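/- **Setting.** Let $N\ge 1$, let $G:\mathbf R^N\times(0,\infty)\to\mathbf R$ and let $\gamma\in\{1,2,\dots\}$, $d>0$, $L>0$ be such that condition (G) holds: (a) $G\in C^\gamma(\mathbf R^N\times(0,\infty))$; (b) $G(x,t)=t^{-N/d}\,G(t^{-1/d}x,1)$ for all $x\in\mathbf R^N$, $t>0$, and $\sup_{x}(1+|x|)^{N+L+j}|\nabla_x^jG(x,1)|<\infty$ for $j=0,\dots,\gamma$; (c) $G(x,t)=\int_{\mathbf R^N}G(x-y,t-s)G(y,s)\,dy$ for all $x\in\mathbf R^N$ and $t>s>0$. Let $e^{t\mathcal L}\varphi(x)=\int_{\mathbf R^N}G(x-y,t)\varphi(y)\,dy$, let $\|\cdot\|_r$ be the norm of $L^r(\mathbf R^N)$, and for $k\ge0$ let $|||\varphi|||_k=\int_{\mathbf R^N}|\varphi(x)|(1+|x|^k)\,dx$. For multi-indices $\alpha$ with $|\alpha|\le\gamma$ let $g_\alpha(x,t)=\frac{(-1)^{|\alpha|}}{\alpha!}\partial_x^\alpha G(x,t+1)$. For $0\le k<L$ with $[k]\le\gamma$ (where $[k]$ is the integer part of $k$),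 $|\alpha|\le k$, $t\ge0$ and $\varphi$ with $|||\varphi|||_k<\infty$ define inductively $$M_\alpha(\varphi,t)=\int_{\mathbf R^N}x^\alpha\varphi(x)\,dx-\sum_{\beta\le\alpha,\ \beta\ne\alpha}M_\beta(\varphi,t)\int_{\mathbf R^N}x^\alpha g_\beta(x,t)\,dx,$$ and put $P_k(t)\varphi=\varphi-\sum_{|\alpha|\le k}M_\alpha(\varphi,t)\,g_\alpha(\cdot,t)$. Let $0\le K<L$ with $[K]+1\le\gamma$ and $1\le q\le\infty$. Call a real-valued measurable function $f$ on $\mathbf R^N\times(0,\infty)$ *admissible* if $$E_{K,q}[f](t)=(1+t)^{\frac Kd}\Big[t^{\frac Nd(1-\frac1q)}\|f(t)\|_q+\|f(t)\|_1\Big]+|||f(t)|||_K$$ belongs to $L^\infty(0,T)$ for every $T>0$, where $f(t)=f(\cdot,t)$. **Theorem.** (i) For every $\alpha$ with $|\alpha|\le K$ there is a constant $C_1>0$ such that for every admissible $f$ $$|M_\alpha(f(t),t)|\le C_1(1+t)^{-\frac{K-|\alpha|}d}E_{K,q}[f](t)\qquad\text{for almost all }t>0.$$ (ii) For every admissible $f$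 and every $t>0$, the integrals below converge absolutely (for almost every $x$) and define $$R_K[f](t)=\int_0^te^{(t-s)\mathcal L}P_K(s)f(s)\,ds=\int_0^te^{(t-s)\mathcal L}f(s)\,ds-\sum_{|\alpha|\le K}\Big[\int_0^tM_\alpha(f(s),s)\,ds\Big]g_\alpha(t)$$ almost everywhere on $\mathbf R^N$. Let $j\in\{0,\dots,\gamma\}$ with $j<d$. For every admissible $f$ and $t>0$ the function $R_K[f](t)$ has weak derivatives of order $j$, whose family is denoted by $\nabla^jR_K[f](t)$; and for every $\ell\in[0,K]$ and $T_0>0$ there is a constant $C_2>0$ such that, for every admissible $f$, every $\epsilon>0$ and every $T\ge T_0$, $$t^{\frac Nd(1-\frac1q)}\|\nabla^jR_K[f](t)\|_q+t^{-\frac\ell d}|||\nabla^jR_K[f](t)|||_\ell\le\epsilon\,t^{-\frac{K+j}d}+C_2\,t^{-\frac Kd}\int_T^t(t-s)^{-\frac jd}E_{K,q}[f](s)\,ds$$ for all sufficiently large $t$. In particular, if $f$ is admissible and $\int_0^\infty E_{K,q}[f](s)\,ds<\infty$, then for every $\ell\in[0,K]$ $$\lim_{t\to\infty}t^{\frac Kd}\Big[t^{\frac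 Nd(1-\frac1q)}\|R_K[f](t)\|_q+t^{-\frac\ell d}|||R_K[f](t)|||_\ell\Big]=0.$$ -/

import Mathlib

open MeasureTheory Set Filter Topology
open scoped ENNReal

noncomputable section

namespace GenHeat

/-- The space `ℝ^N` with its Euclidean norm and Lebesgue measure. -/
abbrev Sp (N : ℕ) : Type := EuclideanSpace ℝ (Fin N)

/-- The length `|α| = ∑ α_i` of a multi-index. -/
def len {N : ℕ} (α : Fin N → ℕ) : ℕ := ∑ i, α i

/-- The finite set of multi-indices `α` with `|α| ≤ k`, for a real number `k ≥ 0`. -/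
def multiIdx (N : ℕ) (k : ℝ) : Finset (Fin N → ℕ) :=
  (Finset.Iic (fun _ => ⌊k⌋₊)).filter (fun α => (len α : ℝ) ≤ k)

theorem mem_multiIdx {N : ℕ} {k : ℝ} {α : Fin N → ℕ} :
    α ∈ multiIdx N k ↔ (len α : ℝ) ≤ k := by
  simp only [multiIdx, Finset.mem_filter, Finset.mem_Iic, and_iff_right_iff_imp]
  intro h i
  refine Nat.le_floor (le_trans ?_ h)
  exact_mod_cast Finset.single_le_sum (f := α) (fun _ _ => Nat.zero_le _) (Finset.mem_univ i)

/-- The finite set of multi-indices `α` with `|α| = j`. -/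
def multiIdxEq (N j : ℕ) : Finset (Fin N → ℕ) := Finset.piAntidiag Finset.univ j

theorem mem_multiIdxEq {N j : ℕ} {α : Fin N → ℕ} : α ∈ multiIdxEq N j ↔ len α = j := by
  simp [multiIdxEq, len]

/-- The monomial `x^α = ∏ x_i ^ α_i`. -/
def mono {N : ℕ} (α : Fin N → ℕ) (x : Sp N) : ℝ := ∏ i, x i ^ α i

/-- `α! = ∏ α_i !`. -/
def multiFact {N : ℕ} (α : Fin N → ℕ) : ℕ := ∏ i, (α i).factorial

/-- The classical partial derivative `∂u/∂x_i`. -/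
def partialD {N : ℕ} (i : Fin N) (u : Sp N → ℝ) : Sp N → ℝ :=
  fun x => fderiv ℝ u x (EuclideanSpace.single i 1)

/-- The classical derivative `∂^α u = ∂_1^{α_1} ⋯ ∂_N^{α_N} u`
(only used for functions of class `C^m` with `|α| ≤ m`). -/
def partialPow {N : ℕ} (α : Fin N → ℕ) (u : Sp N → ℝ) : Sp N → ℝ :=
  (List.finRange N).foldr (fun i v => (partialD i)^[α i] v) u

/-- The Euclidean length of the family of all derivatives of order `j`:
`(∑_{|α| = j} (W_α)^2)^{1/2}`. -/
def nablaLen {N : ℕ} (j : ℕ) (W : (Fin N → ℕ) → Sp N → ℝ) : Sp N → ℝ :=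
  fun x => Real.sqrt (∑ α ∈ multiIdxEq N j, W α x ^ 2)

/-- `w` is a weak (distributional) derivative `∂^α u` on `ℝ^N`. -/
def HasWeakPartial {N : ℕ} (α : Fin N → ℕ) (u w : Sp N → ℝ) : Prop :=
  LocallyIntegrable u ∧ LocallyIntegrable w ∧
    ∀ φ : Sp N → ℝ, ContDiff ℝ (⊤ : ℕ∞) φ → HasCompactSupport φ →
      ∫ x, u x * partialPow α φ x = (-1 : ℝ) ^ len α * ∫ x, w x * φ x

open Classical in
/-- The weak derivative `∂^α u` (unique up to null sets where it exists; `0` by convention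
where it does not exist). -/
def weakPartial {N : ℕ} (α : Fin N → ℕ) (u : Sp N → ℝ) : Sp N → ℝ :=
  if h : ∃ w, HasWeakPartial α u w then h.choose else 0

/-- The function `|∇^j u|`, with `∇^j u` the family of all weak derivatives of order `j`. -/
def weakNablaAbs {N : ℕ} (j : ℕ) (u : Sp N → ℝ) : Sp N → ℝ :=
  nablaLen j (fun α => weakPartial α u)

/-- The weighted norm `|||φ|||_k = ∫ |φ(x)| (1 + |x|^k) dx`, with values in `[0, ∞]`. -/
def wNorm {N : ℕ} (k : ℝ) (φ : Sp N → ℝ) : ℝ≥0∞ :=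
  ∫⁻ x, ‖φ x‖ₑ * ENNReal.ofReal (1 + ‖x‖ ^ k)

/-- Condition (G) for the kernel `G(x, t)`, written `G t x`, with parameters `γ, d, L`. -/
structure CondG {N : ℕ} (G : ℝ → Sp N → ℝ) (γ : ℕ) (d L : ℝ) : Prop where
  γ_pos : 1 ≤ γ
  d_pos : 0 < d
  L_pos : 0 < L
  smooth : ContDiffOn ℝ γ (fun p : Sp N × ℝ => G p.2 p.1) (univ ×ˢ Ioi 0)
  scaling : ∀ (x : Sp N) (t : ℝ), 0 < t →
    G t x = t ^ (-(N : ℝ) / d) * G 1 ((t ^ (1 / d))⁻¹ • x)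
  decay : ∀ j : ℕ, j ≤ γ → ∃ C : ℝ, ∀ x : Sp N,
    (1 + ‖x‖) ^ ((N : ℝ) + L + j) * nablaLen j (fun α => partialPow α (G 1)) x ≤ C
  semigroup : ∀ (x : Sp N) (s t : ℝ), 0 < s → s < t →
    G t x = ∫ y, G (t - s) (x - y) * G s y

/-- The operator `[e^{tL} φ](x) = ∫ G(x - y, t) φ(y) dy`. -/
def expL {N : ℕ} (G : ℝ → Sp N → ℝ) (t : ℝ) (φ : Sp N → ℝ) : Sp N → ℝ :=
  fun x => ∫ y, G t (x - y) * φ y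

/-- `g_α(x, t) = ((-1)^{|α|} / α!) ∂_x^α G(x, t + 1)`. -/
def gFun {N : ℕ} (G : ℝ → Sp N → ℝ) (α : Fin N → ℕ) (t : ℝ) : Sp N → ℝ :=
  fun x => (-1 : ℝ) ^ len α / (multiFact α : ℝ) * partialPow α (G (t + 1)) x

/-- The moments `M_α(φ, t)`, defined inductively by
`M_α(φ, t) = ∫ x^α φ dx - ∑_{β ≤ α, β ≠ α} M_β(φ, t) ∫ x^α g_β(x, t) dx`
(for `α = 0` the sum is empty). -/
def moment {N : ℕ} (G : ℝ → Sp N → ℝ) (φ : Sp N → ℝ) (t : ℝ) (α : Fin N → ℕ) : ℝ :=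
  (∫ x, mono α x * φ x) -
    ∑ β ∈ (Finset.Iio α).attach, moment G φ t β.1 * ∫ x, mono α x * gFun G β.1 t x
termination_by len α
decreasing_by
  have h := Finset.mem_Iio.1 β.2
  obtain ⟨hle, i, hi⟩ := Pi.lt_def.1 h
  exact Finset.sum_lt_sum (fun k _ => hle k) ⟨i, Finset.mem_univ i, hi⟩

theorem moment_eq {N : ℕ} (G : ℝ → Sp N → ℝ) (φ : Sp N → ℝ) (t : ℝ) (α : Fin N → ℕ) :
    moment G φ t α = (∫ x, mono α x * φ x) -
      ∑ β ∈ Finset.Iio α, moment G φ t β * ∫ x, mono α x * gFun G β t x := by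
  rw [moment, ← Finset.sum_attach (Finset.Iio α)]

/-- `[P_k(t) φ](x) = φ(x) - ∑_{|α| ≤ k} M_α(φ, t) g_α(x, t)`. -/
def projP {N : ℕ} (G : ℝ → Sp N → ℝ) (k t : ℝ) (φ : Sp N → ℝ) : Sp N → ℝ :=
  fun x => φ x - ∑ α ∈ multiIdx N k, moment G φ t α * gFun G α t x

/-- The quantity `E_{K,q}[f](t) =
(1+t)^{K/d} [t^{(N/d)(1-1/q)} ‖f(t)‖_q + ‖f(t)‖_1] + |||f(t)|||_K`, with values in `[0, ∞]`;
here `f t` is the function `f(·, t)`. -/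
def EKq {N : ℕ} (d K : ℝ) (q : ℝ≥0∞) (f : ℝ → Sp N → ℝ) (t : ℝ) : ℝ≥0∞ :=
  ENNReal.ofReal ((1 + t) ^ (K / d)) *
      (ENNReal.ofReal (t ^ ((N : ℝ) / d * (1 - (1 / q).toReal))) * eLpNorm (f t) q volume
        + eLpNorm (f t) 1 volume)
    + wNorm K (f t)

/-- The forcing `f` is a (Lebesgue) measurable function on `ℝ^N × (0, ∞)` such that
`E_{K,q}[f]` belongs to `L^∞(0, T)` for every `T > 0`. -/
structure Admissible {N : ℕ} (d K : ℝ) (q : ℝ≥0∞) (f : ℝ → Sp N → ℝ) : Prop where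
  meas : AEStronglyMeasurable (fun p : Sp N × ℝ => f p.2 p.1)
    (volume.restrict (univ ×ˢ Ioi 0))
  bdd : ∀ T : ℝ, 0 < T → essSup (EKq d K q f) (volume.restrict (Ioo 0 T)) < ∞

/-- The remainder `R_K[f](x, t) = ∫_0^t [e^{(t-s)L} P_K(s) f(s)](x) ds`. -/
def remR {N : ℕ} (G : ℝ → Sp N → ℝ) (K : ℝ) (f : ℝ → Sp N → ℝ) (t : ℝ) : Sp N → ℝ :=
  fun x => ∫ s in Ioo 0 t, expL G (t - s) (projP G K s (f s)) x

end GenHeat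

end

open MeasureTheory Set Filter Topology
open scoped ENNReal

noncomputable section

namespace GenHeat

variable {N : ℕ}

/-! ### Iterated partial derivatives along words -/

/-! Functions at time t are measured at the parabolic scale R = t^{1/d} by `zN`: R^{N(1-1/q)} times
the L^q norm, plus the L^1 norm with weight (1+|x|/R)^K. This weight is submultiplicative, so
convolution respects the weighted norm (`nW_cv_le`), and the self-similarity of G makes the norm of
a kernel at its own scale independent of time, up to a factor t^{-j/d} for j derivatives.

Cancellation comes from the moments. Integration by parts shows that ∫ x^α g_β is 1 for β = α and 0
unless β ≤ α, so the recursion for M_α solves a triangular system and P_K(s)f(s) has vanishing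
moments up to order [K] (`CondG.moments_projP`). This needs ∫ G = 1, which condition (G) does not
state. Letting one of the two times in the semigroup law tend to 0 gives G(·,1) = (∫ G(·,1)) G(·,1),
so either the mass is 1 or G vanishes and the decay estimate is trivial (`CondG.mass_eq_one_or`). At
scale (s+1)^{1/d} the growth of M_α compensates the decay of g_α, so P_K(s) is bounded uniformly in
s (`CondG.exists_zN_projP_le`); the definition of E_{K,q} then yields the factor (s+1)^{-K/d}
(`CondG.exists_projP_bounds`).

The integrand of R_K[f](t) is estimated separately on the two sides of s = t/2. For s ≥ t/2 the
scales of s+1 and t are comparable and plain convolution bounds suffice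
(`CondG.exists_zN_cv_le_late`). For s < t/2 the kernel is factored into two halves: one carries the
derivatives and the L^1-L^q smoothing, the other is replaced by its Taylor error, which gains
t^{-K/d} (`CondG.exists_nW_cv_le_of_moments`, `CondG.exists_zN_cv_le_early`). The early bound
retains the functional `qW`, whose integrand is the minimum of |y|^K and |y|^{[K]+1}
t^{-([K]+1-K)/d}, against |P_K(s)f(s)|. Since K < [K]+1, its integral over a bounded time interval
tends to 0 by dominated convergence (`CondG.tendsto_lintegral_qW`), which is the source of the ε
term. Minkowski's inequality integrates the pointwise-in-time bounds (`CondG.exists_zN_duhamel_le`).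

Weak derivatives of order j < d exist because (t-s)^{-j/d} is integrable, so Fubini's theorem moves
derivatives from the test function to the kernel (`CondG.hasWeakPartial_duhamel`). Measurability in
time is handled by replacing f with a jointly measurable representative and the derivatives of the
kernel with their explicit scaling formula `kern`. -/

/-- The iterated partial derivative `∂_{w_1} ⋯ ∂_{w_n} u` along a word `w`. -/
def wordD (w : List (Fin N)) (u : Sp N → ℝ) : Sp N → ℝ := w.foldr partialD u

@[simp] theorem wordD_nil (u : Sp N → ℝ) : wordD [] u = u := rfl

@[simp] theorem wordD_cons (i : Fin N) (w : List (Fin N)) (u : Sp N → ℝ) :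
    wordD (i :: w) u = partialD i (wordD w u) := rfl

theorem wordD_append (w w' : List (Fin N)) (u : Sp N → ℝ) :
    wordD (w ++ w') u = wordD w (wordD w' u) := by
  simp [wordD]

theorem contDiff_partialD {n : ℕ} {u : Sp N → ℝ} (hu : ContDiff ℝ (n + 1 : ℕ) u) (i : Fin N) :
    ContDiff ℝ n (partialD i u) := by
  have h : ContDiff ℝ n (fderiv ℝ u) := hu.fderiv_right (by norm_cast)
  exact h.clm_apply contDiff_const

theorem contDiff_wordD {n : ℕ} (w : List (Fin N)) {u : Sp N → ℝ}
    (hu : ContDiff ℝ (n + w.length : ℕ) u) : ContDiff ℝ n (wordD w u) := by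
  induction w generalizing n with
  | nil => simpa using hu
  | cons i w ih =>
    refine contDiff_partialD (ih ?_) i
    rw [List.length_cons] at hu
    convert hu using 2
    ring

theorem contDiff_wordD_of_le {n m : ℕ} (w : List (Fin N)) {u : Sp N → ℝ}
    (hu : ContDiff ℝ m u) (h : n + w.length ≤ m) : ContDiff ℝ n (wordD w u) :=
  contDiff_wordD w (hu.of_le (by exact_mod_cast h))

theorem contDiff_top_wordD (w : List (Fin N)) {u : Sp N → ℝ}
    (hu : ContDiff ℝ (⊤ : ℕ∞) u) : ContDiff ℝ (⊤ : ℕ∞) (wordD w u) := by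
  rw [contDiff_infty] at hu ⊢
  exact fun n => contDiff_wordD w (hu _)

theorem partialD_comm {u : Sp N → ℝ} (hu : ContDiff ℝ 2 u) (i j : Fin N) :
    partialD i (partialD j u) = partialD j (partialD i u) := by
  funext x
  have hd : DifferentiableAt ℝ (fderiv ℝ u) x :=
    ((hu.fderiv_right (m := 1) (by norm_num)).differentiable one_ne_zero).differentiableAt
  have key : ∀ i j : Fin N, partialD i (partialD j u) x =
      fderiv ℝ (fderiv ℝ u) x (EuclideanSpace.single i 1) (EuclideanSpace.single j 1) := by
    intro i j
    unfold partialD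
    rw [fderiv_clm_apply hd (differentiableAt_const _)]
    simp
  rw [key, key]
  exact hu.contDiffAt.isSymmSndFDerivAt (by simp) _ _

/-- Permutations are generated by swaps of the two leading letters below a common prefix, so
Schwarz's theorem is enough; the tail uses up all but two orders of smoothness. -/
theorem wordD_perm {w w' : List (Fin N)} (h : w.Perm w') {u : Sp N → ℝ}
    (hu : ContDiff ℝ w.length u) : wordD w u = wordD w' u := by
  induction h with
  | nil => rfl
  | cons i _ ih =>
    rw [wordD_cons, wordD_cons, ih (hu.of_le (by simp))]
  | swap i j l =>
    rw [wordD_cons, wordD_cons, wordD_cons, wordD_cons]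
    refine partialD_comm (contDiff_wordD l (n := 2) (hu.of_le ?_)) _ _
    simp only [List.length_cons]
    norm_cast
    omega
  | trans h₁ _ ih₁ ih₂ =>
    rw [ih₁ hu, ih₂ (by rwa [← h₁.length_eq])]

/-- The sorted word with content `α`. -/
def wordOf (α : Fin N → ℕ) : List (Fin N) :=
  (List.finRange N).flatMap fun i => List.replicate (α i) i

theorem partialPow_eq_wordD (α : Fin N → ℕ) (u : Sp N → ℝ) :
    partialPow α u = wordD (wordOf α) u := by
  unfold partialPow wordOf
  induction List.finRange N with
  | nil => rfl
  | cons i l ih =>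
    rw [List.foldr_cons, ih, List.flatMap_cons, wordD_append]
    generalize wordD (List.flatMap _ l) u = v
    induction α i with
    | zero => rfl
    | succ n ihn => rw [Function.iterate_succ_apply', ihn]; rfl

theorem length_wordOf (α : Fin N → ℕ) : (wordOf α).length = len α := by
  simp only [wordOf, List.length_flatMap, List.length_replicate, len]
  rw [← List.sum_ofFn]
  congr 1
  exact List.ofFn_eq_map.symm

theorem count_wordOf (α : Fin N → ℕ) (i : Fin N) : (wordOf α).count i = α i := by
  have : ∀ l : List (Fin N), l.Nodup → i ∈ l →
      (l.flatMap fun i => List.replicate (α i) i).count i = α i := by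
    intro l hl hi
    induction l with
    | nil => simp at hi
    | cons j l ih =>
      rw [List.flatMap_cons, List.count_append, List.count_replicate]
      rw [List.nodup_cons] at hl
      by_cases hij : j = i
      · subst hij
        have : (l.flatMap fun i => List.replicate (α i) i).count j = 0 := by
          rw [List.count_eq_zero]
          simp only [List.mem_flatMap, List.mem_replicate, not_exists, not_and]
          rintro k hk - rfl
          exact hl.1 hk
        simp [this]
      · have hi' : i ∈ l := by
          rcases List.mem_cons.1 hi with h | h
          · exact absurd h.symm hij
          · exact h
        simp [hij, ih hl.2 hi']
  exact this _ (List.nodup_finRange N) (List.mem_finRange i)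

/-- The content of a word: the multi-index of its letter counts. -/
def content (w : List (Fin N)) : Fin N → ℕ := fun i => w.count i

theorem perm_wordOf_content (w : List (Fin N)) : w.Perm (wordOf (content w)) := by
  rw [List.perm_iff_count]
  intro i
  rw [count_wordOf]
  rfl

theorem len_content (w : List (Fin N)) : len (content w) = w.length := by
  rw [← length_wordOf, ← (perm_wordOf_content w).length_eq]

theorem wordD_eq_partialPow (w : List (Fin N)) {u : Sp N → ℝ} (hu : ContDiff ℝ w.length u) :
    wordD w u = partialPow (content w) u := by
  rw [partialPow_eq_wordD]
  exact wordD_perm (perm_wordOf_content w) hu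

theorem mono_content (w : List (Fin N)) (x : Sp N) :
    mono (content w) x = (w.map fun i => x i).prod := by
  unfold mono content
  rw [Finset.prod_list_map_count]
  refine (Finset.prod_subset (Finset.subset_univ _) fun i _ hi => ?_).symm
  rw [List.mem_toFinset] at hi
  simp [List.count_eq_zero.2 hi]

theorem abs_mono_le (α : Fin N → ℕ) (x : Sp N) : |mono α x| ≤ ‖x‖ ^ len α := by
  unfold mono len
  rw [Finset.abs_prod, ← Finset.prod_pow_eq_pow_sum]
  refine Finset.prod_le_prod (fun _ _ => abs_nonneg _) fun i _ => ?_
  rw [abs_pow]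
  exact pow_le_pow_left₀ (abs_nonneg _) (by simpa using PiLp.norm_apply_le x i) _

theorem continuous_mono (α : Fin N → ℕ) : Continuous (mono α : Sp N → ℝ) := by
  unfold mono
  fun_prop

theorem partialD_smul_comp (a c : ℝ) (i : Fin N) (u : Sp N → ℝ) :
    partialD i (fun x => a * u (c • x)) = fun x => a * c * partialD i u (c • x) := by
  funext x
  unfold partialD
  have h : (fun x => a * u (c • x)) = a • (fun x => u (c • x)) := rfl
  rw [h, fderiv_const_smul_field, Pi.smul_apply, fderiv_comp_smul]
  simp [mul_assoc]

theorem wordD_smul_comp (a c : ℝ) (w : List (Fin N)) (u : Sp N → ℝ) :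
    wordD w (fun x => a * u (c • x)) = fun x => a * c ^ w.length * wordD w u (c • x) := by
  induction w with
  | nil => simp
  | cons i w ih =>
    rw [wordD_cons, ih, partialD_smul_comp]
    funext x
    simp [pow_succ, mul_assoc]

theorem wordD_comp_sub (y : Sp N) (w : List (Fin N)) (u : Sp N → ℝ) :
    wordD w (fun x => u (x - y)) = fun x => wordD w u (x - y) := by
  induction w with
  | nil => simp
  | cons i w ih =>
    rw [wordD_cons, ih]
    funext x
    simp only [partialD, wordD_cons]
    rw [fderiv_comp_sub]

/-! ### Taylor's formula -/

/-- The derivative of the remainder of `h 0` is the remainder of `h 1` one order lower, so the mean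
value inequality on [0,1] passes the bound B upwards by induction. The gain of 1/(m+1)! is given up.
-/
theorem taylor_one_dim (m : ℕ) (h : ℕ → ℝ → ℝ) (B : ℝ)
    (hd : ∀ n ≤ m, ∀ θ ∈ Icc (0 : ℝ) 1, HasDerivAt (h n) (h (n + 1) θ) θ)
    (hB : ∀ θ ∈ Icc (0 : ℝ) 1, |h (m + 1) θ| ≤ B) :
    ∀ θ ∈ Icc (0 : ℝ) 1,
      |h 0 θ - ∑ n ∈ Finset.range (m + 1), θ ^ n / n.factorial * h n 0| ≤ B := by
  induction m generalizing h with
  | zero =>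
    intro θ hθ
    have := (convex_Icc (0 : ℝ) 1).norm_image_sub_le_of_norm_hasDerivWithin_le
      (fun x hx => (hd 0 le_rfl x hx).hasDerivWithinAt) (fun x hx => hB x hx)
      (left_mem_Icc.2 zero_le_one) hθ
    have hB0 : 0 ≤ B := (abs_nonneg _).trans (hB θ hθ)
    simp only [Real.norm_eq_abs, sub_zero, abs_of_nonneg hθ.1] at this
    simpa using this.trans (mul_le_of_le_one_right hB0 hθ.2)
  | succ m ih =>
    intro θ hθ
    have key := ih (fun n => h (n + 1)) (fun n hn => hd (n + 1) (by omega)) hB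
    have hder : ∀ x ∈ Icc (0 : ℝ) 1, HasDerivWithinAt
        (fun θ => h 0 θ - ∑ n ∈ Finset.range (m + 1 + 1), θ ^ n / n.factorial * h n 0)
        (h 1 x - ∑ n ∈ Finset.range (m + 1), x ^ n / n.factorial * h (n + 1) 0)
        (Icc 0 1) x := by
      intro x hx
      refine HasDerivAt.hasDerivWithinAt ((hd 0 (by omega) x hx).sub ?_)
      have hs : HasDerivAt
          (fun θ : ℝ => ∑ n ∈ Finset.range (m + 1 + 1), θ ^ n / n.factorial * h n 0)
          (∑ n ∈ Finset.range (m + 1 + 1), (n * x ^ (n - 1)) / n.factorial * h n 0) x := by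
        refine HasDerivAt.fun_sum fun n _ => ?_
        exact ((hasDerivAt_pow n x).div_const _).mul_const _
      refine hs.congr_deriv ?_
      rw [Finset.sum_range_succ' _ (m + 1)]
      simp only [Nat.cast_zero, zero_mul, zero_div, add_zero]
      refine Finset.sum_congr rfl fun n _ => ?_
      rw [Nat.factorial_succ, Nat.add_sub_cancel]
      have : (n.factorial : ℝ) ≠ 0 := by positivity
      have : (n + 1 : ℝ) ≠ 0 := by positivity
      push_cast
      field_simp
    have hB0 : 0 ≤ B := (abs_nonneg _).trans (hB θ hθ)
    have := (convex_Icc (0 : ℝ) 1).norm_image_sub_le_of_norm_hasDerivWithin_le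
      hder key (left_mem_Icc.2 zero_le_one) hθ
    simp only [Real.norm_eq_abs, sub_zero, abs_of_nonneg hθ.1] at this
    have h0 : h 0 0 - ∑ n ∈ Finset.range (m + 1 + 1), (0 : ℝ) ^ n / n.factorial * h n 0 = 0 := by
      rw [Finset.sum_range_succ' _ (m + 1)]
      simp
    rw [h0, sub_zero] at this
    exact this.trans (mul_le_of_le_one_right hB0 hθ.2)

/-- The homogeneous part of order `n` of the Taylor expansion of `u` at `x`, in direction `v`,
up to the factor `1 / n!`. -/
def homPart (n : ℕ) (u : Sp N → ℝ) (x v : Sp N) : ℝ :=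
  ∑ w : Fin n → Fin N, (∏ i, v (w i)) * wordD (List.ofFn w) u x

/-- The Taylor polynomial of order `m` of `u` at `x`. -/
def taylorPoly (m : ℕ) (u : Sp N → ℝ) (x v : Sp N) : ℝ :=
  ∑ n ∈ Finset.range (m + 1), (n.factorial : ℝ)⁻¹ * homPart n u x v

theorem hasDerivAt_line {u : Sp N → ℝ} (hu : ContDiff ℝ 1 u) (x v : Sp N) (θ : ℝ) :
    HasDerivAt (fun θ : ℝ => u (x + θ • v)) (∑ i, v i * partialD i u (x + θ • v)) θ := by
  have h1 : HasDerivAt (fun θ : ℝ => x + θ • v) v θ := by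
    simpa using ((hasDerivAt_id θ).smul_const v).const_add x
  have h2 := ((hu.differentiable one_ne_zero) (x + θ • v)).hasFDerivAt.comp_hasDerivAt θ h1
  refine h2.congr_deriv ?_
  unfold partialD
  generalize fderiv ℝ u (x + θ • v) = A
  conv_lhs => rw [← (EuclideanSpace.basisFun (Fin N) ℝ).sum_repr v]
  simp [map_sum]

/-- Differentiation along the line prepends one letter to each word, and words of length n+1 are
exactly a letter followed by a word of length n. -/
theorem hasDerivAt_homPart {m n : ℕ} {u : Sp N → ℝ} (hu : ContDiff ℝ (m + 1 : ℕ) u) (hn : n ≤ m)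
    (x v : Sp N) (θ : ℝ) :
    HasDerivAt (fun θ : ℝ => homPart n u (x + θ • v) v) (homPart (n + 1) u (x + θ • v) v) θ := by
  have h1 : HasDerivAt (fun θ : ℝ => homPart n u (x + θ • v) v)
      (∑ w : Fin n → Fin N, (∏ i, v (w i)) *
        ∑ i, v i * partialD i (wordD (List.ofFn w) u) (x + θ • v)) θ := by
    unfold homPart
    refine HasDerivAt.fun_sum fun w _ => ?_
    refine (hasDerivAt_line (contDiff_wordD_of_le (n := 1) _ hu ?_) x v θ).const_mul _
    simp
    omega
  refine h1.congr_deriv ?_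
  symm
  unfold homPart
  rw [← (Fin.consEquiv (fun _ : Fin (n + 1) => Fin N)).sum_comp, Fintype.sum_prod_type,
    Finset.sum_comm]
  refine Finset.sum_congr rfl fun w _ => ?_
  rw [Finset.mul_sum]
  refine Finset.sum_congr rfl fun i _ => ?_
  simp only [Fin.consEquiv_apply, Fin.prod_univ_succ, Fin.cons_zero, Fin.cons_succ,
    List.ofFn_succ, wordD_cons]
  ring

theorem prod_abs_le {n : ℕ} (v : Sp N) (w : Fin n → Fin N) : |∏ i, v (w i)| ≤ ‖v‖ ^ n := by
  rw [Finset.abs_prod]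
  refine (Finset.prod_le_prod (fun _ _ => abs_nonneg _)
    (fun i _ => (by simpa using PiLp.norm_apply_le v (w i) : |v (w i)| ≤ ‖v‖))).trans ?_
  simp

theorem abs_homPart_le {n : ℕ} {u : Sp N → ℝ} {x v : Sp N} {B : ℝ}
    (hB : ∀ w : Fin n → Fin N, |wordD (List.ofFn w) u x| ≤ B) :
    |homPart n u x v| ≤ (N : ℝ) ^ n * (‖v‖ ^ n * B) := by
  unfold homPart
  refine (Finset.abs_sum_le_sum_abs _ _).trans ?_
  refine (Finset.sum_le_card_nsmul _ _ (‖v‖ ^ n * B) fun w _ => ?_).trans ?_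
  · rw [abs_mul]
    exact mul_le_mul (prod_abs_le v w) (hB w) (abs_nonneg _) (by positivity)
  · simp

/-- One-dimensional Taylor along the segment from x to x+v, evaluated at its end; N^{m+1} counts the
words of length m+1. -/
theorem abs_sub_taylorPoly_le {m : ℕ} {u : Sp N → ℝ} (hu : ContDiff ℝ (m + 1 : ℕ) u)
    {x v : Sp N} {B : ℝ}
    (hB : ∀ θ ∈ Icc (0 : ℝ) 1, ∀ w : Fin (m + 1) → Fin N,
      |wordD (List.ofFn w) u (x + θ • v)| ≤ B) :
    |u (x + v) - taylorPoly m u x v| ≤ (N : ℝ) ^ (m + 1) * (‖v‖ ^ (m + 1) * B) := by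
  have := taylor_one_dim m (fun n θ => homPart n u (x + θ • v) v) _
    (fun n hn θ _ => hasDerivAt_homPart hu hn x v θ)
    (fun θ hθ => abs_homPart_le (hB θ hθ)) 1 (right_mem_Icc.2 zero_le_one)
  simpa [taylorPoly, homPart] using this

/-! ### Minkowski's integral inequality -/

section Minkowski

variable {α β : Type*} [MeasurableSpace α] [MeasurableSpace β]

theorem measurable_eLpNorm_section {μ : Measure α} [SFinite μ] {F : β → α → ℝ≥0∞}
    (hF : Measurable (Function.uncurry F)) (p : ℝ≥0∞) :
    Measurable fun s => eLpNorm (F s) p μ := by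
  rcases eq_or_ne p 0 with rfl | hp0
  · simp
  rcases eq_or_ne p ∞ with rfl | hp
  · simp only [eLpNorm_exponent_top, eLpNormEssSup, enorm_eq_self]
    refine measurable_of_Ioi fun c => ?_
    -- The essential supremum exceeds c exactly when a superlevel section has positive measure, and
    -- measures of sections depend measurably on s.
    have : (fun s => essSup (F s) μ) ⁻¹' Ioi c = {s | μ (Prod.mk s ⁻¹' {p | c < F p.1 p.2}) = 0}ᶜ := by
      ext s
      simp only [mem_preimage, mem_Ioi, mem_compl_iff, Set.mem_ofPred_eq]
      rw [← not_le, not_iff_not]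
      constructor
      · intro h
        have := (ENNReal.ae_le_essSup (F s) (μ := μ)).mono fun x hx => hx.trans h
        simpa [ae_iff] using this
      · intro h
        refine essSup_le_of_ae_le _ ?_
        rw [Filter.EventuallyLE, ae_iff]
        simpa using h
    rw [this]
    have hs : MeasurableSet {p : β × α | c < F p.1 p.2} := measurableSet_lt measurable_const hF
    exact ((measurable_measure_prodMk_left hs) (measurableSet_singleton 0)).compl
  · simp only [eLpNorm_eq_lintegral_rpow_enorm_toReal hp0 hp, enorm_eq_self]
    refine Measurable.pow_const ?_ _
    exact (hF.pow_const p.toReal).lintegral_prod_right'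

/-- For 1 < p < ∞, write a(s) for the norm of F(s) and apply Hölder to F = a^{1/p'} · F a^{-1/p'}.
This gives (∫F)^p ≤ (∫a)^{p-1} ∫ F^p a^{1-p}, and Tonelli turns the last integral into at most ∫a.
The case p = 1 is Tonelli; p = ∞ exchanges two almost-everywhere quantifiers. -/
theorem eLpNorm_lintegral_le {μ : Measure α} {ν : Measure β} [SFinite μ] [SFinite ν]
    {F : β → α → ℝ≥0∞} (hF : Measurable (Function.uncurry F)) {p : ℝ≥0∞} (hp : 1 ≤ p) :
    eLpNorm (fun x => ∫⁻ s, F s x ∂ν) p μ ≤ ∫⁻ s, eLpNorm (F s) p μ ∂ν := by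
  have ham := measurable_eLpNorm_section (μ := μ) hF p
  have hsw : Measurable (Function.uncurry fun x s => F s x) := hF.comp measurable_swap
  have hFs : ∀ s, Measurable (F s) := fun s => hF.comp measurable_prodMk_left
  rcases eq_or_ne p ∞ with rfl | hpt
  · have h1 : ∀ᵐ s ∂ν, ∀ᵐ x ∂μ, F s x ≤ eLpNorm (F s) ∞ μ := by
      refine Eventually.of_forall fun s => ?_
      simpa [eLpNorm_exponent_top, eLpNormEssSup] using ENNReal.ae_le_essSup (F s) (μ := μ)
    have h2 : ∀ᵐ x ∂μ, ∀ᵐ s ∂ν, F s x ≤ eLpNorm (F s) ∞ μ := by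
      refine (Measure.ae_ae_comm ?_).1 h1
      exact measurableSet_le hF (ham.comp measurable_fst)
    rw [eLpNorm_exponent_top, eLpNormEssSup]
    refine essSup_le_of_ae_le _ (h2.mono fun x hx => ?_)
    simpa using lintegral_mono_ae hx
  have hp0 : p ≠ 0 := (zero_lt_one.trans_le hp).ne'
  rcases eq_or_lt_of_le hp with rfl | hp1
  · simp only [eLpNorm_one_eq_lintegral_enorm, enorm_eq_self]
    rw [lintegral_lintegral_swap hsw.aemeasurable]
  set P := p.toReal with hP
  have hP1 : 1 < P := by
    rw [hP, ← ENNReal.toReal_one]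
    exact (ENNReal.toReal_lt_toReal (by simp) hpt).2 hp1
  have hP0 : 0 < P := by linarith
  set a : β → ℝ≥0∞ := fun s => eLpNorm (F s) p μ with ha
  have hapow : ∀ s, ∫⁻ x, F s x ^ P ∂μ = a s ^ P := by
    intro s
    simp only [ha, eLpNorm_eq_lintegral_rpow_enorm_toReal hp0 hpt, enorm_eq_self]
    rw [← ENNReal.rpow_mul, ← hP, one_div, inv_mul_cancel₀ hP0.ne', ENNReal.rpow_one]
  rcases eq_or_ne (∫⁻ s, a s ∂ν) ∞ with hA | hA
  · rw [hA]; exact le_top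
  have hfin : ∀ᵐ s ∂ν, a s < ∞ := ae_lt_top ham hA
  -- The factorisation divides by a(s), so times with a(s) = 0 must be harmless: there F(s) vanishes
  -- almost everywhere.
  have hzero : ∀ᵐ x ∂μ, ∀ᵐ s ∂ν, a s = 0 → F s x = 0 := by
    refine (Measure.ae_ae_comm (p := fun s x => a s = 0 → F s x = 0) ?_).1 ?_
    · have h1 : MeasurableSet {z : β × α | a z.1 = 0} :=
        (ham.comp measurable_fst) (measurableSet_singleton 0)
      have h2 : MeasurableSet {z : β × α | F z.1 z.2 = 0} := hF (measurableSet_singleton 0)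
      have : {z : β × α | a z.1 = 0 → F z.1 z.2 = 0} =
          {z | a z.1 = 0}ᶜ ∪ {z | F z.1 z.2 = 0} := by
        ext z; simp [imp_iff_not_or]
      rw [this]
      exact h1.compl.union h2
    · refine Eventually.of_forall fun s => ?_
      by_cases h0 : a s = 0
      · have h1 := hapow s
        rw [h0, ENNReal.zero_rpow_of_pos hP0,
          lintegral_eq_zero_iff ((hFs s).pow_const P)] at h1
        refine h1.mono fun x hx _ => ?_
        simpa [ENNReal.rpow_eq_zero_iff, hP0, hP0.not_gt] using hx
      · simp [h0]
  set P' := P.conjExponent with hP'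
  have hconj : P'.HolderConjugate P := (Real.HolderConjugate.conjExponent hP1).symm
  have hP'0 : 0 < P' := hconj.pos
  have hdiv : P / P' = P - 1 := by
    rw [hP', Real.conjExponent]
    have : P - 1 ≠ 0 := by linarith
    field_simp
  have hpt : ∀ᵐ x ∂μ, (∫⁻ s, F s x ∂ν) ^ P ≤
      (∫⁻ s, a s ∂ν) ^ (P - 1) * ∫⁻ s, F s x ^ P * a s ^ (1 - P) ∂ν := by
    filter_upwards [hzero] with x hx
    have h1 : ∫⁻ s, F s x ∂ν ≤ ∫⁻ s, ((fun s => a s ^ (1 / P')) *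
        (fun s => F s x * a s ^ (-(1 / P')))) s ∂ν := by
      refine lintegral_mono_ae ?_
      filter_upwards [hx, hfin] with s hs hs'
      by_cases h0 : a s = 0
      · rw [hs h0]; exact zero_le
      · simp only [Pi.mul_apply]
        rw [mul_left_comm, ← ENNReal.rpow_add _ _ h0 hs'.ne]
        simp
    have h2 := ENNReal.lintegral_mul_le_Lp_mul_Lq ν hconj
      (f := fun s => a s ^ (1 / P')) (g := fun s => F s x * a s ^ (-(1 / P')))
      (ham.pow_const _).aemeasurable
      ((hF.comp measurable_prodMk_right).mul (ham.pow_const _)).aemeasurable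
    refine (ENNReal.rpow_le_rpow (h1.trans h2) hP0.le).trans ?_
    rw [ENNReal.mul_rpow_of_nonneg _ _ hP0.le, ← ENNReal.rpow_mul, ← ENNReal.rpow_mul]
    refine mul_le_mul' ?_ ?_
    · simp only [← ENNReal.rpow_mul]
      rw [one_div_mul_cancel hP'0.ne', one_div_mul_eq_div, hdiv]
      simp
    · rw [one_div_mul_cancel hP0.ne', ENNReal.rpow_one]
      refine lintegral_mono fun s => ?_
      rw [ENNReal.mul_rpow_of_nonneg _ _ hP0.le, ← ENNReal.rpow_mul, neg_mul, one_div_mul_eq_div,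
        hdiv, neg_sub]
  have hmain : ∫⁻ x, (∫⁻ s, F s x ∂ν) ^ P ∂μ ≤ (∫⁻ s, a s ∂ν) ^ P := by
    have hA' : (∫⁻ s, a s ∂ν) ^ (P - 1) ≠ ∞ := ENNReal.rpow_ne_top_of_nonneg (by linarith) hA
    refine (lintegral_mono_ae hpt).trans ?_
    rw [lintegral_const_mul' _ _ hA']
    have hm : Measurable (Function.uncurry fun x s => F s x ^ P * a s ^ (1 - P)) :=
      (hsw.pow_const P).mul ((ham.comp measurable_snd).pow_const _)
    rw [lintegral_lintegral_swap hm.aemeasurable]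
    have h3 : ∫⁻ s, ∫⁻ x, F s x ^ P * a s ^ (1 - P) ∂μ ∂ν ≤ ∫⁻ s, a s ∂ν := by
      refine lintegral_mono_ae (hfin.mono fun s hs => ?_)
      rw [lintegral_mul_const _ ((hFs s).pow_const P), hapow]
      by_cases h0 : a s = 0
      · rw [h0, ENNReal.zero_rpow_of_pos hP0, zero_mul]
      · rw [← ENNReal.rpow_add _ _ h0 hs.ne]
        simp
    refine (mul_le_mul_right h3 _).trans ?_
    by_cases h0 : ∫⁻ s, a s ∂ν = 0
    · rw [h0, mul_zero]; exact zero_le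
    · nth_rewrite 2 [← ENNReal.rpow_one (∫⁻ s, a s ∂ν)]
      rw [← ENNReal.rpow_add _ _ h0 hA]
      simp
  rw [eLpNorm_eq_lintegral_rpow_enorm_toReal hp0 (by assumption)]
  simp only [enorm_eq_self]
  refine (ENNReal.rpow_le_rpow hmain (by positivity)).trans ?_
  rw [← ENNReal.rpow_mul, ← hP, mul_one_div_cancel hP0.ne', ENNReal.rpow_one]

end Minkowski

/-! ### Weights -/

/-- The submultiplicative weight `(1 + |x| / ρ)^K`. -/
def wt (K ρ : ℝ) (x : Sp N) : ℝ := (1 + ‖x‖ / ρ) ^ K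

/-- The norm of `φ` in `L^1` with weight `(1 + |x| / ρ)^K`. -/
def nW (K ρ : ℝ) (φ : Sp N → ℝ) : ℝ≥0∞ := ∫⁻ x, ‖φ x‖ₑ * ENNReal.ofReal (wt K ρ x)

section Weights

variable {K ρ R : ℝ}

theorem one_le_wt (hK : 0 ≤ K) (hρ : 0 ≤ ρ) (x : Sp N) : 1 ≤ wt K ρ x :=
  Real.one_le_rpow (by have : 0 ≤ ‖x‖ / ρ := by positivity
                       linarith) hK

theorem wt_pos (hρ : 0 ≤ ρ) (x : Sp N) : 0 < wt K ρ x := by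
  have : 0 ≤ ‖x‖ / ρ := by positivity
  unfold wt
  positivity

theorem measurable_wt (K ρ : ℝ) : Measurable (wt K ρ : Sp N → ℝ) := by
  unfold wt
  fun_prop

/-- Since 1+a+b ≤ (1+a)(1+b). This is the reason for working with (1+|x|/ρ)^K instead of the weight
1+|x|^K of `wNorm`. -/
theorem wt_add_le (hK : 0 ≤ K) (hρ : 0 < ρ) (x y : Sp N) :
    wt K ρ (x + y) ≤ wt K ρ x * wt K ρ y := by
  unfold wt
  rw [← Real.mul_rpow (by positivity) (by positivity)]
  refine Real.rpow_le_rpow (by positivity) ?_ hK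
  have h1 : ‖x + y‖ / ρ ≤ ‖x‖ / ρ + ‖y‖ / ρ := by
    rw [← add_div]
    exact div_le_div_of_nonneg_right (norm_add_le x y) hρ.le
  have h2 : 0 ≤ ‖x‖ / ρ * (‖y‖ / ρ) := by positivity
  nlinarith

theorem wt_le_wt (hK : 0 ≤ K) (hρ : 0 < ρ) (h : ρ ≤ R) (x : Sp N) : wt K R x ≤ wt K ρ x := by
  unfold wt
  have hR : 0 < R := hρ.trans_le h
  exact Real.rpow_le_rpow (by positivity) (by gcongr) hK

theorem wt_le_mul_wt (hK : 0 ≤ K) {c : ℝ} (hc : 1 ≤ c) (hρ : 0 < ρ) (hR : 0 < R)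
    (h : ρ ≤ c * R) (x : Sp N) : wt K R x ≤ c ^ K * wt K ρ x := by
  unfold wt
  rw [← Real.mul_rpow (by positivity) (by positivity)]
  refine Real.rpow_le_rpow (by positivity) ?_ hK
  have : ‖x‖ / R ≤ c * (‖x‖ / ρ) := by
    rw [← mul_div_assoc, div_le_div_iff₀ hR hρ]
    nlinarith [norm_nonneg x]
  nlinarith

theorem wt_smul {r : ℝ} (hr : 0 < r) (x : Sp N) : wt K 1 (r⁻¹ • x) = wt K r x := by
  unfold wt
  rw [norm_smul, norm_inv, Real.norm_eq_abs, abs_of_pos hr, div_one, div_eq_inv_mul]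

theorem pow_le_wt {a : ℝ} (ha0 : 0 ≤ a) (ha : a ≤ K) (hρ : 0 < ρ) (x : Sp N) :
    ‖x‖ ^ a ≤ ρ ^ a * wt K ρ x := by
  have h1 : ‖x‖ ^ a = ρ ^ a * (‖x‖ / ρ) ^ a := by
    rw [← Real.mul_rpow hρ.le (by positivity), mul_div_cancel₀ _ hρ.ne']
  rw [h1]
  refine mul_le_mul_of_nonneg_left ?_ (by positivity)
  have h0 : 0 ≤ ‖x‖ / ρ := by positivity
  calc (‖x‖ / ρ) ^ a ≤ (1 + ‖x‖ / ρ) ^ a := Real.rpow_le_rpow h0 (by linarith) ha0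
    _ ≤ wt K ρ x := Real.rpow_le_rpow_of_exponent_le (by linarith) ha

/-- Comparison with the weight of `wNorm`: the larger of 1 and |x|/ρ is doubled. -/
theorem wt_le_one_add (hK : 0 ≤ K) (hρ : 0 < ρ) (x : Sp N) :
    wt K ρ x ≤ 2 ^ K * (1 + ρ ^ (-K) * ‖x‖ ^ K) := by
  have h0 : 0 ≤ ‖x‖ / ρ := by positivity
  have h1 : ρ ^ (-K) * ‖x‖ ^ K = (‖x‖ / ρ) ^ K := by
    rw [Real.div_rpow (norm_nonneg _) hρ.le, Real.rpow_neg hρ.le]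
    field_simp
  rw [h1]
  unfold wt
  generalize ‖x‖ / ρ = y at h0
  rcases le_total y 1 with h | h
  · have : (1 + y) ^ K ≤ 2 ^ K := Real.rpow_le_rpow (by positivity) (by linarith) hK
    have h3 : 0 ≤ y ^ K := by positivity
    have h4 : (0 : ℝ) < 2 ^ K := by positivity
    nlinarith
  · have : (1 + y) ^ K ≤ (2 * y) ^ K := Real.rpow_le_rpow (by positivity) (by linarith) hK
    rw [Real.mul_rpow (by norm_num) h0] at this
    have h4 : (0 : ℝ) < 2 ^ K := by positivity
    nlinarith

theorem nW_le_nW (hK : 0 ≤ K) (hρ : 0 < ρ) (h : ρ ≤ R) (φ : Sp N → ℝ) :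
    nW K R φ ≤ nW K ρ φ := by
  refine lintegral_mono fun x => ?_
  gcongr
  exact wt_le_wt hK hρ h x

theorem nW_le_mul_nW (hK : 0 ≤ K) {c : ℝ} (hc : 1 ≤ c) (hρ : 0 < ρ) (hR : 0 < R)
    (h : ρ ≤ c * R) (φ : Sp N → ℝ) : nW K R φ ≤ ENNReal.ofReal (c ^ K) * nW K ρ φ := by
  unfold nW
  rw [← lintegral_const_mul' _ _ ENNReal.ofReal_ne_top]
  refine lintegral_mono fun x => ?_
  rw [mul_left_comm, ← ENNReal.ofReal_mul (by positivity)]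
  gcongr
  exact wt_le_mul_wt hK hc hρ hR h x

theorem lintegral_enorm_le_nW (hK : 0 ≤ K) (hρ : 0 ≤ ρ) (φ : Sp N → ℝ) :
    ∫⁻ x, ‖φ x‖ₑ ≤ nW K ρ φ := by
  refine lintegral_mono fun x => le_mul_of_one_le_right' ?_
  rw [← ENNReal.ofReal_one]
  exact ENNReal.ofReal_le_ofReal (one_le_wt hK hρ x)

theorem nW_const_mul (c : ℝ) (φ : Sp N → ℝ) : nW K ρ (fun x => c * φ x) = ‖c‖ₑ * nW K ρ φ := by
  unfold nW
  rw [← lintegral_const_mul' _ _ enorm_ne_top]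
  simp only [enorm_mul, mul_assoc]

end Weights

/-! ### Rescaling -/

/-- The `L^1`-normalised rescaling `r^{-N} h(x / r)`. -/
def scl (r : ℝ) (h : Sp N → ℝ) : Sp N → ℝ := fun x => (r ^ N)⁻¹ * h (r⁻¹ • x)

section Scaling

variable {r : ℝ}

theorem lintegral_comp_inv_smul (hr : 0 < r) (F : Sp N → ℝ≥0∞) :
    ∫⁻ x, F (r⁻¹ • x) = ENNReal.ofReal (r ^ N) * ∫⁻ x, F x := by
  have h := lintegral_map_equiv (μ := (volume : Measure (Sp N))) F
    (MeasurableEquiv.smul₀ (r⁻¹) (inv_ne_zero hr.ne'))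
  simp only [MeasurableEquiv.coe_smul₀] at h
  rw [← h, Measure.map_addHaar_smul _ (inv_ne_zero hr.ne'), lintegral_smul_measure]
  simp [abs_of_pos hr]

theorem lintegral_scl (hr : 0 < r) (F : Sp N → ℝ≥0∞) :
    ∫⁻ x, ENNReal.ofReal ((r ^ N)⁻¹) * F (r⁻¹ • x) = ∫⁻ x, F x := by
  rw [lintegral_const_mul' _ _ ENNReal.ofReal_ne_top, lintegral_comp_inv_smul hr, ← mul_assoc,
    ← ENNReal.ofReal_mul (by positivity), inv_mul_cancel₀ (by positivity), ENNReal.ofReal_one,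
    one_mul]

theorem enorm_scl (hr : 0 < r) (h : Sp N → ℝ) (x : Sp N) :
    ‖scl r h x‖ₑ = ENNReal.ofReal ((r ^ N)⁻¹) * ‖h (r⁻¹ • x)‖ₑ := by
  rw [scl, enorm_mul, Real.enorm_eq_ofReal (by positivity)]

theorem nW_scl (hr : 0 < r) (K : ℝ) (h : Sp N → ℝ) : nW K r (scl r h) = nW K 1 h := by
  unfold nW
  rw [← lintegral_scl hr (fun x => ‖h x‖ₑ * ENNReal.ofReal (wt K 1 x))]
  refine lintegral_congr fun x => ?_
  rw [enorm_scl hr, wt_smul hr, mul_assoc]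

theorem lintegral_enorm_scl (hr : 0 < r) (h : Sp N → ℝ) : ∫⁻ x, ‖scl r h x‖ₑ = ∫⁻ x, ‖h x‖ₑ := by
  rw [← lintegral_scl hr (fun x => ‖h x‖ₑ)]
  exact lintegral_congr fun x => enorm_scl hr h x

/-- The exponent found here is the one that the prefactor of `zN` cancels. -/
theorem eLpNorm_scl (hr : 0 < r) {h : Sp N → ℝ} (hh : Measurable h) (q : ℝ≥0∞) :
    eLpNorm (scl r h) q volume =
      ENNReal.ofReal (r ^ (-(N * (1 - (1 / q).toReal)))) * eLpNorm h q volume := by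
  have hr' : r⁻¹ ≠ 0 := inv_ne_zero hr.ne'
  have h1 : eLpNorm (fun x : Sp N => h (r⁻¹ • x)) q volume =
      ENNReal.ofReal (r ^ N) ^ (1 / q).toReal * eLpNorm h q volume := by
    have := eLpNorm_map_measure (p := q) (μ := (volume : Measure (Sp N)))
      (f := fun x => r⁻¹ • x) (g := h) hh.aestronglyMeasurable (by fun_prop)
    rw [Function.comp_def] at this
    rw [← this, Measure.map_addHaar_smul _ hr', eLpNorm_smul_measure_of_ne_zero]
    · simp [abs_of_pos hr]
    · simp only [ne_eq, ENNReal.ofReal_eq_zero, not_le]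
      positivity
  have h2 : scl r h = (r ^ N)⁻¹ • fun x : Sp N => h (r⁻¹ • x) := rfl
  rw [h2, eLpNorm_const_smul, h1, ← mul_assoc, Real.enorm_eq_ofReal (by positivity),
    ENNReal.ofReal_rpow_of_pos (by positivity), ← ENNReal.ofReal_mul (by positivity)]
  congr 2
  rw [← Real.rpow_natCast, ← Real.rpow_neg hr.le, ← Real.rpow_mul hr.le, ← Real.rpow_add hr]
  congr 1
  ring

theorem measurable_scl (r : ℝ) {h : Sp N → ℝ} (hh : Measurable h) : Measurable (scl r h) := by
  unfold scl
  fun_prop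

end Scaling

/-! ### Convolution estimates -/

/-- The convolution `∫ h(x - y) φ(y) dy`. -/
def cv (h φ : Sp N → ℝ) : Sp N → ℝ := fun x => ∫ y, h (x - y) * φ y

theorem cv_comm (h φ : Sp N → ℝ) : cv h φ = cv φ h := by
  funext x
  unfold cv
  rw [← integral_sub_left_eq_self _ _ x]
  refine integral_congr_ae (Eventually.of_forall fun y => ?_)
  simp [mul_comm]

theorem enorm_cv_le (h φ : Sp N → ℝ) (x : Sp N) :
    ‖cv h φ x‖ₑ ≤ ∫⁻ y, ‖h (x - y)‖ₑ * ‖φ y‖ₑ := by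
  refine (enorm_integral_le_lintegral_enorm _).trans_eq ?_
  simp only [enorm_mul]

theorem measurable_cv {h φ : Sp N → ℝ} (hh : Measurable h) (hφ : Measurable φ) :
    Measurable (cv h φ) := by
  have h1 : Measurable (Function.uncurry fun x y : Sp N => h (x - y) * φ y) := by
    unfold Function.uncurry; fun_prop
  exact h1.stronglyMeasurable.integral_prod_right.measurable

theorem measurable_conv_integrand {h φ : Sp N → ℝ} (hh : Measurable h) (hφ : Measurable φ) :
    Measurable (Function.uncurry fun y x : Sp N => ‖h (x - y)‖ₑ * ‖φ y‖ₑ) := by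
  unfold Function.uncurry
  fun_prop

theorem nW_comp_sub_le {K ρ : ℝ} (hK : 0 ≤ K) (hρ : 0 < ρ) (h : Sp N → ℝ) (y : Sp N) :
    nW K ρ (fun x => h (x - y)) ≤ ENNReal.ofReal (wt K ρ y) * nW K ρ h := by
  unfold nW
  rw [← lintegral_const_mul' _ _ ENNReal.ofReal_ne_top,
    ← lintegral_sub_right_eq_self (fun x => ENNReal.ofReal (wt K ρ y) *
      (‖h x‖ₑ * ENNReal.ofReal (wt K ρ x))) y]
  refine lintegral_mono fun x => ?_
  rw [mul_left_comm, ← ENNReal.ofReal_mul (wt_pos hρ.le y).le]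
  gcongr
  simpa using wt_add_le hK hρ y (x - y)

/-- Tonelli together with submultiplicativity of the weight under x = (x-y)+y. -/
theorem nW_cv_le {K ρ : ℝ} (hK : 0 ≤ K) (hρ : 0 < ρ) {h φ : Sp N → ℝ} (hh : Measurable h)
    (hφ : Measurable φ) : nW K ρ (cv h φ) ≤ nW K ρ h * nW K ρ φ := by
  calc nW K ρ (cv h φ) ≤ ∫⁻ x, ∫⁻ y, ‖h (x - y)‖ₑ * ‖φ y‖ₑ * ENNReal.ofReal (wt K ρ x) := by
        refine lintegral_mono fun x => ?_
        rw [lintegral_mul_const' _ _ ENNReal.ofReal_ne_top]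
        gcongr
        exact enorm_cv_le h φ x
    _ = ∫⁻ y, ∫⁻ x, ‖h (x - y)‖ₑ * ‖φ y‖ₑ * ENNReal.ofReal (wt K ρ x) := by
        refine lintegral_lintegral_swap (Measurable.aemeasurable ?_)
        have := measurable_wt (N := N) K ρ
        unfold Function.uncurry
        fun_prop
    _ = ∫⁻ y, ‖φ y‖ₑ * nW K ρ (fun x => h (x - y)) := by
        refine lintegral_congr fun y => ?_
        unfold nW
        rw [← lintegral_const_mul' _ _ enorm_ne_top]
        refine lintegral_congr fun x => by ring
    _ ≤ ∫⁻ y, nW K ρ h * (‖φ y‖ₑ * ENNReal.ofReal (wt K ρ y)) := by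
        refine lintegral_mono fun y => ?_
        rw [mul_left_comm]
        gcongr
        rw [mul_comm]
        exact nW_comp_sub_le hK hρ h y
    _ = nW K ρ h * nW K ρ φ := by
        refine lintegral_const_mul _ ?_
        have := measurable_wt (N := N) K ρ
        fun_prop

/-- Young's inequality with an L^1 factor: Minkowski applied to a superposition of translates, all
of which have the same L^q norm. -/
theorem eLpNorm_cv_le {h φ : Sp N → ℝ} (hh : Measurable h) (hφ : Measurable φ) {q : ℝ≥0∞}
    (hq : 1 ≤ q) : eLpNorm (cv h φ) q volume ≤ eLpNorm h q volume * ∫⁻ y, ‖φ y‖ₑ := by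
  calc eLpNorm (cv h φ) q volume
      ≤ eLpNorm (fun x => ∫⁻ y, ‖h (x - y)‖ₑ * ‖φ y‖ₑ) q volume :=
        eLpNorm_mono_enorm fun x => by simpa using enorm_cv_le h φ x
    _ ≤ ∫⁻ y, eLpNorm (fun x => ‖h (x - y)‖ₑ * ‖φ y‖ₑ) q volume :=
        eLpNorm_lintegral_le (measurable_conv_integrand hh hφ) hq
    _ = ∫⁻ y, eLpNorm h q volume * ‖φ y‖ₑ := by
        refine lintegral_congr fun y => ?_
        have h1 : eLpNorm (fun x => ‖h (x - y)‖ₑ * ‖φ y‖ₑ) q volume =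
            eLpNorm (fun x => φ y • h (x - y)) q volume := by
          rw [← eLpNorm_enorm (fun x => φ y • h (x - y))]
          congr 1
          funext x
          rw [smul_eq_mul, enorm_mul, mul_comm]
        rw [h1]
        have h2 := eLpNorm_const_smul (φ y) (fun x => h (x - y)) q volume
        have h3 := eLpNorm_comp_measurePreserving (p := q) (hh.aestronglyMeasurable (μ := volume))
          (measurePreserving_sub_right (volume : Measure (Sp N)) y)
        rw [Function.comp_def] at h3
        rw [h3] at h2
        rw [mul_comm]
        exact h2
    _ = eLpNorm h q volume * ∫⁻ y, ‖φ y‖ₑ := lintegral_const_mul _ (by fun_prop)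

/-- For finite q, |h|^q ≤ B^{q-1} |h|. -/
theorem eLpNorm_lt_top_of_bounded {h : Sp N → ℝ} (B : ℝ) (hB : ∀ x, |h x| ≤ B)
    (h1 : ∫⁻ x, ‖h x‖ₑ < ∞) {q : ℝ≥0∞} (hq : 1 ≤ q) : eLpNorm h q volume < ∞ := by
  rcases eq_or_ne q ∞ with rfl | hqt
  · rw [eLpNorm_exponent_top]
    exact (eLpNormEssSup_le_of_ae_bound (C := B) (Eventually.of_forall hB)).trans_lt
      ENNReal.ofReal_lt_top
  have hq0 : q ≠ 0 := (zero_lt_one.trans_le hq).ne'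
  have hq1 : 1 ≤ q.toReal := by
    rw [← ENNReal.toReal_one]
    exact ENNReal.toReal_mono hqt hq
  rw [eLpNorm_lt_top_iff_lintegral_rpow_enorm_lt_top hq0 hqt]
  calc ∫⁻ x, ‖h x‖ₑ ^ q.toReal ≤ ∫⁻ x, ENNReal.ofReal B ^ (q.toReal - 1) * ‖h x‖ₑ := by
        refine lintegral_mono fun x => ?_
        have : q.toReal = (q.toReal - 1) + 1 := by ring
        conv_lhs => rw [this]
        rw [ENNReal.rpow_add_of_nonneg _ _ (by linarith) zero_le_one, ENNReal.rpow_one]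
        have h2 : ‖h x‖ₑ ≤ ENNReal.ofReal B := by
          rw [← ofReal_norm]
          exact ENNReal.ofReal_le_ofReal (hB x)
        exact mul_le_mul_left (ENNReal.rpow_le_rpow h2 (by linarith)) _
    _ = ENNReal.ofReal B ^ (q.toReal - 1) * ∫⁻ x, ‖h x‖ₑ :=
        lintegral_const_mul' _ _ (ENNReal.rpow_ne_top_of_nonneg (by linarith) ENNReal.ofReal_ne_top)
    _ < ∞ := ENNReal.mul_lt_top
        (ENNReal.rpow_lt_top_of_nonneg (by linarith) ENNReal.ofReal_ne_top) h1

/-- The norm `R^{N (1 - 1/q)} ‖ψ‖_q + ∫ |ψ| (1 + |x| / R)^K`. -/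
def zN (K : ℝ) (q : ℝ≥0∞) (R : ℝ) (ψ : Sp N → ℝ) : ℝ≥0∞ :=
  ENNReal.ofReal (R ^ (N * (1 - (1 / q).toReal))) * eLpNorm ψ q volume + nW K R ψ

theorem one_sub_toReal_nonneg {q : ℝ≥0∞} (hq : 1 ≤ q) : 0 ≤ 1 - (1 / q).toReal := by
  rw [sub_nonneg, ← ENNReal.toReal_one]
  exact ENNReal.toReal_mono (by simp) (by simpa using hq)

/-- No smoothing is used: the kernel acts on L^q through its L^1 norm, which does not depend on r,
and the weight at the coarser scale R is the smaller one. Hence r may be arbitrarily small compared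
with R. -/
theorem zN_cv_scl_le {K : ℝ} (hK : 0 ≤ K) {q : ℝ≥0∞} (hq : 1 ≤ q) {r R : ℝ} (hr : 0 < r)
    (hrR : r ≤ R) {h φ : Sp N → ℝ} (hh : Measurable h) (hφ : Measurable φ) :
    zN K q R (cv (scl r h) φ) ≤ nW K 1 h * zN K q R φ := by
  have hR : 0 < R := hr.trans_le hrR
  unfold zN
  rw [mul_add, mul_left_comm]
  refine add_le_add ?_ ?_
  · gcongr
    rw [cv_comm, mul_comm]
    refine (eLpNorm_cv_le hφ (measurable_scl r hh) hq).trans ?_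
    rw [lintegral_enorm_scl hr]
    gcongr
    exact lintegral_enorm_le_nW hK zero_le_one h
  · refine (nW_cv_le hK hR (measurable_scl r hh) hφ).trans ?_
    gcongr
    rw [← nW_scl hr]
    exact nW_le_nW hK hr hrR _

/-- The smoothing counterpart: now the L^q norm falls on the kernel and costs r^{-N(1-1/q)}. The
prefactor in R pays for it because r and R are comparable. -/
theorem zN_cv_scl_le_nW {K : ℝ} (hK : 0 ≤ K) {q : ℝ≥0∞} (hq : 1 ≤ q) {r R c : ℝ} (hr : 0 < r)
    (hrR : r ≤ R) (hc : 0 < c) (hcR : c * R ≤ r) {h φ : Sp N → ℝ} (hh : Measurable h)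
    (hφ : Measurable φ) :
    zN K q R (cv (scl r h) φ) ≤
      (ENNReal.ofReal (c ^ (-(N * (1 - (1 / q).toReal)))) * eLpNorm h q volume + nW K 1 h) *
        nW K R φ := by
  have hR : 0 < R := hr.trans_le hrR
  have hN : 0 ≤ N * (1 - (1 / q).toReal) :=
    mul_nonneg (Nat.cast_nonneg _) (one_sub_toReal_nonneg hq)
  unfold zN
  rw [add_mul]
  refine add_le_add ?_ ?_
  · refine (mul_le_mul_right (eLpNorm_cv_le (measurable_scl r hh) hφ hq) _).trans ?_
    rw [eLpNorm_scl hr hh, ← mul_assoc, ← mul_assoc, ← ENNReal.ofReal_mul (by positivity)]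
    gcongr
    · rw [Real.rpow_neg hr.le, Real.rpow_neg hc.le, ← div_eq_mul_inv, div_le_iff₀ (by positivity),
        inv_mul_eq_div, le_div_iff₀ (by positivity), ← Real.mul_rpow hR.le hc.le, mul_comm R c]
      exact Real.rpow_le_rpow (by positivity) hcR hN
    · exact lintegral_enorm_le_nW hK hR.le φ
  · refine (nW_cv_le hK hR (measurable_scl r hh) hφ).trans ?_
    gcongr
    rw [← nW_scl hr]
    exact nW_le_nW hK hr hrR _

/-! ### The kernel -/

/-- Differentiation under the integral along a single line. Differentiability of the convolution is
assumed, so uniqueness of the one-variable derivative identifies the partial derivative; in the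
application the convolution is a derivative of the kernel, already known to be smooth. -/
theorem partialD_cv {g u : Sp N → ℝ} (hg : Integrable g) (hu : ContDiff ℝ 1 u) {B B' : ℝ}
    (hB : ∀ x, |u x| ≤ B) (i : Fin N) (hB' : ∀ x, |partialD i u x| ≤ B')
    (hd : Differentiable ℝ (cv g u)) : partialD i (cv g u) = cv g (partialD i u) := by
  funext x
  set e : Sp N := EuclideanSpace.single i 1 with he
  have h1 : HasDerivAt (fun θ : ℝ => cv g u (x + θ • e)) (partialD i (cv g u) x) 0 := by
    have hl : HasDerivAt (fun θ : ℝ => x + θ • e) e 0 := by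
      simpa using ((hasDerivAt_id (0 : ℝ)).smul_const e).const_add x
    have h := (hd (x + (0 : ℝ) • e)).hasFDerivAt.comp_hasDerivAt (0 : ℝ) hl
    simpa [partialD, Function.comp_def] using h
  have hline : ∀ (y : Sp N) (θ : ℝ),
      HasDerivAt (fun θ : ℝ => u (x + θ • e - y)) (partialD i u (x + θ • e - y)) θ := by
    intro y θ
    have hl : HasDerivAt (fun θ : ℝ => x + θ • e - y) e θ := by
      simpa using (((hasDerivAt_id θ).smul_const e).const_add x).sub_const y
    exact ((hu.differentiable one_ne_zero) _).hasFDerivAt.comp_hasDerivAt θ hl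
  have hpc : Continuous (partialD i u) :=
    (contDiff_partialD (n := 0) (by simpa using hu) i).continuous
  have h2 : HasDerivAt (fun θ : ℝ => ∫ y, u (x + θ • e - y) * g y)
      (∫ y, partialD i u (x + (0 : ℝ) • e - y) * g y) 0 := by
    refine (hasDerivAt_integral_of_dominated_loc_of_deriv_le (s := univ) (μ := volume)
      (F := fun (θ : ℝ) y => u (x + θ • e - y) * g y)
      (F' := fun (θ : ℝ) y => partialD i u (x + θ • e - y) * g y)
      (bound := fun y => B' * |g y|) univ_mem ?_ ?_ ?_ ?_ ?_ ?_).2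
    · refine Eventually.of_forall fun θ => ?_
      exact (Continuous.aestronglyMeasurable (by
        have := hu.continuous
        fun_prop)).mul hg.aestronglyMeasurable
    · refine Integrable.bdd_mul hg (c := B) (Continuous.aestronglyMeasurable (by
        have := hu.continuous
        fun_prop)) (Eventually.of_forall fun y => hB _)
    · exact (Continuous.aestronglyMeasurable (by fun_prop)).mul hg.aestronglyMeasurable
    · refine Eventually.of_forall fun y θ _ => ?_
      rw [Real.norm_eq_abs, abs_mul]
      exact mul_le_mul_of_nonneg_right (hB' _) (abs_nonneg _)
    · exact hg.abs.const_mul _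
    · exact Eventually.of_forall fun y θ _ => (hline y θ).mul_const _
  have h3 : (fun θ : ℝ => cv g u (x + θ • e)) = fun θ : ℝ => ∫ y, u (x + θ • e - y) * g y := by
    funext θ
    rw [cv_comm]
    rfl
  rw [h3] at h1
  rw [h1.unique h2, cv_comm]
  simp [cv]

theorem abs_le_nablaLen {j : ℕ} (W : (Fin N → ℕ) → Sp N → ℝ) {α : Fin N → ℕ} (hα : len α = j)
    (x : Sp N) : |W α x| ≤ nablaLen j W x := by
  unfold nablaLen
  rw [← Real.sqrt_sq_eq_abs]
  exact Real.sqrt_le_sqrt (Finset.single_le_sum (f := fun α => W α x ^ 2)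
    (fun _ _ => sq_nonneg _) (mem_multiIdxEq.2 hα))

theorem nablaLen_le_sum {j : ℕ} (W : (Fin N → ℕ) → Sp N → ℝ) (x : Sp N) :
    nablaLen j W x ≤ ∑ α ∈ multiIdxEq N j, |W α x| := by
  unfold nablaLen
  refine Real.sqrt_le_iff.2 ⟨Finset.sum_nonneg fun _ _ => abs_nonneg _, ?_⟩
  simp only [← sq_abs (W _ x)]
  exact Finset.sum_sq_le_sq_sum_of_nonneg fun _ _ => abs_nonneg _

section Kernel

variable {G : ℝ → Sp N → ℝ} {γ : ℕ} {d L : ℝ}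

theorem CondG.contDiff (hG : CondG G γ d L) {t : ℝ} (ht : 0 < t) : ContDiff ℝ γ (G t) := by
  rw [← contDiffOn_univ]
  have h : ContDiffOn ℝ γ (fun x : Sp N => (x, t)) univ :=
    (contDiff_id.prodMk contDiff_const).contDiffOn
  exact hG.smooth.comp h fun x _ => ⟨mem_univ _, ht⟩

theorem CondG.eq_scl (hG : CondG G γ d L) {t : ℝ} (ht : 0 < t) :
    G t = scl (t ^ (1 / d)) (G 1) := by
  funext x
  rw [hG.scaling x t ht, scl]
  congr 1
  rw [← Real.rpow_natCast, ← Real.rpow_mul ht.le, ← Real.rpow_neg ht.le]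
  congr 1
  ring

theorem CondG.wordD_eq (hG : CondG G γ d L) {t : ℝ} (ht : 0 < t) (w : List (Fin N)) (x : Sp N) :
    wordD w (G t) x =
      ((t ^ (1 / d))⁻¹) ^ w.length * scl (t ^ (1 / d)) (wordD w (G 1)) x := by
  rw [hG.eq_scl ht]
  unfold scl
  rw [wordD_smul_comp]
  ring

theorem CondG.exists_decay (hG : CondG G γ d L) : ∃ B : ℝ, 0 < B ∧ ∀ w : List (Fin N),
    w.length ≤ γ → ∀ x, |wordD w (G 1) x| ≤ B * (1 + ‖x‖) ^ (-((N : ℝ) + L + w.length)) := by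
  choose! C hC using hG.decay
  refine ⟨1 + ∑ j ∈ Finset.range (γ + 1), |C j|, by positivity, fun w hw x => ?_⟩
  rw [wordD_eq_partialPow w ((hG.contDiff one_pos).of_le (by exact_mod_cast hw))]
  have h1 := abs_le_nablaLen (fun α => partialPow α (G 1)) (len_content w) x
  have h2 := hC _ hw x
  have h3 : |C w.length| ≤ ∑ j ∈ Finset.range (γ + 1), |C j| :=
    Finset.single_le_sum (f := fun j => |C j|) (fun _ _ => abs_nonneg _)
      (Finset.mem_range.2 (by omega))
  have hpos : 0 < (1 + ‖x‖) ^ ((N : ℝ) + L + w.length) := by positivity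
  rw [Real.rpow_neg (by positivity), ← div_eq_mul_inv, le_div_iff₀ hpos, mul_comm]
  calc _ ≤ _ := mul_le_mul_of_nonneg_left h1 hpos.le
    _ ≤ C w.length := h2
    _ ≤ _ := by linarith [le_abs_self (C w.length)]

/-- The extra decay of higher derivatives is dropped: integrability against a weight of order K < L
needs only the exponent N+L, which is the same for all words. -/
theorem CondG.exists_decay' (hG : CondG G γ d L) : ∃ B : ℝ, 0 < B ∧ ∀ w : List (Fin N),
    w.length ≤ γ → ∀ x, |wordD w (G 1) x| ≤ B * (1 + ‖x‖) ^ (-((N : ℝ) + L)) := by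
  obtain ⟨B, hB, h⟩ := hG.exists_decay
  refine ⟨B, hB, fun w hw x => (h w hw x).trans ?_⟩
  refine mul_le_mul_of_nonneg_left (Real.rpow_le_rpow_of_exponent_le
    (by linarith [norm_nonneg x]) (neg_le_neg ?_)) hB.le
  exact le_add_of_nonneg_right (Nat.cast_nonneg _)

theorem CondG.continuous_wordD (hG : CondG G γ d L) {t : ℝ} (ht : 0 < t) {w : List (Fin N)}
    (hw : w.length ≤ γ) : Continuous (wordD w (G t)) :=
  (contDiff_wordD_of_le (n := 0) w (hG.contDiff ht) (by omega)).continuous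

theorem lintegral_decay_lt_top {a : ℝ} (ha : (N : ℝ) < a) (B : ℝ) :
    ∫⁻ x : Sp N, ENNReal.ofReal (B * (1 + ‖x‖) ^ (-a)) < ∞ := by
  have := (finite_integral_one_add_norm (E := Sp N) (μ := volume) (r := a) (by simpa using ha))
  calc _ ≤ ∫⁻ x : Sp N, ENNReal.ofReal B * ENNReal.ofReal ((1 + ‖x‖) ^ (-a)) := by
        refine lintegral_mono fun x => ?_
        rw [ENNReal.ofReal_mul' (by positivity)]
    _ < ∞ := by
        rw [lintegral_const_mul' _ _ ENNReal.ofReal_ne_top]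
        exact ENNReal.mul_lt_top ENNReal.ofReal_lt_top this

theorem nW_lt_top_of_decay {K : ℝ} {B a : ℝ} (ha : N + K < a) {h : Sp N → ℝ}
    (hh : ∀ x, |h x| ≤ B * (1 + ‖x‖) ^ (-a)) : nW K 1 h < ∞ := by
  refine lt_of_le_of_lt (lintegral_mono fun x => ?_)
    (lintegral_decay_lt_top (N := N) (a := a - K) (by linarith) B)
  rw [← ofReal_norm, Real.norm_eq_abs, ← ENNReal.ofReal_mul (abs_nonneg _)]
  refine ENNReal.ofReal_le_ofReal ?_
  have h0 : 0 < wt K 1 x := wt_pos zero_le_one x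
  refine (mul_le_mul_of_nonneg_right (hh x) h0.le).trans_eq ?_
  rw [wt, div_one, mul_assoc, ← Real.rpow_add (by positivity)]
  congr 2
  ring

theorem CondG.nW_wordD_lt_top (hG : CondG G γ d L) {K : ℝ} (hK : K < L) {w : List (Fin N)}
    (hw : w.length ≤ γ) : nW K 1 (wordD w (G 1)) < ∞ := by
  obtain ⟨B, -, h⟩ := hG.exists_decay'
  exact nW_lt_top_of_decay (by linarith) (h w hw)

theorem CondG.exists_bound (hG : CondG G γ d L) {t : ℝ} (ht : 0 < t) :
    ∃ B : ℝ, ∀ w : List (Fin N), w.length ≤ γ → ∀ x, |wordD w (G t) x| ≤ B := by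
  obtain ⟨B, hB, h⟩ := hG.exists_decay'
  set r := t ^ (1 / d) with hr
  have hr0 : 0 < r := by positivity
  refine ⟨∑ j ∈ Finset.range (γ + 1), (r⁻¹) ^ j * ((r ^ N)⁻¹ * B), fun w hw x => ?_⟩
  rw [hG.wordD_eq ht, ← hr, scl, abs_mul, abs_mul, abs_of_pos (by positivity),
    abs_of_pos (by positivity)]
  calc _ ≤ (r⁻¹) ^ w.length * ((r ^ N)⁻¹ * B) := by
        gcongr
        refine (h w hw _).trans (mul_le_of_le_one_right hB.le ?_)
        refine Real.rpow_le_one_of_one_le_of_nonpos (by linarith [norm_nonneg (r⁻¹ • x)]) ?_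
        have := hG.L_pos
        have : (0 : ℝ) ≤ N := Nat.cast_nonneg _
        linarith
    _ ≤ _ := Finset.single_le_sum (f := fun j => (r⁻¹) ^ j * ((r ^ N)⁻¹ * B))
        (fun _ _ => by positivity) (Finset.mem_range.2 (by omega))

theorem CondG.eLpNorm_wordD_lt_top (hG : CondG G γ d L) {w : List (Fin N)}
    (hw : w.length ≤ γ) {q : ℝ≥0∞} (hq : 1 ≤ q) : eLpNorm (wordD w (G 1)) q volume < ∞ := by
  obtain ⟨B, h⟩ := hG.exists_bound one_pos
  exact eLpNorm_lt_top_of_bounded B (h w hw) ((lintegral_enorm_le_nW le_rfl zero_le_one _).trans_lt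
    (hG.nW_wordD_lt_top hG.L_pos hw)) hq

theorem CondG.nW_wordD_eq (hG : CondG G γ d L) (K : ℝ) {t : ℝ} (ht : 0 < t) (w : List (Fin N)) :
    nW K (t ^ (1 / d)) (wordD w (G t)) =
      ENNReal.ofReal (((t ^ (1 / d))⁻¹) ^ w.length) * nW K 1 (wordD w (G 1)) := by
  have h : wordD w (G t) = fun x =>
      ((t ^ (1 / d))⁻¹) ^ w.length * scl (t ^ (1 / d)) (wordD w (G 1)) x :=
    funext (hG.wordD_eq ht w)
  rw [h, nW_const_mul, nW_scl (by positivity), Real.enorm_eq_ofReal (by positivity)]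

theorem CondG.integrable_wordD (hG : CondG G γ d L) {t : ℝ} (ht : 0 < t) {w : List (Fin N)}
    (hw : w.length ≤ γ) : Integrable (wordD w (G t)) := by
  refine ⟨(hG.continuous_wordD ht hw).aestronglyMeasurable, ?_⟩
  refine (lintegral_enorm_le_nW le_rfl (ρ := t ^ (1 / d)) (by positivity) _).trans_lt ?_
  rw [hG.nW_wordD_eq 0 ht]
  exact ENNReal.mul_lt_top ENNReal.ofReal_lt_top (hG.nW_wordD_lt_top hG.L_pos hw)

theorem CondG.integrable (hG : CondG G γ d L) {t : ℝ} (ht : 0 < t) : Integrable (G t) :=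
  hG.integrable_wordD ht (w := []) (by simp)

/-! ### Consequences of the semigroup law: derivatives and total mass. -/

theorem CondG.eq_cv (hG : CondG G γ d L) {a b : ℝ} (ha : 0 < a) (hb : 0 < b) :
    G (a + b) = cv (G a) (G b) := by
  funext x
  rw [hG.semigroup x b (a + b) hb (by linarith)]
  simp [cv]

theorem CondG.wordD_eq_cv (hG : CondG G γ d L) {a b : ℝ} (ha : 0 < a) (hb : 0 < b)
    {w : List (Fin N)} (hw : w.length ≤ γ) :
    wordD w (G (a + b)) = cv (G a) (wordD w (G b)) := by
  induction w with
  | nil => exact hG.eq_cv ha hb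
  | cons i w ih =>
    rw [List.length_cons] at hw
    have ih' := ih (by omega)
    obtain ⟨B, hB⟩ := hG.exists_bound hb
    rw [wordD_cons, wordD_cons, ih']
    refine partialD_cv (hG.integrable ha)
      (contDiff_wordD_of_le (n := 1) w (hG.contDiff hb) (by omega)) (hB w (by omega)) i
      (hB (i :: w) hw) ?_
    rw [← ih']
    exact (contDiff_wordD_of_le (n := 1) w (hG.contDiff (by linarith : 0 < a + b))
      (by omega)).differentiable one_ne_zero

/-- Let τ decrease to 0 in G(1+τ) = G(1) * G(τ). The left side tends to G(1) by continuity, while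
G(τ) concentrates at the origin with constant mass. -/
theorem CondG.eq_mass_mul (hG : CondG G γ d L) (x : Sp N) : G 1 x = (∫ y, G 1 y) * G 1 x := by
  have hc : Continuous (G 1) := (hG.contDiff one_pos).continuous
  obtain ⟨B, hB⟩ := hG.exists_bound one_pos
  have hB' : ∀ y, |G 1 y| ≤ B := hB [] (by simp)
  have hint := hG.integrable one_pos
  have hrt : Tendsto (fun τ : ℝ => τ ^ (1 / d)) (𝓝[>] 0) (𝓝 0) := by
    have h1 : 0 < 1 / d := one_div_pos.2 hG.d_pos
    have := (Real.continuousAt_rpow_const 0 (1 / d) (Or.inr h1.le)).tendsto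
    rw [Real.zero_rpow h1.ne'] at this
    exact this.mono_left nhdsWithin_le_nhds
  have hl : Tendsto (fun τ : ℝ => G (1 + τ) x) (𝓝[>] 0) (𝓝 (G 1 x)) := by
    have h1 : ContinuousAt (fun p : Sp N × ℝ => G p.2 p.1) (x, 1) :=
      hG.smooth.continuousOn.continuousAt
        ((isOpen_univ.prod isOpen_Ioi).mem_nhds ⟨mem_univ _, by simp⟩)
    have h2 : Tendsto (fun τ : ℝ => (x, 1 + τ)) (𝓝[>] 0) (𝓝 (x, (1 : ℝ))) := by
      have : Continuous fun τ : ℝ => (x, 1 + τ) := by fun_prop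
      simpa using (this.tendsto 0).mono_left nhdsWithin_le_nhds
    exact h1.tendsto.comp h2
  -- Rescaling the integration variable by τ^{1/d} makes the concentrating factor independent of τ;
  -- the limit then only concerns a bounded continuous factor.
  have heq : ∀ τ : ℝ, 0 < τ →
      G (1 + τ) x = ∫ z, G 1 z * G 1 (x - (τ ^ (1 / d)) • z) := by
    intro τ hτ
    have hr : 0 < τ ^ (1 / d) := by positivity
    rw [hG.eq_cv one_pos hτ, hG.eq_scl hτ, cv_comm]
    unfold cv scl
    rw [← integral_sub_left_eq_self _ _ x]
    have h1 := Measure.integral_comp_inv_smul_of_nonneg (volume : Measure (Sp N))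
      (fun z => G 1 z * G 1 (x - (τ ^ (1 / d)) • z)) hr.le
    simp only [smul_smul, mul_inv_cancel₀ hr.ne', one_smul, finrank_euclideanSpace,
      Fintype.card_fin, smul_eq_mul] at h1
    simp only [sub_sub_cancel, mul_assoc]
    rw [integral_const_mul, h1, ← mul_assoc, inv_mul_cancel₀ (by positivity), one_mul]
  have hr : Tendsto (fun τ : ℝ => ∫ z, G 1 z * G 1 (x - (τ ^ (1 / d)) • z)) (𝓝[>] 0)
      (𝓝 (∫ z, G 1 z * G 1 x)) := by
    refine tendsto_integral_filter_of_dominated_convergence (fun z => |G 1 z| * B)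
      (Eventually.of_forall fun τ => Continuous.aestronglyMeasurable (by fun_prop)) ?_
      (hint.abs.mul_const B) (Eventually.of_forall fun z => ?_)
    · refine Eventually.of_forall fun τ => Eventually.of_forall fun z => ?_
      rw [Real.norm_eq_abs, abs_mul]
      exact mul_le_mul_of_nonneg_left (hB' _) (abs_nonneg _)
    · refine Tendsto.const_mul _ ((hc.tendsto x).comp ?_)
      simpa using tendsto_const_nhds.sub (hrt.smul_const z)
  rw [← integral_mul_const]
  refine tendsto_nhds_unique hl (hr.congr' ?_)
  filter_upwards [self_mem_nhdsWithin] with τ hτ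
  exact (heq τ hτ).symm

/-- If G(·,1) is nonzero somewhere it can be cancelled from the mass identity; scaling carries
either alternative to all times. -/
theorem CondG.mass_eq_one_or (hG : CondG G γ d L) :
    (∀ t, 0 < t → ∫ x, G t x = 1) ∨ ∀ t, 0 < t → G t = 0 := by
  by_cases h : ∃ x, G 1 x ≠ 0
  · obtain ⟨x, hx⟩ := h
    have h1 : ∫ y, G 1 y = 1 := by
      have := hG.eq_mass_mul x
      exact mul_right_cancel₀ hx (by rw [one_mul]; exact this.symm)
    refine Or.inl fun t ht => ?_
    have hr : 0 < t ^ (1 / d) := by positivity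
    rw [hG.eq_scl ht]
    unfold scl
    rw [integral_const_mul, Measure.integral_comp_inv_smul_of_nonneg _ _ hr.le, h1]
    simp only [finrank_euclideanSpace, Fintype.card_fin, smul_eq_mul, mul_one]
    exact inv_mul_cancel₀ (by positivity)
  · push Not at h
    refine Or.inr fun t ht => ?_
    rw [hG.eq_scl ht]
    funext x
    simp [scl, h]

end Kernel

/-! ### Decay gained from vanishing moments -/

section Cancellation

variable {G : ℝ → Sp N → ℝ} {γ : ℕ} {d L K : ℝ}

/-- The error of the Taylor approximation of `H(x - y)` at `x`. -/
def taylorErr (m : ℕ) (H : Sp N → ℝ) (x y : Sp N) : ℝ := H (x - y) - taylorPoly m H x (-y)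

theorem one_add_norm_rpow_le {a θ : ℝ} (ha : 0 ≤ a) (hθ : θ ∈ Icc (0 : ℝ) 1) {x y : Sp N}
    (hy : ‖y‖ ≤ 1) :
    (1 + ‖x + θ • -y‖) ^ (-a) ≤ 2 ^ a * (1 + ‖x‖) ^ (-a) := by
  have h1 : ‖x‖ ≤ ‖x + θ • -y‖ + 1 := by
    have h2 : x = (x + θ • -y) + θ • y := by simp
    calc ‖x‖ = ‖(x + θ • -y) + θ • y‖ := by rw [← h2]
      _ ≤ ‖x + θ • -y‖ + ‖θ • y‖ := norm_add_le _ _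
      _ ≤ _ := by
        rw [norm_smul, Real.norm_eq_abs, abs_of_nonneg hθ.1]
        gcongr
        exact mul_le_one₀ hθ.2 (norm_nonneg _) hy
  have h3 : 0 ≤ ‖x + θ • -y‖ := norm_nonneg _
  rw [Real.rpow_neg (by positivity), Real.rpow_neg (by positivity), ← div_eq_mul_inv,
    inv_eq_one_div, div_le_div_iff₀ (by positivity) (by positivity), one_mul,
    ← Real.mul_rpow (by norm_num) (by positivity)]
  exact Real.rpow_le_rpow (by positivity) (by linarith) ha

/-- For |y| ≤ 1 the Taylor segment stays within distance 1 of x, so the decay of the derivatives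
along it is comparable with the decay at x. -/
theorem CondG.exists_taylorErr_le_of_norm_le_one (hG : CondG G γ d L) {m : ℕ}
    (hm : m + 1 ≤ γ) : ∃ B : ℝ, ∀ x y : Sp N, ‖y‖ ≤ 1 →
      |taylorErr m (G 1) x y| ≤ ‖y‖ ^ (m + 1) * (B * (1 + ‖x‖) ^ (-((N : ℝ) + L))) := by
  obtain ⟨B, hB, h⟩ := hG.exists_decay'
  have ha : 0 ≤ (N : ℝ) + L := add_nonneg (Nat.cast_nonneg _) hG.L_pos.le
  refine ⟨(N : ℝ) ^ (m + 1) * (B * 2 ^ ((N : ℝ) + L)), fun x y hy => ?_⟩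
  have := abs_sub_taylorPoly_le (x := x) (v := -y)
    ((hG.contDiff one_pos).of_le (by exact_mod_cast hm))
    (B := B * (2 ^ ((N : ℝ) + L) * (1 + ‖x‖) ^ (-((N : ℝ) + L)))) (fun θ hθ w => ?_)
  · rw [← sub_eq_add_neg, norm_neg] at this
    refine this.trans_eq ?_
    ring
  · refine (h _ (by simpa using hm) _).trans ?_
    gcongr
    exact one_add_norm_rpow_le ha hθ hy

theorem CondG.exists_taylorPoly_le (hG : CondG G γ d L) (hK : 0 ≤ K) (hm : ⌊K⌋₊ ≤ γ) :
    ∃ B : ℝ, ∀ x y : Sp N, 1 ≤ ‖y‖ →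
      |taylorPoly ⌊K⌋₊ (G 1) x (-y)| ≤ ‖y‖ ^ K * (B * (1 + ‖x‖) ^ (-((N : ℝ) + L))) := by
  obtain ⟨B, hB, h⟩ := hG.exists_decay'
  refine ⟨∑ n ∈ Finset.range (⌊K⌋₊ + 1), (N : ℝ) ^ n * B, fun x y hy => ?_⟩
  unfold taylorPoly
  rw [Finset.sum_mul, Finset.mul_sum]
  refine (Finset.abs_sum_le_sum_abs _ _).trans (Finset.sum_le_sum fun n hn => ?_)
  have hn' : n ≤ ⌊K⌋₊ := by simpa [Nat.lt_succ_iff] using hn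
  have hnK : (n : ℝ) ≤ K := (Nat.le_floor_iff hK).1 hn'
  have h1 := abs_homPart_le (n := n) (u := G 1) (x := x) (v := -y)
    (B := B * (1 + ‖x‖) ^ (-((N : ℝ) + L))) (fun w => h _ (by simp; omega) _)
  rw [abs_mul, abs_of_nonneg (by positivity)]
  calc _ ≤ 1 * ((N : ℝ) ^ n * (‖y‖ ^ n * (B * (1 + ‖x‖) ^ (-((N : ℝ) + L))))) := by
        rw [norm_neg] at h1
        refine mul_le_mul ?_ h1 (abs_nonneg _) zero_le_one
        exact inv_le_one_of_one_le₀ (Nat.one_le_cast.2 n.factorial_pos)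
    _ ≤ 1 * ((N : ℝ) ^ n * (‖y‖ ^ K * (B * (1 + ‖x‖) ^ (-((N : ℝ) + L))))) := by
        gcongr
        rw [← Real.rpow_natCast]
        exact Real.rpow_le_rpow_of_exponent_le hy hnK
    _ = _ := by ring

theorem CondG.measurable_taylorErr (hG : CondG G γ d L) {m : ℕ} (hm : m ≤ γ) :
    Measurable (Function.uncurry (taylorErr m (G 1))) := by
  have h1 : Continuous (G 1) := (hG.contDiff one_pos).continuous
  have h2 : ∀ n ∈ Finset.range (m + 1), ∀ w : Fin n → Fin N,
      Continuous (wordD (List.ofFn w) (G 1)) := by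
    intro n hn w
    refine hG.continuous_wordD one_pos ?_
    have := Finset.mem_range.1 hn
    simp only [List.length_ofFn]
    omega
  refine Continuous.measurable ?_
  unfold Function.uncurry taylorErr taylorPoly homPart
  refine Continuous.sub (by fun_prop) ?_
  refine continuous_finsetSum _ fun n hn => Continuous.mul continuous_const ?_
  refine continuous_finsetSum _ fun w _ => ?_
  have := h2 n hn w
  fun_prop

/-- Near the origin the Taylor remainder gives |y|^{[K]+1}. For |y| ≥ 1 there is no cancellation:
the translate G(x-y) costs the weight of y, at most 2^K |y|^K, and each term of the polynomial has
degree at most K. The minimum is the relevant power in each range. -/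
theorem CondG.exists_lintegral_taylorErr_le (hG : CondG G γ d L) (hK : 0 ≤ K) (hKL : K < L)
    (hKγ : ⌊K⌋₊ + 1 ≤ γ) : ∃ C : ℝ≥0∞, C ≠ ∞ ∧ ∀ y : Sp N,
      ∫⁻ x, ‖taylorErr ⌊K⌋₊ (G 1) x y‖ₑ * ENNReal.ofReal (wt K 1 x) ≤
        C * ENNReal.ofReal (min (‖y‖ ^ K) (‖y‖ ^ (⌊K⌋₊ + 1))) := by
  obtain ⟨B₁, hB₁⟩ := hG.exists_taylorErr_le_of_norm_le_one hKγ
  obtain ⟨B₂, hB₂⟩ := hG.exists_taylorPoly_le hK (by omega)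
  have hlt : K < ((⌊K⌋₊ + 1 : ℕ) : ℝ) := by exact_mod_cast Nat.lt_floor_add_one K
  have fin : ∀ B : ℝ, nW K 1 (fun x : Sp N => B * (1 + ‖x‖) ^ (-((N : ℝ) + L))) < ∞ := by
    intro B
    refine nW_lt_top_of_decay (B := |B|) (a := N + L) (by linarith) fun x => ?_
    rw [abs_mul]
    exact le_of_eq (congrArg _ (abs_of_pos (by positivity)))
  have fin0 : nW K 1 (G 1) < ∞ := hG.nW_wordD_lt_top hKL (w := []) (by simp)
  set b : ℝ → ℝ≥0∞ := fun B => nW K 1 (fun x : Sp N => B * (1 + ‖x‖) ^ (-((N : ℝ) + L))) with hb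
  refine ⟨b B₁ + (ENNReal.ofReal (2 ^ K) * nW K 1 (G 1) + b B₂), ?_, fun y => ?_⟩
  · exact (ENNReal.add_lt_top.2 ⟨fin _, ENNReal.add_lt_top.2
      ⟨ENNReal.mul_lt_top ENNReal.ofReal_lt_top fin0, fin _⟩⟩).ne
  have pull : ∀ (p B : ℝ), 0 ≤ p → nW K 1 (fun x : Sp N => p * (B * (1 + ‖x‖) ^ (-((N : ℝ) + L))))
      = ENNReal.ofReal p * b B := fun p B hp => by
    rw [nW_const_mul, Real.enorm_eq_ofReal hp]
  rcases le_total ‖y‖ 1 with hy | hy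
  · have hmin : min (‖y‖ ^ K) (‖y‖ ^ (⌊K⌋₊ + 1)) = ‖y‖ ^ (⌊K⌋₊ + 1) := by
      refine min_eq_right ?_
      rw [← Real.rpow_natCast]
      exact Real.rpow_le_rpow_of_exponent_ge' (norm_nonneg _) hy hK hlt.le
    rw [hmin]
    refine le_trans (lintegral_mono fun x => ?_) ((pull (‖y‖ ^ (⌊K⌋₊ + 1)) B₁
      (by positivity)).le.trans ?_)
    · gcongr
      rw [Real.enorm_eq_ofReal_abs, Real.enorm_eq_ofReal_abs]
      exact ENNReal.ofReal_le_ofReal ((hB₁ x y hy).trans (le_abs_self _))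
    · rw [mul_comm]
      gcongr
      exact le_self_add
  · have hmin : min (‖y‖ ^ K) (‖y‖ ^ (⌊K⌋₊ + 1)) = ‖y‖ ^ K := by
      refine min_eq_left ?_
      rw [← Real.rpow_natCast]
      exact Real.rpow_le_rpow_of_exponent_le hy hlt.le
    rw [hmin]
    have hw : wt K 1 y ≤ 2 ^ K * ‖y‖ ^ K := by
      unfold wt
      rw [div_one, ← Real.mul_rpow (by norm_num) (norm_nonneg _)]
      exact Real.rpow_le_rpow (by positivity) (by linarith) hK
    calc ∫⁻ x, ‖taylorErr ⌊K⌋₊ (G 1) x y‖ₑ * ENNReal.ofReal (wt K 1 x)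
        ≤ ∫⁻ x, (‖G 1 (x - y)‖ₑ * ENNReal.ofReal (wt K 1 x) +
            ‖‖y‖ ^ K * (B₂ * (1 + ‖x‖) ^ (-((N : ℝ) + L)))‖ₑ * ENNReal.ofReal (wt K 1 x)) := by
          refine lintegral_mono fun x => ?_
          rw [← add_mul]
          refine mul_le_mul_left ?_ _
          refine (enorm_sub_le).trans (add_le_add_right ?_ _)
          rw [Real.enorm_eq_ofReal_abs, Real.enorm_eq_ofReal_abs]
          exact ENNReal.ofReal_le_ofReal ((hB₂ x y hy).trans (le_abs_self _))
      _ = nW K 1 (fun x => G 1 (x - y)) +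
            nW K 1 (fun x => ‖y‖ ^ K * (B₂ * (1 + ‖x‖) ^ (-((N : ℝ) + L)))) := by
          refine lintegral_add_left ?_ _
          have := (hG.contDiff one_pos).continuous.measurable
          have := measurable_wt (N := N) K 1
          fun_prop
      _ ≤ ENNReal.ofReal (2 ^ K * ‖y‖ ^ K) * nW K 1 (G 1) + ENNReal.ofReal (‖y‖ ^ K) * b B₂ := by
          refine add_le_add ((nW_comp_sub_le hK one_pos _ _).trans ?_) (pull _ _ (by positivity)).le
          gcongr
      _ = (ENNReal.ofReal (2 ^ K) * nW K 1 (G 1) + b B₂) * ENNReal.ofReal (‖y‖ ^ K) := by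
          rw [ENNReal.ofReal_mul (by positivity)]
          ring
      _ ≤ _ := by
          exact mul_le_mul_left le_add_self _

theorem mono_zero (x : Sp N) : mono (0 : Fin N → ℕ) x = 1 := by simp [mono]

theorem prod_neg_smul_eq {n : ℕ} (c : ℝ) (y : Sp N) (w : Fin n → Fin N) :
    ∏ i, (-(c • y)) (w i) = (-c) ^ n * mono (content (List.ofFn w)) y := by
  have h : ∏ _i : Fin n, (-c) = (-c) ^ n := by simp
  rw [mono_content, List.map_ofFn, List.prod_ofFn, ← h, ← Finset.prod_mul_distrib]
  simp

/-- As a function of y the Taylor polynomial is a combination of monomials of degree at most m, each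
of zero integral against φ. -/
theorem integral_taylorPoly_eq_zero {m : ℕ} {φ : Sp N → ℝ}
    (hφ : ∀ α : Fin N → ℕ, len α ≤ m → Integrable (fun y => mono α y * φ y))
    (hφ0 : ∀ α : Fin N → ℕ, len α ≤ m → ∫ y, mono α y * φ y = 0) (H : Sp N → ℝ) (x : Sp N)
    (c : ℝ) : Integrable (fun y => taylorPoly m H x (-(c • y)) * φ y) ∧
      ∫ y, taylorPoly m H x (-(c • y)) * φ y = 0 := by
  have heq : (fun y => taylorPoly m H x (-(c • y)) * φ y) = fun y =>
      ∑ n ∈ Finset.range (m + 1), ∑ w : Fin n → Fin N,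
        ((n.factorial : ℝ)⁻¹ * (-c) ^ n * wordD (List.ofFn w) H x) *
          (mono (content (List.ofFn w)) y * φ y) := by
    funext y
    simp only [taylorPoly, homPart, prod_neg_smul_eq, Finset.sum_mul, Finset.mul_sum]
    exact Finset.sum_congr rfl fun n _ => Finset.sum_congr rfl fun w _ => by ring
  have hlen : ∀ n ∈ Finset.range (m + 1), ∀ w : Fin n → Fin N,
      len (content (List.ofFn w)) ≤ m := by
    intro n hn w
    rw [len_content, List.length_ofFn]
    exact Nat.lt_succ_iff.1 (Finset.mem_range.1 hn)
  rw [heq]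
  have hint : ∀ n ∈ Finset.range (m + 1), ∀ w : Fin n → Fin N, Integrable fun y =>
      ((n.factorial : ℝ)⁻¹ * (-c) ^ n * wordD (List.ofFn w) H x) *
          (mono (content (List.ofFn w)) y * φ y) :=
    fun n hn w => (hφ _ (hlen n hn w)).const_mul _
  refine ⟨integrable_finsetSum _ fun n hn => integrable_finsetSum _ fun w _ => hint n hn w, ?_⟩
  rw [integral_finsetSum _ fun n hn => integrable_finsetSum _ fun w _ => hint n hn w]
  refine Finset.sum_eq_zero fun n hn => ?_
  rw [integral_finsetSum _ fun w _ => hint n hn w]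
  refine Finset.sum_eq_zero fun w _ => ?_
  rw [integral_const_mul, hφ0 _ (hlen n hn w), mul_zero]

theorem CondG.exists_nW_cv_le_of_moments (hG : CondG G γ d L) (hK : 0 ≤ K) (hKL : K < L)
    (hKγ : ⌊K⌋₊ + 1 ≤ γ) : ∃ C : ℝ≥0∞, C ≠ ∞ ∧ ∀ t : ℝ, 0 < t → ∀ φ : Sp N → ℝ, Measurable φ →
      (∀ α : Fin N → ℕ, len α ≤ ⌊K⌋₊ → Integrable (fun y => mono α y * φ y)) →
      (∀ α : Fin N → ℕ, len α ≤ ⌊K⌋₊ → ∫ y, mono α y * φ y = 0) →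
      nW K (t ^ (1 / d)) (cv (G t) φ) ≤ C * ∫⁻ y, ‖φ y‖ₑ *
        ENNReal.ofReal (min ((‖y‖ / t ^ (1 / d)) ^ K) ((‖y‖ / t ^ (1 / d)) ^ (⌊K⌋₊ + 1))) := by
  obtain ⟨C, hC, h⟩ := hG.exists_lintegral_taylorErr_le hK hKL hKγ
  refine ⟨C, hC, fun t ht φ hφm hφ hφ0 => ?_⟩
  set r := t ^ (1 / d) with hr
  have hr0 : 0 < r := by positivity
  have hD := hG.measurable_taylorErr (m := ⌊K⌋₊) (by omega)
  have hφ1 : Integrable φ := by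
    simpa [mono_zero] using hφ 0 (by simp [len])
  -- The vanishing moments allow the Taylor polynomial to be subtracted from the kernel without
  -- changing the convolution.
  have hpt : ∀ x, cv (G t) φ x =
      ∫ y, (r ^ N)⁻¹ * taylorErr ⌊K⌋₊ (G 1) (r⁻¹ • x) (r⁻¹ • y) * φ y := by
    intro x
    obtain ⟨hi, h0⟩ := integral_taylorPoly_eq_zero hφ hφ0 (G 1) (r⁻¹ • x) r⁻¹
    have hGi : Integrable fun y => G t (x - y) * φ y := by
      obtain ⟨B, hB⟩ := hG.exists_bound ht
      refine Integrable.bdd_mul hφ1 (c := B) (Continuous.aestronglyMeasurable ?_)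
        (Eventually.of_forall fun y => hB [] (by simp) _)
      have := (hG.contDiff ht).continuous
      fun_prop
    have heq : ∀ y, (r ^ N)⁻¹ * taylorErr ⌊K⌋₊ (G 1) (r⁻¹ • x) (r⁻¹ • y) * φ y =
        G t (x - y) * φ y - (r ^ N)⁻¹ *
          (taylorPoly ⌊K⌋₊ (G 1) (r⁻¹ • x) (-(r⁻¹ • y)) * φ y) := by
      intro y
      rw [hG.eq_scl ht, ← hr, scl, taylorErr, smul_sub]
      ring
    simp only [heq]
    rw [integral_sub hGi (hi.const_mul _), integral_const_mul, h0, mul_zero, sub_zero]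
    rfl
  have hwm := measurable_wt (N := N) K 1
  calc nW K r (cv (G t) φ)
      ≤ ∫⁻ x, ∫⁻ y, ‖φ y‖ₑ * (ENNReal.ofReal ((r ^ N)⁻¹) *
          (‖taylorErr ⌊K⌋₊ (G 1) (r⁻¹ • x) (r⁻¹ • y)‖ₑ * ENNReal.ofReal (wt K 1 (r⁻¹ • x)))) := by
        refine lintegral_mono fun x => ?_
        rw [hpt x, ← wt_smul hr0]
        refine (mul_le_mul_left (enorm_integral_le_lintegral_enorm _) _).trans_eq ?_
        rw [← lintegral_mul_const' _ _ ENNReal.ofReal_ne_top]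
        refine lintegral_congr fun y => ?_
        rw [enorm_mul, enorm_mul, Real.enorm_eq_ofReal (by positivity : 0 ≤ (r ^ N)⁻¹)]
        ring
    _ = ∫⁻ y, ∫⁻ x, ‖φ y‖ₑ * (ENNReal.ofReal ((r ^ N)⁻¹) *
          (‖taylorErr ⌊K⌋₊ (G 1) (r⁻¹ • x) (r⁻¹ • y)‖ₑ * ENNReal.ofReal (wt K 1 (r⁻¹ • x)))) := by
        refine lintegral_lintegral_swap (Measurable.aemeasurable ?_)
        have h1 : Measurable fun z : Sp N × Sp N =>
            taylorErr ⌊K⌋₊ (G 1) (r⁻¹ • z.1) (r⁻¹ • z.2) :=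
          hD.comp (f := fun z : Sp N × Sp N => (r⁻¹ • z.1, r⁻¹ • z.2)) (by fun_prop)
        unfold Function.uncurry
        fun_prop
    _ = ∫⁻ y, ‖φ y‖ₑ * ∫⁻ x, ‖taylorErr ⌊K⌋₊ (G 1) x (r⁻¹ • y)‖ₑ * ENNReal.ofReal (wt K 1 x) := by
        refine lintegral_congr fun y => ?_
        rw [lintegral_const_mul' _ _ enorm_ne_top, lintegral_scl hr0
          (fun x => ‖taylorErr ⌊K⌋₊ (G 1) x (r⁻¹ • y)‖ₑ * ENNReal.ofReal (wt K 1 x))]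
    _ ≤ ∫⁻ y, C * (‖φ y‖ₑ * ENNReal.ofReal
          (min ((‖y‖ / r) ^ K) ((‖y‖ / r) ^ (⌊K⌋₊ + 1)))) := by
        refine lintegral_mono fun y => ?_
        rw [mul_left_comm]
        gcongr
        refine (h (r⁻¹ • y)).trans_eq ?_
        rw [norm_smul, norm_inv, Real.norm_eq_abs, abs_of_pos hr0, ← div_eq_inv_mul]
    _ = _ := lintegral_const_mul' _ _ hC

end Cancellation

/-! ### Triangle inequalities -/

theorem nW_add_le {K ρ : ℝ} {φ ψ : Sp N → ℝ} (hφ : Measurable φ) :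
    nW K ρ (fun x => φ x + ψ x) ≤ nW K ρ φ + nW K ρ ψ := by
  have hw := measurable_wt (N := N) K ρ
  unfold nW
  rw [← lintegral_add_left (by fun_prop)]
  refine lintegral_mono fun x => ?_
  rw [← add_mul]
  gcongr
  exact enorm_add_le _ _

theorem zN_const_mul (K : ℝ) (q : ℝ≥0∞) (R c : ℝ) (φ : Sp N → ℝ) :
    zN K q R (fun x => c * φ x) = ‖c‖ₑ * zN K q R φ := by
  unfold zN
  rw [nW_const_mul, mul_add, mul_left_comm, ← eLpNorm_const_smul]
  rfl

theorem zN_add_le {K : ℝ} {q : ℝ≥0∞} (hq : 1 ≤ q) {R : ℝ} {φ ψ : Sp N → ℝ} (hφ : Measurable φ)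
    (hψ : Measurable ψ) : zN K q R (fun x => φ x + ψ x) ≤ zN K q R φ + zN K q R ψ := by
  unfold zN
  refine (add_le_add (mul_le_mul_right (eLpNorm_add_le (μ := volume) hφ.aestronglyMeasurable
    hψ.aestronglyMeasurable hq) _) (nW_add_le hφ)).trans_eq ?_
  ring

theorem zN_sum_le {K : ℝ} {q : ℝ≥0∞} (hq : 1 ≤ q) {R : ℝ} {ι : Type*} (s : Finset ι)
    {φ : ι → Sp N → ℝ} (hφ : ∀ i ∈ s, Measurable (φ i)) :
    zN K q R (fun x => ∑ i ∈ s, φ i x) ≤ ∑ i ∈ s, zN K q R (φ i) := by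
  classical
  induction s using Finset.induction_on with
  | empty => simp [zN, nW]
  | insert a s ha ih =>
    have h1 := fun i hi => hφ i (Finset.mem_insert_of_mem hi)
    simp only [Finset.sum_insert ha]
    exact (zN_add_le hq (hφ a (Finset.mem_insert_self a s))
      (Finset.measurable_sum s h1)).trans (add_le_add le_rfl (ih h1))

theorem nW_le_zN (K : ℝ) (q : ℝ≥0∞) (R : ℝ) (φ : Sp N → ℝ) : nW K R φ ≤ zN K q R φ := le_add_self

theorem zN_one_le (K R : ℝ) (hK : 0 ≤ K) (hR : 0 ≤ R) (φ : Sp N → ℝ) :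
    zN K 1 R φ ≤ 2 * nW K R φ := by
  unfold zN
  simp only [one_div, inv_one, ENNReal.toReal_one, sub_self, mul_zero, Real.rpow_zero,
    ENNReal.ofReal_one, one_mul, eLpNorm_one_eq_lintegral_enorm]
  rw [two_mul]
  exact add_le_add (lintegral_enorm_le_nW hK hR φ) le_rfl

theorem zN_scl {K : ℝ} {q : ℝ≥0∞} {r : ℝ} (hr : 0 < r) {h : Sp N → ℝ} (hh : Measurable h) :
    zN K q r (scl r h) = eLpNorm h q volume + nW K 1 h := by
  unfold zN
  rw [nW_scl hr, eLpNorm_scl hr hh, ← mul_assoc, ← ENNReal.ofReal_mul (by positivity),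
    ← Real.rpow_add hr, add_neg_cancel, Real.rpow_zero, ENNReal.ofReal_one, one_mul]

/-! ### Monomials against weighted functions -/

theorem lintegral_mono_mul_le {K ρ : ℝ} (hρ : 0 < ρ) {α : Fin N → ℕ} (hα : (len α : ℝ) ≤ K)
    (φ : Sp N → ℝ) :
    ∫⁻ x, ‖mono α x * φ x‖ₑ ≤ ENNReal.ofReal (ρ ^ len α) * nW K ρ φ := by
  unfold nW
  rw [← lintegral_const_mul' _ _ ENNReal.ofReal_ne_top]
  refine lintegral_mono fun x => ?_
  rw [enorm_mul, mul_left_comm, ← ENNReal.ofReal_mul (by positivity), mul_comm]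
  gcongr
  rw [← ofReal_norm, Real.norm_eq_abs]
  refine ENNReal.ofReal_le_ofReal ((abs_mono_le α x).trans ?_)
  simpa using pow_le_wt (Nat.cast_nonneg (len α)) hα hρ x

theorem integrable_mono_mul {K ρ : ℝ} (hρ : 0 < ρ) {α : Fin N → ℕ} (hα : (len α : ℝ) ≤ K)
    {φ : Sp N → ℝ} (hφ : AEStronglyMeasurable φ) (h : nW K ρ φ < ∞) :
    Integrable (fun x => mono α x * φ x) :=
  ⟨(continuous_mono α).aestronglyMeasurable.mul hφ, (lintegral_mono_mul_le hρ hα φ).trans_lt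
    (ENNReal.mul_lt_top ENNReal.ofReal_lt_top h)⟩

theorem partialD_eq_of_hasDerivAt {u : Sp N → ℝ} (hu : Differentiable ℝ u) {i : Fin N} {x : Sp N}
    {D : ℝ} (h : HasDerivAt (fun θ : ℝ => u (x + θ • EuclideanSpace.single i 1)) D 0) :
    partialD i u x = D := by
  have hl : HasDerivAt (fun θ : ℝ => x + θ • EuclideanSpace.single i (1 : ℝ))
      (EuclideanSpace.single i 1) 0 := by
    simpa using ((hasDerivAt_id (0 : ℝ)).smul_const
      (EuclideanSpace.single i (1 : ℝ))).const_add x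
  have h2 := (hu (x + (0 : ℝ) • EuclideanSpace.single i 1)).hasFDerivAt.comp_hasDerivAt (0 : ℝ) hl
  have h3 := h2.unique h
  simpa [partialD] using h3

theorem contDiff_mono (α : Fin N → ℕ) {n : WithTop ℕ∞} : ContDiff ℝ n (mono α : Sp N → ℝ) := by
  unfold mono
  fun_prop

/-- If α i = 0 the truncated subtraction is harmless, since the coefficient vanishes. -/
theorem partialD_mono (i : Fin N) (α : Fin N → ℕ) (x : Sp N) :
    partialD i (mono α) x = α i * mono (α - Pi.single i 1) x := by
  refine partialD_eq_of_hasDerivAt ((contDiff_mono α (n := 1)).differentiable one_ne_zero) ?_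
  have h1 : (fun θ : ℝ => mono α (x + θ • EuclideanSpace.single i (1 : ℝ))) = fun θ =>
      (x i + θ) ^ α i * ∏ j ∈ Finset.univ.erase i, x j ^ α j := by
    funext θ
    unfold mono
    rw [← Finset.mul_prod_erase _ _ (Finset.mem_univ i)]
    congr 1
    · simp
    · refine Finset.prod_congr rfl fun j hj => ?_
      have : j ≠ i := Finset.ne_of_mem_erase hj
      simp [this]
  have h2 : mono (α - Pi.single i 1) x =
      x i ^ (α i - 1) * ∏ j ∈ Finset.univ.erase i, x j ^ α j := by
    unfold mono
    rw [← Finset.mul_prod_erase _ _ (Finset.mem_univ i)]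
    congr 1
    · simp
    · refine Finset.prod_congr rfl fun j hj => ?_
      have : j ≠ i := Finset.ne_of_mem_erase hj
      simp [this]
  rw [h1, h2]
  have h3 := (((hasDerivAt_id (0 : ℝ)).const_add (x i)).fun_pow (α i)).mul_const
    (∏ j ∈ Finset.univ.erase i, x j ^ α j)
  refine h3.congr_deriv ?_
  simp [mul_assoc]

theorem len_sub_single {α : Fin N → ℕ} (i : Fin N) : len (α - Pi.single i 1) ≤ len α :=
  Finset.sum_le_sum fun _ _ => Nat.sub_le _ _

/-- Integration by parts of iterated derivatives against monomials. -/
theorem integral_mono_wordD {u : Sp N → ℝ} {γ m : ℕ} (hu : ContDiff ℝ γ u)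
    (hint : ∀ α : Fin N → ℕ, len α ≤ m → ∀ w : List (Fin N), w.length ≤ γ →
      Integrable fun x => mono α x * wordD w u x)
    (w : List (Fin N)) (hw : w.length ≤ γ) (α : Fin N → ℕ) (hα : len α ≤ m) :
    ∫ x, mono α x * wordD w u x = (-1) ^ w.length *
      (∏ i, (α i).descFactorial (w.count i) : ℕ) * ∫ x, mono (α - content w) x * u x := by
  induction w generalizing α with
  | nil =>
    have : α - content ([] : List (Fin N)) = α := by ext i; simp [content]
    simp [this]
  | cons i w ih =>
    rw [List.length_cons] at hw
    have hα' : len (α - Pi.single i 1) ≤ m := (len_sub_single i).trans hα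
    have hmd : Differentiable ℝ (mono α : Sp N → ℝ) :=
      (contDiff_mono α (n := 1)).differentiable one_ne_zero
    have hwd : Differentiable ℝ (wordD w u) :=
      (contDiff_wordD_of_le (n := 1) w hu (by omega)).differentiable one_ne_zero
    have hpm : ∀ x : Sp N, fderiv ℝ (mono α) x (EuclideanSpace.single i 1) =
        α i * mono (α - Pi.single i 1) x := partialD_mono i α
    have hp := integral_mul_fderiv_eq_neg_fderiv_mul_of_integrable (μ := (volume : Measure (Sp N)))
      (f := mono α) (g := wordD w u) (v := EuclideanSpace.single i 1) (by
        simp only [hpm, mul_assoc]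
        exact (hint _ hα' w (by omega)).const_mul _) (hint α hα (i :: w) hw)
      (hint α hα w (by omega)) (fun x _ => hmd x) (fun x _ => hwd x)
    have hcons : ∀ x, wordD (i :: w) u x = fderiv ℝ (wordD w u) x (EuclideanSpace.single i 1) :=
      fun x => rfl
    simp only [hcons]
    rw [hp]
    simp only [hpm, mul_assoc]
    rw [integral_const_mul, ih (by omega) _ hα']
    have hsub : α - Pi.single i 1 - content w = α - content (i :: w) := by
      ext j
      simp only [content, Pi.sub_apply, List.count_cons]
      by_cases hj : i = j
      · subst hj; simp; omega
      · simp [hj, Ne.symm hj]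
    -- Only the factor at i changes, by n · (n-1)(n-2)⋯ = n(n-1)(n-2)⋯; for α i = 0 both sides
    -- vanish.
    have hprod : α i * ∏ j, ((α - Pi.single i 1 : Fin N → ℕ) j).descFactorial (w.count j) =
        ∏ j, (α j).descFactorial ((i :: w).count j) := by
      rw [← Finset.mul_prod_erase _ _ (Finset.mem_univ i),
        ← Finset.mul_prod_erase _ (fun j => (α j).descFactorial _) (Finset.mem_univ i), ← mul_assoc]
      congr 1
      · simp only [Pi.sub_apply, Pi.single_eq_same, List.count_cons_self]
        cases α i with
        | zero => simp
        | succ n => rw [Nat.add_sub_cancel, Nat.succ_descFactorial_succ]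
      · refine Finset.prod_congr rfl fun j hj => ?_
        have hj' : j ≠ i := Finset.ne_of_mem_erase hj
        simp [hj', Ne.symm hj']
    rw [hsub, ← hprod]
    push_cast
    rw [List.length_cons, pow_succ]
    ring

/-! ### The functions `g_α` and the moments -/

section Moments

variable {G : ℝ → Sp N → ℝ} {γ : ℕ} {d L K : ℝ}

theorem content_wordOf (α : Fin N → ℕ) : content (wordOf α) = α := funext (count_wordOf α)

/-- The derivative along `w` of the kernel at time `τ`, by its scaling formula. -/
def kern (G : ℝ → Sp N → ℝ) (d : ℝ) (w : List (Fin N)) (τ : ℝ) (x : Sp N) : ℝ :=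
  ((τ ^ (1 / d))⁻¹) ^ w.length * scl (τ ^ (1 / d)) (wordD w (G 1)) x

theorem CondG.wordD_eq_kern (hG : CondG G γ d L) {t : ℝ} (ht : 0 < t) (w : List (Fin N)) :
    wordD w (G t) = kern G d w t := funext (hG.wordD_eq ht w)

theorem CondG.measurable_wordD (hG : CondG G γ d L) {t : ℝ} (ht : 0 < t) {w : List (Fin N)}
    (hw : w.length ≤ γ) : Measurable (wordD w (G t)) := (hG.continuous_wordD ht hw).measurable

theorem CondG.measurable_kern (hG : CondG G γ d L) {w : List (Fin N)} (hw : w.length ≤ γ) :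
    Measurable (Function.uncurry (kern G d w)) := by
  have := hG.measurable_wordD one_pos hw
  unfold Function.uncurry kern scl
  fun_prop

theorem gFun_eq (α : Fin N → ℕ) (t : ℝ) (x : Sp N) : gFun G α t x =
    (-1 : ℝ) ^ len α / (multiFact α : ℝ) * wordD (wordOf α) (G (t + 1)) x := by
  rw [gFun, partialPow_eq_wordD]

theorem multiFact_pos (α : Fin N → ℕ) : 0 < multiFact α :=
  Finset.prod_pos fun _ _ => Nat.factorial_pos _

theorem enorm_gFun_const_le (α : Fin N → ℕ) :
    ‖(-1 : ℝ) ^ len α / (multiFact α : ℝ)‖ₑ ≤ 1 := by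
  rw [← ofReal_norm, norm_div, norm_pow, norm_neg, norm_one, one_pow, Real.norm_natCast]
  rw [← ENNReal.ofReal_one]
  refine ENNReal.ofReal_le_ofReal ?_
  rw [div_le_one (by exact_mod_cast multiFact_pos α)]
  exact_mod_cast multiFact_pos α

theorem CondG.measurable_gFun (hG : CondG G γ d L) {t : ℝ} (ht : 0 < t) {α : Fin N → ℕ}
    (hα : len α ≤ γ) : Measurable (gFun G α t) := by
  have h : gFun G α t = fun x => _ := funext (gFun_eq α t)
  rw [h]
  exact (hG.measurable_wordD (by linarith) (by rwa [length_wordOf])).const_mul _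

/-- The profile g_α(t) lives exactly at scale (t+1)^{1/d}, so after scaling only the factor from the
|α| derivatives depends on t. -/
theorem CondG.zN_gFun_le (hG : CondG G γ d L) (K : ℝ) (q : ℝ≥0∞) {t : ℝ} (ht : 0 < t)
    {α : Fin N → ℕ} (hα : len α ≤ γ) :
    zN K q ((t + 1) ^ (1 / d)) (gFun G α t) ≤ ENNReal.ofReal ((((t + 1) ^ (1 / d))⁻¹) ^ len α) *
      (eLpNorm (wordD (wordOf α) (G 1)) q volume + nW K 1 (wordD (wordOf α) (G 1))) := by
  have ht1 : 0 < t + 1 := by linarith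
  have h : gFun G α t = fun x => (-1 : ℝ) ^ len α / (multiFact α : ℝ) *
      (kern G d (wordOf α) (t + 1) x) := by
    funext x
    rw [gFun_eq, hG.wordD_eq_kern ht1]
  have h' : kern G d (wordOf α) (t + 1) = fun x => (((t + 1) ^ (1 / d))⁻¹) ^ (wordOf α).length *
      scl ((t + 1) ^ (1 / d)) (wordD (wordOf α) (G 1)) x := rfl
  rw [h, zN_const_mul, h', zN_const_mul, zN_scl (by positivity)
    (hG.measurable_wordD one_pos (by rwa [length_wordOf])),
    Real.enorm_eq_ofReal (by positivity : 0 ≤ (((t + 1) ^ (1 / d))⁻¹) ^ (wordOf α).length),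
    length_wordOf]
  exact mul_le_of_le_one_left' (enorm_gFun_const_le α)

theorem CondG.nW_gFun_le (hG : CondG G γ d L) (hK : 0 ≤ K) {t : ℝ} (ht : 0 < t)
    {α : Fin N → ℕ} (hα : len α ≤ γ) :
    nW K ((t + 1) ^ (1 / d)) (gFun G α t) ≤ ENNReal.ofReal ((((t + 1) ^ (1 / d))⁻¹) ^ len α) *
      (2 * nW K 1 (wordD (wordOf α) (G 1))) := by
  refine (nW_le_zN K 1 _ _).trans ((hG.zN_gFun_le K 1 ht hα).trans ?_)
  rw [eLpNorm_one_eq_lintegral_enorm, two_mul]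
  gcongr
  exact lintegral_enorm_le_nW hK zero_le_one _

theorem CondG.nW_gFun_lt_top (hG : CondG G γ d L) (hK : 0 ≤ K) (hKL : K < L) {t : ℝ} (ht : 0 < t)
    {α : Fin N → ℕ} (hα : len α ≤ γ) : nW K ((t + 1) ^ (1 / d)) (gFun G α t) < ∞ :=
  (hG.nW_gFun_le hK ht hα).trans_lt (ENNReal.mul_lt_top ENNReal.ofReal_lt_top
    (ENNReal.mul_lt_top (by simp) (hG.nW_wordD_lt_top hKL (by rwa [length_wordOf]))))

theorem len_le_floor {α : Fin N → ℕ} (hK : 0 ≤ K) : len α ≤ ⌊K⌋₊ ↔ (len α : ℝ) ≤ K :=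
  Nat.le_floor_iff hK

theorem len_mono {α β : Fin N → ℕ} (h : α ≤ β) : len α ≤ len β :=
  Finset.sum_le_sum fun i _ => h i

theorem len_lt_of_lt {α β : Fin N → ℕ} (h : α < β) : len α < len β := by
  obtain ⟨hle, i, hi⟩ := Pi.lt_def.1 h
  exact Finset.sum_lt_sum (fun k _ => hle k) ⟨i, Finset.mem_univ i, hi⟩

/-- Strong induction on |α|. In each correction term the factor ρ^{|β|} from M_β cancels the
ρ^{-|β|} from g_β, leaving the weight ρ^{|α|} of the monomial. -/
theorem CondG.exists_moment_le (hG : CondG G γ d L) (hK : 0 ≤ K) (hKL : K < L)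
    (hKγ : ⌊K⌋₊ + 1 ≤ γ) (α : Fin N → ℕ) (hα : (len α : ℝ) ≤ K) : ∃ C : ℝ≥0∞, C ≠ ∞ ∧
      ∀ t : ℝ, 0 < t → ∀ φ : Sp N → ℝ, ‖moment G φ t α‖ₑ ≤
        C * (ENNReal.ofReal (((t + 1) ^ (1 / d)) ^ len α) * nW K ((t + 1) ^ (1 / d)) φ) := by
  induction hn : len α using Nat.strong_induction_on generalizing α with
  | _ n ih =>
    subst hn
    have hsub : ∀ β ∈ Finset.Iio α, (len β : ℝ) ≤ K := fun β hβ =>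
      le_trans (by exact_mod_cast (len_lt_of_lt (Finset.mem_Iio.1 hβ)).le) hα
    have hβγ : ∀ β ∈ Finset.Iio α, len β ≤ γ := fun β hβ => by
      have := (len_le_floor hK).2 (hsub β hβ)
      omega
    have ih' : ∀ β ∈ Finset.Iio α, _ := fun β hβ =>
      ih (len β) (len_lt_of_lt (Finset.mem_Iio.1 hβ)) β (hsub β hβ) rfl
    choose! C hC h using ih'
    refine ⟨1 + ∑ β ∈ Finset.Iio α, C β * (2 * nW K 1 (wordD (wordOf β) (G 1))), ?_, ?_⟩
    · refine ENNReal.add_ne_top.2 ⟨by simp, ENNReal.sum_ne_top.2 fun β hβ => ?_⟩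
      exact ENNReal.mul_ne_top (hC β hβ) (ENNReal.mul_ne_top (by simp)
        (hG.nW_wordD_lt_top hKL (by rw [length_wordOf]; exact hβγ β hβ)).ne)
    · intro t ht φ
      set ρ := (t + 1) ^ (1 / d) with hρ
      have hρ0 : 0 < ρ := by positivity
      set X := ENNReal.ofReal (ρ ^ len α) * nW K ρ φ with hX
      rw [moment_eq]
      refine enorm_sub_le.trans ?_
      rw [add_mul, one_mul, Finset.sum_mul]
      refine add_le_add ((enorm_integral_le_lintegral_enorm _).trans
        (lintegral_mono_mul_le hρ0 hα φ)) ?_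
      refine (enorm_sum_le _ _).trans (Finset.sum_le_sum fun β hβ => ?_)
      rw [enorm_mul]
      refine (mul_le_mul' (h β hβ t ht φ) ((enorm_integral_le_lintegral_enorm _).trans
        ((lintegral_mono_mul_le hρ0 hα _).trans (mul_le_mul_right
          (hG.nW_gFun_le hK ht (hβγ β hβ)) _)))).trans_eq ?_
      have h1 : ENNReal.ofReal (ρ ^ len β) * ENNReal.ofReal ((ρ⁻¹) ^ len β) = 1 := by
        rw [← ENNReal.ofReal_mul (by positivity), ← mul_pow, mul_inv_cancel₀ hρ0.ne', one_pow,
          ENNReal.ofReal_one]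
      calc _ = C β * (2 * nW K 1 (wordD (wordOf β) (G 1))) * X *
            (ENNReal.ofReal (ρ ^ len β) * ENNReal.ofReal ((ρ⁻¹) ^ len β)) := by ring
        _ = _ := by rw [h1, mul_one]

/-- `P_K(t)` is bounded, uniformly in `t`, for the norm scaled by `(t + 1)^{1/d}`. -/
theorem CondG.exists_zN_projP_le (hG : CondG G γ d L) (hK : 0 ≤ K) (hKL : K < L)
    (hKγ : ⌊K⌋₊ + 1 ≤ γ) {q : ℝ≥0∞} (hq : 1 ≤ q) : ∃ C : ℝ≥0∞, C ≠ ∞ ∧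
      ∀ t : ℝ, 0 < t → ∀ φ : Sp N → ℝ, Measurable φ →
        zN K q ((t + 1) ^ (1 / d)) (projP G K t φ) ≤ C * zN K q ((t + 1) ^ (1 / d)) φ := by
  have h : ∀ α ∈ multiIdx N K, _ := fun α hα =>
    hG.exists_moment_le hK hKL hKγ α (mem_multiIdx.1 hα)
  choose! C hC h using h
  have hγ : ∀ α ∈ multiIdx N K, len α ≤ γ := fun α hα => by
    have := (len_le_floor hK).2 (mem_multiIdx.1 hα)
    omega
  set A : (Fin N → ℕ) → ℝ≥0∞ := fun α =>
    eLpNorm (wordD (wordOf α) (G 1)) q volume + nW K 1 (wordD (wordOf α) (G 1)) with hA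
  refine ⟨1 + ∑ α ∈ multiIdx N K, C α * A α, ?_, fun t ht φ hφ => ?_⟩
  · refine ENNReal.add_ne_top.2 ⟨by simp, ENNReal.sum_ne_top.2 fun α hα => ?_⟩
    have hw : (wordOf α).length ≤ γ := by rw [length_wordOf]; exact hγ α hα
    exact ENNReal.mul_ne_top (hC α hα) (ENNReal.add_ne_top.2
      ⟨(hG.eLpNorm_wordD_lt_top hw hq).ne, (hG.nW_wordD_lt_top hKL hw).ne⟩)
  · set ρ := (t + 1) ^ (1 / d) with hρ
    have hρ0 : 0 < ρ := by positivity
    have hm : ∀ α ∈ multiIdx N K, Measurable fun x => (-moment G φ t α) * gFun G α t x :=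
      fun α hα => (hG.measurable_gFun ht (hγ α hα)).const_mul _
    have heq : projP G K t φ = fun x =>
        φ x + ∑ α ∈ multiIdx N K, (-moment G φ t α) * gFun G α t x := by
      funext x
      simp [projP, sub_eq_add_neg]
    rw [heq]
    refine (zN_add_le hq hφ (Finset.measurable_sum _ hm)).trans ?_
    rw [add_mul, one_mul, Finset.sum_mul]
    refine add_le_add le_rfl ((zN_sum_le hq _ hm).trans (Finset.sum_le_sum fun α hα => ?_))
    rw [zN_const_mul, enorm_neg]
    refine (mul_le_mul' (h α hα t ht φ) (hG.zN_gFun_le K q ht (hγ α hα))).trans ?_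
    -- Growth of the moment against decay of the profile: their product is independent of time.
    have h1 : ENNReal.ofReal (ρ ^ len α) * ENNReal.ofReal ((ρ⁻¹) ^ len α) = 1 := by
      rw [← ENNReal.ofReal_mul (by positivity), ← mul_pow, mul_inv_cancel₀ hρ0.ne', one_pow,
        ENNReal.ofReal_one]
    calc _ = C α * A α * nW K ρ φ *
          (ENNReal.ofReal (ρ ^ len α) * ENNReal.ofReal ((ρ⁻¹) ^ len α)) := by ring
      _ ≤ _ := by
        rw [h1, mul_one]
        gcongr
        exact nW_le_zN K q ρ φ

/-- All derivatives are moved onto the monomial. If some β_i > α_i the monomial is annihilated; if α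
= β what remains is α! times the mass, and the sign and factorial in g_β normalise it to 1. -/
theorem CondG.integral_mono_gFun (hG : CondG G γ d L) (hK : 0 ≤ K) (hKL : K < L)
    (hKγ : ⌊K⌋₊ + 1 ≤ γ) (h1 : ∀ t, 0 < t → ∫ x, G t x = 1) {t : ℝ} (ht : 0 < t)
    {α β : Fin N → ℕ} (hα : len α ≤ ⌊K⌋₊) (hβ : len β ≤ ⌊K⌋₊) :
    (α = β → ∫ x, mono α x * gFun G β t x = 1) ∧
      (¬ β ≤ α → ∫ x, mono α x * gFun G β t x = 0) := by
  have ht1 : 0 < t + 1 := by linarith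
  have hint : ∀ α : Fin N → ℕ, len α ≤ ⌊K⌋₊ → ∀ w : List (Fin N), w.length ≤ γ →
      Integrable fun x => mono α x * wordD w (G (t + 1)) x := by
    intro α hα w hw
    refine integrable_mono_mul (K := K) (ρ := (t + 1) ^ (1 / d)) (by positivity)
      ((len_le_floor hK).1 hα) (hG.measurable_wordD ht1 hw).aestronglyMeasurable ?_
    rw [hG.nW_wordD_eq K ht1]
    exact ENNReal.mul_lt_top ENNReal.ofReal_lt_top (hG.nW_wordD_lt_top hKL hw)
  have key := integral_mono_wordD (hG.contDiff ht1) hint (wordOf β)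
    (by rw [length_wordOf]; omega) α hα
  have heq : ∫ x, mono α x * gFun G β t x = (-1 : ℝ) ^ len β / (multiFact β : ℝ) *
      ∫ x, mono α x * wordD (wordOf β) (G (t + 1)) x := by
    rw [← integral_const_mul]
    refine integral_congr_ae (Eventually.of_forall fun x => ?_)
    simp only [gFun_eq]
    ring
  rw [heq, key, length_wordOf, content_wordOf]
  simp only [count_wordOf]
  constructor
  · rintro rfl
    have hf : ∏ i, (α i).descFactorial (α i) = multiFact α := by
      simp [multiFact, Nat.descFactorial_self]
    have h2 : ((-1 : ℝ) ^ len α) ^ 2 = 1 := by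
      rw [← pow_mul, mul_comm, pow_mul]
      simp
    have h3 : (multiFact α : ℝ) ≠ 0 := by exact_mod_cast (multiFact_pos α).ne'
    have h4 : ∫ x, mono (α - α) x * G (t + 1) x = 1 := by
      rw [tsub_self]
      simpa [mono_zero] using h1 _ ht1
    rw [h4, hf]
    field_simp
    exact h2
  · intro hle
    obtain ⟨i, hi⟩ := not_forall.1 hle
    have : ∏ i, (α i).descFactorial (β i) = 0 :=
      Finset.prod_eq_zero (Finset.mem_univ i) (Nat.descFactorial_of_lt (not_le.1 hi))
    rw [this]
    simp

theorem CondG.moments_projP (hG : CondG G γ d L) (hK : 0 ≤ K) (hKL : K < L)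
    (hKγ : ⌊K⌋₊ + 1 ≤ γ) {t : ℝ} (ht : 0 < t) {φ : Sp N → ℝ} (hφm : Measurable φ)
    (hφ : nW K ((t + 1) ^ (1 / d)) φ < ∞) {α : Fin N → ℕ} (hα : len α ≤ ⌊K⌋₊) :
    Integrable (fun x => mono α x * projP G K t φ x) ∧
      ((∀ t, 0 < t → ∫ x, G t x = 1) → ∫ x, mono α x * projP G K t φ x = 0) := by
  have hρ : 0 < (t + 1) ^ (1 / d) := by positivity
  have hαK := (len_le_floor hK).1 hα
  have hγ : ∀ β ∈ multiIdx N K, len β ≤ ⌊K⌋₊ := fun β hβ =>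
    (len_le_floor hK).2 (mem_multiIdx.1 hβ)
  have hi0 : Integrable fun x => mono α x * φ x :=
    integrable_mono_mul hρ hαK hφm.aestronglyMeasurable hφ
  have hig : ∀ β ∈ multiIdx N K, Integrable fun x => mono α x * gFun G β t x := fun β hβ => by
    have hβγ : len β ≤ γ := by have := hγ β hβ; omega
    exact integrable_mono_mul hρ hαK (hG.measurable_gFun ht hβγ).aestronglyMeasurable
      (hG.nW_gFun_lt_top hK hKL ht hβγ)
  have heq : (fun x => mono α x * projP G K t φ x) = fun x => mono α x * φ x -
      ∑ β ∈ multiIdx N K, moment G φ t β * (mono α x * gFun G β t x) := by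
    funext x
    rw [projP, mul_sub, Finset.mul_sum]
    congr 1
    exact Finset.sum_congr rfl fun β _ => by ring
  rw [heq]
  have his : Integrable fun x =>
      ∑ β ∈ multiIdx N K, moment G φ t β * (mono α x * gFun G β t x) :=
    integrable_finsetSum _ fun β hβ => (hig β hβ).const_mul _
  refine ⟨hi0.sub his, fun h1 => ?_⟩
  rw [integral_sub hi0 his, integral_finsetSum _ fun β hβ => (hig β hβ).const_mul _]
  simp only [integral_const_mul]
  have hsub : insert α (Finset.Iio α) ⊆ multiIdx N K := by
    intro β hβ
    rw [mem_multiIdx, ← len_le_floor hK]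
    rcases Finset.mem_insert.1 hβ with rfl | hβ
    · exact hα
    · exact (len_mono (Finset.mem_Iio.1 hβ).le).trans hα
  -- Only β ≤ α contributes. The terms β < α are those in the recursion for M_α, and the term β = α
  -- has coefficient 1, so everything cancels.
  rw [← Finset.sum_subset hsub (fun β hβ hβ' => ?_), Finset.sum_insert (by simp),
    (hG.integral_mono_gFun hK hKL hKγ h1 ht hα hα).1 rfl, mul_one, moment_eq G φ t α]
  · ring
  · rw [(hG.integral_mono_gFun hK hKL hKγ h1 ht hα (hγ β hβ)).2 fun hle => hβ' ?_, mul_zero]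
    rcases hle.eq_or_lt with rfl | hlt
    · exact Finset.mem_insert_self _ _
    · exact Finset.mem_insert_of_mem (Finset.mem_Iio.2 hlt)

end Moments

/-! ### Measurability in time, and a good representative of the forcing -/

section Representative

variable {G : ℝ → Sp N → ℝ} {γ : ℕ} {d L K : ℝ} {q : ℝ≥0∞} {f : ℝ → Sp N → ℝ}

theorem EKq_congr {f₁ f₂ : ℝ → Sp N → ℝ} {s : ℝ} (h : f₁ s =ᵐ[volume] f₂ s) :
    EKq d K q f₁ s = EKq d K q f₂ s := by
  unfold EKq wNorm
  rw [eLpNorm_congr_ae h, eLpNorm_congr_ae h]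
  congr 1
  exact lintegral_congr_ae (h.mono fun x hx => by simp only [hx])

theorem EKq_eq_zero {s : ℝ} (h : f s = 0) : EKq d K q f s = 0 := by
  simp [EKq, wNorm, h]

theorem measurable_section_eLpNorm (hf : Measurable (Function.uncurry f)) (p : ℝ≥0∞) :
    Measurable fun s => eLpNorm (f s) p volume := by
  have h : Measurable (Function.uncurry fun s x => ‖f s x‖ₑ) := hf.enorm
  simpa only [eLpNorm_enorm] using measurable_eLpNorm_section (μ := volume) h p

theorem measurable_EKq (hf : Measurable (Function.uncurry f)) : Measurable (EKq d K q f) := by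
  have h1 := measurable_section_eLpNorm hf q
  have h2 := measurable_section_eLpNorm hf 1
  have h3 : Measurable fun s => wNorm K (f s) := by
    have : Measurable (Function.uncurry fun s (x : Sp N) =>
        ‖f s x‖ₑ * ENNReal.ofReal (1 + ‖x‖ ^ K)) := by
      have := hf.enorm
      refine this.mul ?_
      fun_prop
    exact this.lintegral_prod_right
  unfold EKq
  fun_prop

theorem Admissible.ae_EKq_lt_top (hf : Admissible d K q f) :
    ∀ᵐ s ∂(volume.restrict (Ioi (0 : ℝ))), EKq d K q f s < ∞ := by
  have h : ∀ n : ℕ, ∀ᵐ s ∂(volume.restrict (Ioo (0 : ℝ) (n + 1))), EKq d K q f s < ∞ := fun n =>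
    (ENNReal.ae_le_essSup _).mono fun s hs => hs.trans_lt (hf.bdd (n + 1) (by positivity))
  have hU : Ioi (0 : ℝ) = ⋃ n : ℕ, Ioo (0 : ℝ) (n + 1) := by
    ext s
    simp only [mem_Ioi, mem_iUnion, mem_Ioo, exists_and_left]
    refine ⟨fun hs => ⟨hs, ?_⟩, fun hs => hs.1⟩
    obtain ⟨n, hn⟩ := exists_nat_gt s
    exact ⟨n, by linarith⟩
  rw [hU, ae_restrict_iUnion_iff]
  exact h

/-- An admissible forcing agrees, at almost every time, with a jointly measurable one for which
`E_{K,q}` is finite at every time. -/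
theorem Admissible.exists_measurable (hf : Admissible d K q f) :
    ∃ f' : ℝ → Sp N → ℝ, Measurable (Function.uncurry f') ∧ (∀ s, EKq d K q f' s < ∞) ∧
      ∀ᵐ s ∂(volume.restrict (Ioi (0 : ℝ))), f s =ᵐ[volume] f' s := by
  obtain ⟨g, hgs, h1⟩ := hf.meas
  have hgm : Measurable g := hgs.measurable
  set f₁ : ℝ → Sp N → ℝ := fun s x => g (x, s) with hf₁
  have hf₁m : Measurable (Function.uncurry f₁) := hgm.comp measurable_swap
  have hae : ∀ᵐ s ∂(volume.restrict (Ioi (0 : ℝ))), f s =ᵐ[volume] f₁ s := by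
    rw [Measure.volume_eq_prod, ← Measure.prod_restrict, Measure.restrict_univ] at h1
    exact Measure.ae_ae_of_ae_prod
      (Measure.measurePreserving_swap.quasiMeasurePreserving.ae h1)
  have hE := measurable_EKq (d := d) (K := K) (q := q) hf₁m
  have hS : MeasurableSet {s | EKq d K q f₁ s < ∞} := measurableSet_lt hE measurable_const
  refine ⟨fun s x => {s | EKq d K q f₁ s < ∞}.indicator (fun s => f₁ s x) s, ?_, fun s => ?_, ?_⟩
  · have : (Function.uncurry fun s x =>
        {s | EKq d K q f₁ s < ∞}.indicator (fun s => f₁ s x) s) =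
        (Prod.fst ⁻¹' {s | EKq d K q f₁ s < ∞}).indicator (Function.uncurry f₁) := by
      ext ⟨s, x⟩
      simp [Function.uncurry, indicator]
    rw [this]
    exact hf₁m.indicator (measurable_fst hS)
  · by_cases hs : EKq d K q f₁ s < ∞
    · refine lt_of_eq_of_lt (EKq_congr (Eventually.of_forall fun x => ?_)) hs
      exact indicator_of_mem (s := {s | EKq d K q f₁ s < ∞}) hs _
    · rw [EKq_eq_zero]
      · exact ENNReal.zero_lt_top
      · funext x
        exact indicator_of_notMem (s := {s | EKq d K q f₁ s < ∞}) hs _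
  · filter_upwards [hae, hf.ae_EKq_lt_top] with s hs hs'
    rw [EKq_congr hs] at hs'
    refine hs.trans (Eventually.of_forall fun x => ?_)
    exact (indicator_of_mem (s := {s | EKq d K q f₁ s < ∞}) hs' fun s => f₁ s x).symm

theorem moment_congr {φ₁ φ₂ : Sp N → ℝ} (h : φ₁ =ᵐ[volume] φ₂) (t : ℝ) (α : Fin N → ℕ) :
    moment G φ₁ t α = moment G φ₂ t α := by
  induction hn : len α using Nat.strong_induction_on generalizing α with
  | _ n ih =>
    subst hn
    rw [moment_eq, moment_eq]
    congr 1
    · exact integral_congr_ae (h.mono fun x hx => by simp only [hx])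
    · exact Finset.sum_congr rfl fun β hβ => by
        rw [ih _ (len_lt_of_lt (Finset.mem_Iio.1 hβ)) β rfl]

theorem projP_congr {φ₁ φ₂ : Sp N → ℝ} (h : φ₁ =ᵐ[volume] φ₂) (t : ℝ) :
    projP G K t φ₁ =ᵐ[volume] projP G K t φ₂ :=
  h.mono fun x hx => by simp only [projP, hx, moment_congr h]

theorem expL_congr {φ₁ φ₂ : Sp N → ℝ} (h : φ₁ =ᵐ[volume] φ₂) (t : ℝ) :
    expL G t φ₁ = expL G t φ₂ :=
  funext fun _ => integral_congr_ae (h.mono fun x hx => by simp only [hx])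

/-- The scaling formula depends on time only through explicit powers, so it is jointly measurable;
agreement at positive times is all that is needed. -/
theorem CondG.exists_measurable_gFun (hG : CondG G γ d L) {α : Fin N → ℕ} (hα : len α ≤ γ) :
    ∃ g : ℝ → Sp N → ℝ, Measurable (Function.uncurry g) ∧ ∀ s, 0 < s → g s = gFun G α s := by
  refine ⟨fun s x => (-1 : ℝ) ^ len α / (multiFact α : ℝ) * kern G d (wordOf α) (s + 1) x,
    ?_, fun s hs => ?_⟩
  · have h := hG.measurable_kern (w := wordOf α) (by rwa [length_wordOf])
    exact (h.comp (f := fun p : ℝ × Sp N => (p.1 + 1, p.2)) (by fun_prop)).const_mul _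
  · funext x
    rw [gFun_eq, hG.wordD_eq_kern (by linarith)]

theorem measurable_integral_mono_mul {g : ℝ → Sp N → ℝ} (hg : Measurable (Function.uncurry g))
    (α : Fin N → ℕ) : Measurable fun s => ∫ x, mono α x * g s x := by
  have h : Measurable (Function.uncurry fun s x => mono α x * g s x) :=
    ((continuous_mono α).measurable.comp measurable_snd).mul hg
  exact h.stronglyMeasurable.integral_prod_right.measurable

theorem CondG.exists_measurable_moment (hG : CondG G γ d L) (hf : Measurable (Function.uncurry f))
    (α : Fin N → ℕ) (hα : len α ≤ γ) :
    ∃ M : ℝ → ℝ, Measurable M ∧ ∀ s, 0 < s → M s = moment G (f s) s α := by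
  induction hn : len α using Nat.strong_induction_on generalizing α with
  | _ n ih =>
    subst hn
    have hlt : ∀ β ∈ Finset.Iio α, len β < len α := fun β hβ => len_lt_of_lt (Finset.mem_Iio.1 hβ)
    have ih' : ∀ β ∈ Finset.Iio α, _ := fun β hβ =>
      ih (len β) (hlt β hβ) β ((hlt β hβ).le.trans hα) rfl
    choose! M hM hM' using ih'
    have hg : ∀ β ∈ Finset.Iio α, _ := fun β hβ =>
      hG.exists_measurable_gFun (α := β) ((hlt β hβ).le.trans hα)
    choose! g hg hg' using hg
    refine ⟨fun s => (∫ x, mono α x * f s x) -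
      ∑ β ∈ Finset.Iio α, M β s * ∫ x, mono α x * g β s x, ?_, fun s hs => ?_⟩
    · refine (measurable_integral_mono_mul hf α).sub (Finset.measurable_sum _ fun β hβ => ?_)
      exact (hM β hβ).mul (measurable_integral_mono_mul (hg β hβ) α)
    · rw [moment_eq]
      beta_reduce
      congr 1
      exact Finset.sum_congr rfl fun β hβ => by rw [hM' β hβ s hs, hg' β hβ s hs]

theorem CondG.exists_measurable_projP (hG : CondG G γ d L) (hK : 0 ≤ K) (hKγ : ⌊K⌋₊ + 1 ≤ γ)
    (hf : Measurable (Function.uncurry f)) :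
    ∃ Φ : ℝ → Sp N → ℝ, Measurable (Function.uncurry Φ) ∧
      ∀ s, 0 < s → Φ s = projP G K s (f s) := by
  have hγ : ∀ α ∈ multiIdx N K, len α ≤ γ := fun α hα => by
    have := (len_le_floor hK).2 (mem_multiIdx.1 hα)
    omega
  have hM : ∀ α ∈ multiIdx N K, _ := fun α hα => hG.exists_measurable_moment hf α (hγ α hα)
  have hg : ∀ α ∈ multiIdx N K, _ := fun α hα => hG.exists_measurable_gFun (hγ α hα)
  choose! M hM hM' using hM
  choose! g hg hg' using hg
  refine ⟨fun s x => f s x - ∑ α ∈ multiIdx N K, M α s * g α s x, ?_, fun s hs => ?_⟩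
  · exact hf.sub (Finset.measurable_sum _ fun α hα =>
      ((hM α hα).comp measurable_fst).mul (hg α hα))
  · funext x
    rw [projP]
    beta_reduce
    congr 1
    exact Finset.sum_congr rfl fun α hα => by rw [hM' α hα s hs, hg' α hα s hs]

end Representative

/-! ### Estimates at a fixed time -/

section Estimates

variable {G : ℝ → Sp N → ℝ} {γ : ℕ} {d L K : ℝ} {q : ℝ≥0∞} {f : ℝ → Sp N → ℝ}

theorem ofReal_rpow_mul_rpow {x a b : ℝ} (hx : 0 < x) :
    ENNReal.ofReal (x ^ a) * ENNReal.ofReal (x ^ b) = ENNReal.ofReal (x ^ (a + b)) := by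
  rw [← ENNReal.ofReal_mul (by positivity), ← Real.rpow_add hx]

theorem EKq_factor_eq_one {s : ℝ} (hs : 0 < s) :
    ENNReal.ofReal (((s + 1) ^ (1 / d)) ^ (-K)) * ENNReal.ofReal ((1 + s) ^ (K / d)) = 1 := by
  rw [← Real.rpow_mul (by positivity), add_comm 1 s, ofReal_rpow_mul_rpow (by positivity)]
  have : 1 / d * -K + K / d = 0 := by ring
  rw [this, Real.rpow_zero, ENNReal.ofReal_one]

theorem wNorm_ge (φ : Sp N → ℝ) : ∫⁻ x, ‖φ x‖ₑ * ENNReal.ofReal (‖x‖ ^ K) ≤ wNorm K φ := by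
  refine lintegral_mono fun x => ?_
  gcongr
  linarith

/-- The weight splits into 1, controlled by the L^1 term of E_{K,q} with its factor ρ^K, and
(|x|/ρ)^K, controlled by the weighted norm. Both parts give ρ^{-K}. -/
theorem nW_le_EKq (hK : 0 ≤ K) {s : ℝ} (hs : 0 < s) (hf : Measurable (f s)) :
    nW K ((s + 1) ^ (1 / d)) (f s) ≤ ENNReal.ofReal (2 ^ K) *
      (ENNReal.ofReal (((s + 1) ^ (1 / d)) ^ (-K)) * EKq d K q f s) := by
  set ρ := (s + 1) ^ (1 / d) with hρ
  have hρ0 : 0 < ρ := by positivity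
  calc nW K ρ (f s)
      ≤ ∫⁻ x, ENNReal.ofReal (2 ^ K) * (‖f s x‖ₑ +
          ENNReal.ofReal (ρ ^ (-K)) * (‖f s x‖ₑ * ENNReal.ofReal (‖x‖ ^ K))) := by
        refine lintegral_mono fun x => ?_
        refine (mul_le_mul_right (ENNReal.ofReal_le_ofReal (wt_le_one_add hK hρ0 x)) _).trans_eq ?_
        rw [ENNReal.ofReal_mul (by positivity), ENNReal.ofReal_add (by norm_num) (by positivity),
          ENNReal.ofReal_mul (by positivity), ENNReal.ofReal_one]
        ring
    _ = ENNReal.ofReal (2 ^ K) * ((∫⁻ x, ‖f s x‖ₑ) +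
          ENNReal.ofReal (ρ ^ (-K)) * ∫⁻ x, (‖f s x‖ₑ * ENNReal.ofReal (‖x‖ ^ K))) := by
        rw [lintegral_const_mul' _ _ ENNReal.ofReal_ne_top, lintegral_add_left (by fun_prop),
          lintegral_const_mul' _ _ ENNReal.ofReal_ne_top]
    _ ≤ _ := by
        gcongr
        unfold EKq
        rw [mul_add (ENNReal.ofReal (ρ ^ (-K))), ← mul_assoc, EKq_factor_eq_one hs, one_mul]
        refine add_le_add ?_ ?_
        · rw [eLpNorm_one_eq_lintegral_enorm]
          exact le_add_self
        · gcongr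
          exact wNorm_ge _

/-- E_{K,q} weighs the L^q norm by a power of s, degenerate at 0, whereas `zN` uses s+1; for s ≥ 1/2
these agree up to s+1 ≤ 3s. The weighted L^1 part needs no such restriction. -/
theorem zN_le_EKq (hK : 0 ≤ K) (hd : 0 < d) (hq : 1 ≤ q) {s : ℝ} (hs : 1 / 2 ≤ s)
    (hf : Measurable (f s)) :
    zN K q ((s + 1) ^ (1 / d)) (f s) ≤
      ENNReal.ofReal (3 ^ ((N : ℝ) / d * (1 - (1 / q).toReal)) + 2 ^ K) *
      (ENNReal.ofReal (((s + 1) ^ (1 / d)) ^ (-K)) * EKq d K q f s) := by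
  have hs0 : 0 < s := by linarith
  have hq' := one_sub_toReal_nonneg hq
  rw [ENNReal.ofReal_add (by positivity) (by positivity), add_mul]
  refine add_le_add ?_ (nW_le_EKq hK hs0 hf)
  have h1 : ((s + 1) ^ (1 / d)) ^ (N * (1 - (1 / q).toReal)) ≤
      3 ^ ((N : ℝ) / d * (1 - (1 / q).toReal)) * s ^ ((N : ℝ) / d * (1 - (1 / q).toReal)) := by
    rw [← Real.rpow_mul (by positivity), ← Real.mul_rpow (by norm_num) hs0.le]
    have : 1 / d * (N * (1 - (1 / q).toReal)) = (N : ℝ) / d * (1 - (1 / q).toReal) := by ring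
    rw [this]
    exact Real.rpow_le_rpow (by positivity) (by linarith) (by positivity)
  calc _ ≤ ENNReal.ofReal (3 ^ ((N : ℝ) / d * (1 - (1 / q).toReal)) *
        s ^ ((N : ℝ) / d * (1 - (1 / q).toReal))) * eLpNorm (f s) q volume := by gcongr
    _ = ENNReal.ofReal (3 ^ ((N : ℝ) / d * (1 - (1 / q).toReal))) * (1 *
        (ENNReal.ofReal (s ^ ((N : ℝ) / d * (1 - (1 / q).toReal))) * eLpNorm (f s) q volume)) := by
      rw [ENNReal.ofReal_mul (by positivity)]
      ring
    _ ≤ _ := by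
      refine mul_le_mul_right ?_ _
      unfold EKq
      rw [one_mul, mul_add (ENNReal.ofReal (((s + 1) ^ (1 / d)) ^ (-K))), ← mul_assoc
        (ENNReal.ofReal (((s + 1) ^ (1 / d)) ^ (-K))), EKq_factor_eq_one hs0, one_mul]
      exact le_add_right le_self_add

theorem CondG.exists_projP_bounds (hG : CondG G γ d L) (hK : 0 ≤ K) (hKL : K < L)
    (hKγ : ⌊K⌋₊ + 1 ≤ γ) (hq : 1 ≤ q) : ∃ C : ℝ≥0∞, C ≠ ∞ ∧ ∀ (f : ℝ → Sp N → ℝ) (s : ℝ),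
      0 < s → Measurable (f s) →
      nW K ((s + 1) ^ (1 / d)) (projP G K s (f s)) ≤
          C * (ENNReal.ofReal (((s + 1) ^ (1 / d)) ^ (-K)) * EKq d K q f s) ∧
      (1 / 2 ≤ s → zN K q ((s + 1) ^ (1 / d)) (projP G K s (f s)) ≤
          C * (ENNReal.ofReal (((s + 1) ^ (1 / d)) ^ (-K)) * EKq d K q f s)) := by
  obtain ⟨C₁, hC₁, h₁⟩ := hG.exists_zN_projP_le hK hKL hKγ le_rfl
  obtain ⟨C₂, hC₂, h₂⟩ := hG.exists_zN_projP_le hK hKL hKγ hq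
  set A := ENNReal.ofReal (3 ^ ((N : ℝ) / d * (1 - (1 / q).toReal)) + 2 ^ K) with hA
  refine ⟨C₁ * (2 * ENNReal.ofReal (2 ^ K)) + C₂ * A, ?_, fun f s hs hf => ⟨?_, fun hs' => ?_⟩⟩
  · exact ENNReal.add_ne_top.2 ⟨ENNReal.mul_ne_top hC₁ (ENNReal.mul_ne_top (by simp)
      ENNReal.ofReal_ne_top), ENNReal.mul_ne_top hC₂ ENNReal.ofReal_ne_top⟩
  · calc _ ≤ C₁ * zN K 1 ((s + 1) ^ (1 / d)) (f s) := (nW_le_zN _ _ _ _).trans (h₁ s hs _ hf)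
      _ ≤ C₁ * (2 * (ENNReal.ofReal (2 ^ K) *
          (ENNReal.ofReal (((s + 1) ^ (1 / d)) ^ (-K)) * EKq d K q f s))) := by
        gcongr
        refine (zN_one_le K _ hK (by positivity) _).trans ?_
        gcongr
        exact nW_le_EKq hK hs hf
      _ = C₁ * (2 * ENNReal.ofReal (2 ^ K)) *
          (ENNReal.ofReal (((s + 1) ^ (1 / d)) ^ (-K)) * EKq d K q f s) := by ring
      _ ≤ _ := mul_le_mul_left le_self_add _
  · calc _ ≤ C₂ * zN K q ((s + 1) ^ (1 / d)) (f s) := h₂ s hs _ hf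
      _ ≤ C₂ * (A * (ENNReal.ofReal (((s + 1) ^ (1 / d)) ^ (-K)) * EKq d K q f s)) := by
        gcongr
        exact zN_le_EKq hK hG.d_pos hq hs' hf
      _ = C₂ * A * (ENNReal.ofReal (((s + 1) ^ (1 / d)) ^ (-K)) * EKq d K q f s) := by ring
      _ ≤ _ := mul_le_mul_left le_add_self _

theorem cv_const_mul (c : ℝ) (h φ : Sp N → ℝ) :
    cv (fun x => c * h x) φ = fun x => c * cv h φ x := by
  funext x
  simp only [cv, mul_assoc, integral_const_mul]

theorem inv_rpow_pow {τ : ℝ} (hτ : 0 < τ) (d : ℝ) (j : ℕ) :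
    ((τ ^ (1 / d))⁻¹) ^ j = τ ^ (-(j : ℝ) / d) := by
  rw [← Real.rpow_neg hτ.le, ← Real.rpow_natCast, ← Real.rpow_mul hτ.le]
  congr 1
  ring

theorem CondG.cv_wordD_eq (hG : CondG G γ d L) {τ : ℝ} (hτ : 0 < τ) (w : List (Fin N))
    (φ : Sp N → ℝ) : cv (wordD w (G τ)) φ = fun x => τ ^ (-(w.length : ℝ) / d) *
      cv (scl (τ ^ (1 / d)) (wordD w (G 1))) φ x := by
  rw [← cv_const_mul, hG.wordD_eq_kern hτ, ← inv_rpow_pow hτ]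
  rfl

theorem zN_le_mul_zN (hK : 0 ≤ K) (hq : 1 ≤ q) {c ρ R : ℝ} (hc : 1 ≤ c) (hρ : 0 < ρ) (hR : 0 < R)
    (h1 : ρ ≤ c * R) (h2 : R ≤ c * ρ) (φ : Sp N → ℝ) :
    zN K q R φ ≤
      ENNReal.ofReal (c ^ (N * (1 - (1 / q).toReal)) + c ^ K) * zN K q ρ φ := by
  have hq' := one_sub_toReal_nonneg hq
  have hc0 : 0 < c := by linarith
  unfold zN
  rw [mul_add]
  refine add_le_add ?_ ?_
  · rw [← mul_assoc, ← ENNReal.ofReal_mul (by positivity)]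
    gcongr
    calc R ^ (N * (1 - (1 / q).toReal)) ≤ (c * ρ) ^ (N * (1 - (1 / q).toReal)) :=
          Real.rpow_le_rpow hR.le h2 (by positivity)
      _ = c ^ (N * (1 - (1 / q).toReal)) * ρ ^ (N * (1 - (1 / q).toReal)) :=
          Real.mul_rpow hc0.le hρ.le
      _ ≤ _ := by
        refine mul_le_mul_of_nonneg_right ?_ (by positivity)
        have : 0 ≤ c ^ K := by positivity
        linarith
  · refine (nW_le_mul_nW hK hc hρ hR h1 φ).trans ?_
    gcongr
    have : 0 ≤ c ^ (N * (1 - (1 / q).toReal)) := by positivity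
    linarith

/-- The contribution of times `s ≥ t / 2`. -/
theorem CondG.exists_zN_cv_le_late (hG : CondG G γ d L) (hK : 0 ≤ K) (hKL : K < L) (hq : 1 ≤ q)
    {w : List (Fin N)} (hw : w.length ≤ γ) : ∃ C : ℝ≥0∞, C ≠ ∞ ∧ ∀ t s : ℝ, 1 ≤ t → t / 2 ≤ s →
      s < t → ∀ φ : Sp N → ℝ, Measurable φ →
      zN K q (t ^ (1 / d)) (cv (wordD w (G (t - s))) φ) ≤
        C * (ENNReal.ofReal ((t - s) ^ (-(w.length : ℝ) / d)) *
          zN K q ((s + 1) ^ (1 / d)) φ) := by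
  have hd : 0 < 1 / d := one_div_pos.2 hG.d_pos
  set c : ℝ := 2 ^ (1 / d) with hc
  have hc1 : 1 ≤ c := Real.one_le_rpow (by norm_num) hd.le
  refine ⟨nW K 1 (wordD w (G 1)) * ENNReal.ofReal (c ^ (N * (1 - (1 / q).toReal)) + c ^ K),
    ENNReal.mul_ne_top (hG.nW_wordD_lt_top hKL hw).ne ENNReal.ofReal_ne_top,
    fun t s ht hs hst φ hφ => ?_⟩
  have hτ : 0 < t - s := by linarith
  have ht0 : 0 < t := by linarith
  have hs0 : 0 < s := by linarith
  rw [hG.cv_wordD_eq hτ, zN_const_mul, Real.enorm_eq_ofReal (by positivity)]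
  have h1 := zN_cv_scl_le hK hq (r := (t - s) ^ (1 / d)) (R := t ^ (1 / d)) (by positivity)
    (Real.rpow_le_rpow hτ.le (by linarith) hd.le) (hG.measurable_wordD one_pos hw) hφ
  -- Since t ≤ 2(s+1) and, using t ≥ 1, s+1 ≤ 2t, the two scales differ by at most the factor
  -- 2^{1/d}.
  have h2 := zN_le_mul_zN (N := N) hK hq (c := c) (ρ := (s + 1) ^ (1 / d)) (R := t ^ (1 / d)) hc1
    (by positivity) (by positivity)
    (by rw [hc, ← Real.mul_rpow (by norm_num) ht0.le]
        exact Real.rpow_le_rpow (by positivity) (by linarith) hd.le)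
    (by rw [hc, ← Real.mul_rpow (by norm_num) (by positivity)]
        exact Real.rpow_le_rpow (by positivity) (by linarith) hd.le) φ
  calc _ ≤ ENNReal.ofReal ((t - s) ^ (-(w.length : ℝ) / d)) * (nW K 1 (wordD w (G 1)) *
        (ENNReal.ofReal (c ^ (N * (1 - (1 / q).toReal)) + c ^ K) *
          zN K q ((s + 1) ^ (1 / d)) φ)) := by
        gcongr
        exact h1.trans (mul_le_mul_right h2 _)
    _ = _ := by ring

theorem cv_assoc {g h φ : Sp N → ℝ} (hg : Integrable g) (hφ : Integrable φ) (hh : Continuous h)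
    {B : ℝ} (hB : ∀ x, |h x| ≤ B) : cv (cv h g) φ = cv h (cv g φ) := by
  funext x
  have h1 : ∀ y, cv h g (x - y) * φ y = ∫ z, h (x - z) * (g (z - y) * φ y) := by
    intro y
    unfold cv
    rw [← integral_mul_const, ← integral_sub_right_eq_self _ y]
    refine integral_congr_ae (Eventually.of_forall fun z => ?_)
    simp only [mul_assoc]
    congr 2
    abel
  have h2 : ∀ z, h (x - z) * cv g φ z = ∫ y, h (x - z) * (g (z - y) * φ y) := fun z => by
    rw [integral_const_mul]; rfl
  have hi : Integrable (Function.uncurry fun y z : Sp N => h (x - z) * (g (z - y) * φ y))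
      (volume.prod volume) := by
    have h3 := hφ.convolution_integrand (ContinuousLinearMap.mul ℝ ℝ) hg
    have h4 : Integrable (fun p : Sp N × Sp N => φ p.1 * g (p.2 - p.1)) (volume.prod volume) :=
      h3.swap
    refine (h4.bdd_mul (c := B) (f := fun p : Sp N × Sp N => h (x - p.2)) ?_
      (Eventually.of_forall fun p => hB _)).congr (Eventually.of_forall fun p => ?_)
    · exact Continuous.aestronglyMeasurable (by fun_prop)
    · simp only [Function.uncurry]
      ring
  change ∫ y, cv h g (x - y) * φ y = ∫ z, h (x - z) * cv g φ z
  simp only [h1, h2]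
  exact integral_integral_swap hi

/-- `∫ |φ| min(|y|^K, |y|^{[K]+1} t^{-([K]+1-K)/d})`. -/
def qW (d K t : ℝ) (φ : Sp N → ℝ) : ℝ≥0∞ := ∫⁻ y, ‖φ y‖ₑ *
  ENNReal.ofReal (min (‖y‖ ^ K) (‖y‖ ^ (⌊K⌋₊ + 1) * (t ^ (1 / d)) ^ (K - (⌊K⌋₊ + 1))))

/-- Passing from scale r to R and extracting R^{-K} leaves a minimum whose second entry still
carries the negative power R^{K-[K]-1}. -/
theorem min_rpow_le (hK : 0 ≤ K) {c R r a : ℝ} (hc0 : 0 < c) (hc1 : c ≤ 1) (hR : 0 < R)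
    (hr : c * R ≤ r) (ha : 0 ≤ a) :
    min ((a / r) ^ K) ((a / r) ^ (⌊K⌋₊ + 1)) ≤ (c⁻¹) ^ (⌊K⌋₊ + 1) * R ^ (-K) *
      min (a ^ K) (a ^ (⌊K⌋₊ + 1) * R ^ (K - (⌊K⌋₊ + 1))) := by
  have hcR : 0 < c * R := by positivity
  have hci : 1 ≤ c⁻¹ := (one_le_inv₀ hc0).2 hc1
  have h1 : a / r ≤ c⁻¹ * (a / R) := by
    rw [inv_mul_eq_div, div_div, mul_comm R c]
    exact div_le_div_of_nonneg_left ha hcR hr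
  have hr0 : 0 < r := hcR.trans_le hr
  have h0 : 0 ≤ a / r := by positivity
  rw [mul_min_of_nonneg _ _ (by positivity)]
  refine min_le_min ?_ ?_
  · calc (a / r) ^ K ≤ (c⁻¹ * (a / R)) ^ K := Real.rpow_le_rpow h0 h1 hK
      _ = (c⁻¹) ^ K * R ^ (-K) * a ^ K := by
        rw [Real.mul_rpow (by positivity) (by positivity), Real.div_rpow ha hR.le,
          Real.rpow_neg hR.le]
        ring
      _ ≤ _ := by
        gcongr
        rw [← Real.rpow_natCast]
        refine Real.rpow_le_rpow_of_exponent_le hci ?_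
        exact_mod_cast (Nat.lt_floor_add_one K).le
  · calc (a / r) ^ (⌊K⌋₊ + 1) ≤ (c⁻¹ * (a / R)) ^ (⌊K⌋₊ + 1) := pow_le_pow_left₀ h0 h1 _
      _ = _ := by
        have h2 : R ^ (-K) * R ^ (K - (⌊K⌋₊ + 1)) = (R ^ (⌊K⌋₊ + 1))⁻¹ := by
          rw [← Real.rpow_add hR, ← Real.rpow_natCast, ← Real.rpow_neg hR.le]
          congr 1
          push_cast
          ring
        rw [mul_pow, div_pow, div_eq_mul_inv, ← h2]
        ring

/-- The contribution of times `s < t / 2`, where the vanishing moments are used. -/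
theorem CondG.exists_zN_cv_le_early (hG : CondG G γ d L) (hK : 0 ≤ K) (hKL : K < L)
    (hKγ : ⌊K⌋₊ + 1 ≤ γ) (hq : 1 ≤ q) {w : List (Fin N)} (hw : w.length ≤ γ) :
    ∃ C : ℝ≥0∞, C ≠ ∞ ∧ ∀ t s : ℝ, 0 < s → s < t / 2 → ∀ φ : Sp N → ℝ, Measurable φ →
      (∀ α : Fin N → ℕ, len α ≤ ⌊K⌋₊ → Integrable (fun y => mono α y * φ y)) →
      ((∀ t, 0 < t → ∫ x, G t x = 1) →
        ∀ α : Fin N → ℕ, len α ≤ ⌊K⌋₊ → ∫ y, mono α y * φ y = 0) →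
      zN K q (t ^ (1 / d)) (cv (wordD w (G (t - s))) φ) ≤
        C * (ENNReal.ofReal ((t - s) ^ (-(w.length : ℝ) / d)) *
          (ENNReal.ofReal ((t ^ (1 / d)) ^ (-K)) * qW d K t φ)) := by
  have hd : 0 < 1 / d := one_div_pos.2 hG.d_pos
  -- For s < t/2 half of the elapsed time satisfies t/4 ≤ (t-s)/2 ≤ t.
  set c : ℝ := (1 / 4) ^ (1 / d) with hc
  have hc0 : 0 < c := by positivity
  have hc1 : c ≤ 1 := Real.rpow_le_one (by norm_num) (by norm_num) hd.le
  obtain ⟨C₀, hC₀, h₀⟩ := hG.exists_nW_cv_le_of_moments hK hKL hKγ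
  set A := ENNReal.ofReal (c ^ (-(N * (1 - (1 / q).toReal)))) *
    eLpNorm (wordD w (G 1)) q volume + nW K 1 (wordD w (G 1)) with hA
  have hAt : A ≠ ∞ := ENNReal.add_ne_top.2 ⟨ENNReal.mul_ne_top ENNReal.ofReal_ne_top
    (hG.eLpNorm_wordD_lt_top hw hq).ne, (hG.nW_wordD_lt_top hKL hw).ne⟩
  refine ⟨ENNReal.ofReal ((1 / 2) ^ (-(w.length : ℝ) / d)) * (A * (C₀ *
    ENNReal.ofReal ((c⁻¹) ^ (⌊K⌋₊ + 1)))), ?_, fun t s hs hst φ hφ hi h0 => ?_⟩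
  · exact ENNReal.mul_ne_top ENNReal.ofReal_ne_top (ENNReal.mul_ne_top hAt
      (ENNReal.mul_ne_top hC₀ ENNReal.ofReal_ne_top))
  have ht0 : 0 < t := by linarith
  have hτ : 0 < t - s := by linarith
  have hτ2 : 0 < (t - s) / 2 := by linarith
  rcases hG.mass_eq_one_or with h1 | hz
  swap
  · have : cv (wordD w (G (t - s))) φ = fun _ => 0 * φ 0 := by
      rw [hG.cv_wordD_eq hτ, hz 1 one_pos]
      have : ∀ w : List (Fin N), wordD w (0 : Sp N → ℝ) = 0 := by
        intro w
        induction w with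
        | nil => rfl
        | cons i w ih => rw [wordD_cons, ih]; funext x; simp [partialD]
      funext x
      simp [this, cv, scl]
    rw [this, zN_const_mul]
    simp
  set r := ((t - s) / 2) ^ (1 / d) with hr
  have hr0 : 0 < r := by positivity
  have hrR : r ≤ t ^ (1 / d) := Real.rpow_le_rpow hτ2.le (by linarith) hd.le
  have hcR : c * t ^ (1 / d) ≤ r := by
    rw [hc, ← Real.mul_rpow (by norm_num) ht0.le]
    exact Real.rpow_le_rpow (by positivity) (by linarith) hd.le
  have hφi : Integrable φ := by simpa [mono_zero] using hi 0 (by simp [len])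
  obtain ⟨B, hB⟩ := hG.exists_bound hτ2
  -- The outer half carries the derivatives and maps weighted L^1 to `zN`; the inner half exploits
  -- the vanishing moments.
  have hsplit : cv (wordD w (G (t - s))) φ =
      cv (wordD w (G ((t - s) / 2))) (cv (G ((t - s) / 2)) φ) := by
    conv_lhs => rw [← add_halves (t - s)]
    rw [hG.wordD_eq_cv hτ2 hτ2 hw, cv_comm (G _) (wordD w _),
      cv_assoc (hG.integrable hτ2) hφi (hG.continuous_wordD hτ2 hw) (hB w hw)]
  have hχ : Measurable (cv (G ((t - s) / 2)) φ) :=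
    measurable_cv (hG.contDiff hτ2).continuous.measurable hφ
  rw [hsplit, hG.cv_wordD_eq hτ2, zN_const_mul, Real.enorm_eq_ofReal (by positivity)]
  have e1 : ENNReal.ofReal (((t - s) / 2) ^ (-(w.length : ℝ) / d)) =
      ENNReal.ofReal ((1 / 2) ^ (-(w.length : ℝ) / d)) *
        ENNReal.ofReal ((t - s) ^ (-(w.length : ℝ) / d)) := by
    rw [← ENNReal.ofReal_mul (by positivity), ← Real.mul_rpow (by norm_num) hτ.le]
    congr 2
    ring
  have e2 : nW K (t ^ (1 / d)) (cv (G ((t - s) / 2)) φ) ≤ C₀ *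
      (ENNReal.ofReal ((c⁻¹) ^ (⌊K⌋₊ + 1)) *
        (ENNReal.ofReal ((t ^ (1 / d)) ^ (-K)) * qW d K t φ)) := by
    refine (nW_le_nW hK hr0 hrR _).trans ((h₀ _ hτ2 φ hφ hi (h0 h1)).trans ?_)
    gcongr
    unfold qW
    rw [← mul_assoc, ← ENNReal.ofReal_mul (by positivity),
      ← lintegral_const_mul' _ _ ENNReal.ofReal_ne_top]
    refine lintegral_mono fun y => ?_
    rw [mul_left_comm, ← ENNReal.ofReal_mul (by positivity)]
    gcongr
    exact min_rpow_le hK hc0 hc1 (by positivity) hcR (norm_nonneg y)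
  have e3 := zN_cv_scl_le_nW hK hq hr0 hrR hc0 hcR (hG.measurable_wordD one_pos hw) hχ
  rw [e1]
  calc _ ≤ ENNReal.ofReal ((1 / 2) ^ (-(w.length : ℝ) / d)) *
        ENNReal.ofReal ((t - s) ^ (-(w.length : ℝ) / d)) * (A * (C₀ *
      (ENNReal.ofReal ((c⁻¹) ^ (⌊K⌋₊ + 1)) *
        (ENNReal.ofReal ((t ^ (1 / d)) ^ (-K)) * qW d K t φ)))) := by
        gcongr
        exact e3.trans (mul_le_mul_right e2 _)
    _ = _ := by ring

end Estimates

/-! ### Weak derivatives of the Duhamel integral -/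

theorem hasCompactSupport_wordD {ψ : Sp N → ℝ} (hc : HasCompactSupport ψ) (w : List (Fin N)) :
    HasCompactSupport (wordD w ψ) := by
  induction w with
  | nil => exact hc
  | cons i w ih => exact ih.fderiv_apply (𝕜 := ℝ) _

/-- Derivatives leave the test function outermost first, hence reach u in reversed order. -/
theorem integral_mul_wordD {u ψ : Sp N → ℝ} (w : List (Fin N)) (hu : ContDiff ℝ w.length u)
    (hψ : ContDiff ℝ (⊤ : ℕ∞) ψ) (hc : HasCompactSupport ψ) :
    ∫ x, u x * wordD w ψ x = (-1) ^ w.length * ∫ x, wordD w.reverse u x * ψ x := by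
  induction w generalizing u with
  | nil => simp
  | cons i w ih =>
    have hu1 : ContDiff ℝ 1 u := hu.of_le (by simp)
    have hψw : ContDiff ℝ (⊤ : ℕ∞) (wordD w ψ) := contDiff_top_wordD w hψ
    have hcw := hasCompactSupport_wordD hc w
    have hψi : Continuous (partialD i (wordD w ψ)) :=
      (contDiff_top_wordD (i :: w) hψ).continuous
    have hui : Continuous (partialD i u) :=
      (contDiff_partialD (n := 0) (by simpa using hu1) i).continuous
    have hp := integral_mul_fderiv_eq_neg_fderiv_mul_of_integrable (μ := (volume : Measure (Sp N)))
      (f := u) (g := wordD w ψ) (v := EuclideanSpace.single i 1)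
      ((hui.mul hψw.continuous).integrable_of_hasCompactSupport hcw.mul_left)
      ((hu1.continuous.mul hψi).integrable_of_hasCompactSupport
        (hasCompactSupport_wordD hc (i :: w)).mul_left)
      ((hu1.continuous.mul hψw.continuous).integrable_of_hasCompactSupport hcw.mul_left)
      (fun x _ => hu1.differentiable one_ne_zero x)
      (fun x _ => (hψw.of_le (by simp) : ContDiff ℝ 1 _).differentiable one_ne_zero x)
    have hpu : ContDiff ℝ w.length (partialD i u) := contDiff_partialD (by simpa using hu) i
    have h2 := ih hpu
    simp only [wordD_cons, List.reverse_cons, wordD_append, wordD_nil, List.length_cons, pow_succ]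
    have h3 : ∫ x, u x * partialD i (wordD w ψ) x = -∫ x, partialD i u x * wordD w ψ x := hp
    rw [h3, h2]
    ring

theorem integrable_conv_integrand {h φ : Sp N → ℝ} (hh : Integrable h) (hφ : Integrable φ) :
    Integrable (fun p : Sp N × Sp N => h (p.1 - p.2) * φ p.2) (volume.prod volume) :=
  (hφ.convolution_integrand (ContinuousLinearMap.mul ℝ ℝ) hh).congr
    (Eventually.of_forall fun _ => mul_comm _ _)

theorem integral_cv_mul {h φ ψ : Sp N → ℝ} (hh : Integrable h) (hφ : Integrable φ)
    (hψ : Continuous ψ) {B : ℝ} (hB : ∀ x, |ψ x| ≤ B) :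
    ∫ x, cv h φ x * ψ x = ∫ y, φ y * ∫ x, h (x - y) * ψ x := by
  have hi : Integrable (Function.uncurry fun x y : Sp N => h (x - y) * φ y * ψ x)
      (volume.prod volume) :=
    (integrable_conv_integrand hh hφ).mul_bdd (c := B)
      (Continuous.aestronglyMeasurable (by fun_prop)) (Eventually.of_forall fun p => hB p.1)
  simp only [cv, ← integral_mul_const, ← integral_const_mul]
  rw [integral_integral_swap hi]
  refine integral_congr_ae (Eventually.of_forall fun y => integral_congr_ae
    (Eventually.of_forall fun x => ?_))
  simp only
  ring

section Duhamel

variable {G : ℝ → Sp N → ℝ} {γ : ℕ} {d L : ℝ} {Φ : ℝ → Sp N → ℝ} {t : ℝ}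

theorem measurable_cv_kern {k : ℝ → Sp N → ℝ} (hk : Measurable (Function.uncurry k))
    (hΦ : Measurable (Function.uncurry Φ)) (t : ℝ) :
    Measurable (Function.uncurry fun s x => cv (k (t - s)) (Φ s) x) := by
  have h : Measurable fun p : (ℝ × Sp N) × Sp N =>
      k (t - p.1.1) (p.1.2 - p.2) * Φ p.1.1 p.2 :=
    (hk.comp (f := fun p : (ℝ × Sp N) × Sp N => (t - p.1.1, p.1.2 - p.2)) (by fun_prop)).mul
      (hΦ.comp (f := fun p : (ℝ × Sp N) × Sp N => (p.1.1, p.2)) (by fun_prop))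
  exact h.stronglyMeasurable.integral_prod_right'.measurable

theorem lintegral_rpow_lt_top {a : ℝ} (ha : -1 < a) (t : ℝ) :
    ∫⁻ s in Ioo 0 t, ENNReal.ofReal ((t - s) ^ a) < ∞ := by
  rcases le_or_gt t 0 with ht | ht
  · simp [Ioo_eq_empty_of_le ht]
  have h1 : IntervalIntegrable (fun s : ℝ => (t - s) ^ a) volume 0 t := by
    have := (intervalIntegral.intervalIntegrable_rpow' ha (a := t) (b := 0)).comp_sub_left t
    simpa using this
  rw [intervalIntegrable_iff_integrableOn_Ioo_of_le ht.le] at h1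
  exact h1.lintegral_lt_top

/-- The forcing is bounded in `L^1` on `(0, t)`. -/
def BddL1 (Φ : ℝ → Sp N → ℝ) (t : ℝ) : Prop :=
  ∃ M : ℝ≥0∞, M ≠ ∞ ∧ ∀ᵐ s ∂(volume.restrict (Ioo 0 t)), ∫⁻ x, ‖Φ s x‖ₑ ≤ M

theorem CondG.lintegral_wordD (hG : CondG G γ d L) {τ : ℝ} (hτ : 0 < τ) (w : List (Fin N)) :
    ∫⁻ x, ‖wordD w (G τ) x‖ₑ =
      ENNReal.ofReal (τ ^ (-(w.length : ℝ) / d)) * ∫⁻ x, ‖wordD w (G 1) x‖ₑ := by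
  have hr : 0 < τ ^ (1 / d) := by positivity
  rw [← lintegral_enorm_scl hr (wordD w (G 1)), ← lintegral_const_mul' _ _ ENNReal.ofReal_ne_top]
  refine lintegral_congr fun x => ?_
  rw [hG.wordD_eq hτ, enorm_mul, ← inv_rpow_pow hτ,
    Real.enorm_eq_ofReal (by positivity : 0 ≤ ((τ ^ (1 / d))⁻¹) ^ w.length)]

theorem lintegral_conv_integrand {h φ : Sp N → ℝ} (hh : Measurable h) (hφ : Measurable φ) :
    ∫⁻ x, ∫⁻ y, ‖h (x - y)‖ₑ * ‖φ y‖ₑ = (∫⁻ x, ‖h x‖ₑ) * ∫⁻ y, ‖φ y‖ₑ := by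
  have hm : Measurable (Function.uncurry fun x y : Sp N => ‖h (x - y)‖ₑ * ‖φ y‖ₑ) := by
    unfold Function.uncurry
    fun_prop
  rw [lintegral_lintegral_swap hm.aemeasurable, ← lintegral_const_mul _ (by fun_prop)]
  refine lintegral_congr fun y => ?_
  rw [lintegral_mul_const' _ _ enorm_ne_top, lintegral_sub_right_eq_self (fun x => ‖h x‖ₑ)]

/-- By Tonelli the total mass is at most a constant times ∫ (t-s)^{-|w|/d} ds, finite exactly
because |w| < d. -/
theorem CondG.integrable_duhamel (hG : CondG G γ d L) {w : List (Fin N)} (hw : w.length ≤ γ)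
    (hwd : (w.length : ℝ) < d) (hΦ : Measurable (Function.uncurry Φ)) (hb : BddL1 Φ t) :
    Integrable (Function.uncurry fun s x => cv (kern G d w (t - s)) (Φ s) x)
      ((volume.restrict (Ioo 0 t)).prod volume) := by
  have hk := hG.measurable_kern hw
  have hm := measurable_cv_kern hk hΦ t
  refine ⟨hm.aestronglyMeasurable, ?_⟩
  obtain ⟨M, hM, hb⟩ := hb
  have hint : ∫⁻ x, ‖wordD w (G 1) x‖ₑ ≠ ∞ :=
    ((lintegral_enorm_le_nW le_rfl zero_le_one _).trans_lt
      (hG.nW_wordD_lt_top hG.L_pos hw)).ne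
  rw [hasFiniteIntegral_iff_enorm, lintegral_prod _ hm.enorm.aemeasurable]
  calc _ ≤ ∫⁻ s in Ioo 0 t, ENNReal.ofReal ((t - s) ^ (-(w.length : ℝ) / d)) *
        ((∫⁻ x, ‖wordD w (G 1) x‖ₑ) * M) := by
        refine lintegral_mono_ae ?_
        filter_upwards [hb, ae_restrict_mem measurableSet_Ioo] with s hs hst
        have hτ : 0 < t - s := sub_pos.2 hst.2
        have hΦs : Measurable (Φ s) := hΦ.comp measurable_prodMk_left
        refine (lintegral_mono fun x => enorm_cv_le _ _ x).trans ?_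
        dsimp only
        rw [← hG.wordD_eq_kern hτ, lintegral_conv_integrand (hG.measurable_wordD hτ hw)
          hΦs, hG.lintegral_wordD hτ, mul_assoc]
        gcongr
    _ < ∞ := by
        rw [lintegral_mul_const' _ _ (ENNReal.mul_ne_top hint hM)]
        refine ENNReal.mul_lt_top (lintegral_rpow_lt_top ?_ t)
          (ENNReal.mul_ne_top hint hM).lt_top
        rw [neg_div, neg_lt_neg_iff, div_lt_one hG.d_pos]
        exact hwd

/-- The convolution in space and time of the derivative along `w` of the kernel with `Φ`. -/
def duhamel (G : ℝ → Sp N → ℝ) (d : ℝ) (Φ : ℝ → Sp N → ℝ) (t : ℝ) (w : List (Fin N)) : Sp N → ℝ :=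
  fun x => ∫ s in Ioo 0 t, cv (kern G d w (t - s)) (Φ s) x

theorem BddL1.ae_integrable (hb : BddL1 Φ t) (hΦ : Measurable (Function.uncurry Φ)) :
    ∀ᵐ s ∂(volume.restrict (Ioo 0 t)), Integrable (Φ s) := by
  obtain ⟨M, hM, hb⟩ := hb
  filter_upwards [hb] with s hs
  exact ⟨(hΦ.comp measurable_prodMk_left : Measurable (Φ s)).aestronglyMeasurable,
    hs.trans_lt hM.lt_top⟩

/-- Fubini brings the test function inside the time and space integrals. For fixed s and y the claim
is then classical integration by parts for the smooth function x ↦ G(x-y,t-s). -/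
theorem CondG.hasWeakPartial_duhamel (hG : CondG G γ d L) {α : Fin N → ℕ} (hα : len α ≤ γ)
    (hαd : (len α : ℝ) < d) (hΦ : Measurable (Function.uncurry Φ)) (hb : BddL1 Φ t) :
    HasWeakPartial α (duhamel G d Φ t []) (duhamel G d Φ t (wordOf α)) := by
  have hw : (wordOf α).length ≤ γ := by rwa [length_wordOf]
  have hi0 := hG.integrable_duhamel (w := []) (by simp) (by simpa using hG.d_pos) hΦ hb
  have hiα := hG.integrable_duhamel hw (by rwa [length_wordOf]) hΦ hb
  refine ⟨hi0.integral_prod_right.locallyIntegrable, hiα.integral_prod_right.locallyIntegrable,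
    fun ψ hψ hc => ?_⟩
  have hcont : Continuous ψ := hψ.continuous
  have hcontw : Continuous (wordD (wordOf α) ψ) := (contDiff_top_wordD _ hψ).continuous
  obtain ⟨B, hB⟩ := hcont.bounded_above_of_compact_support hc
  obtain ⟨B', hB'⟩ := hcontw.bounded_above_of_compact_support (hasCompactSupport_wordD hc _)
  have hB2 : ∀ x, |ψ x| ≤ B := hB
  have hB2' : ∀ x, |wordD (wordOf α) ψ x| ≤ B' := hB'
  have hi0' : Integrable (Function.uncurry fun (s : ℝ) x =>
      cv (kern G d [] (t - s)) (Φ s) x * wordD (wordOf α) ψ x)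
      ((volume.restrict (Ioo 0 t)).prod volume) :=
    hi0.mul_bdd (c := B') (Continuous.aestronglyMeasurable (by fun_prop))
      (Eventually.of_forall fun p => hB2' p.2)
  have hiα' : Integrable (Function.uncurry fun (s : ℝ) x =>
      cv (kern G d (wordOf α) (t - s)) (Φ s) x * ψ x)
      ((volume.restrict (Ioo 0 t)).prod volume) :=
    hiα.mul_bdd (c := B) (Continuous.aestronglyMeasurable (by fun_prop))
      (Eventually.of_forall fun p => hB2 p.2)
  rw [partialPow_eq_wordD]
  simp only [duhamel, ← integral_mul_const]
  rw [← integral_integral_swap hi0', ← integral_integral_swap hiα', ← integral_const_mul]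
  refine integral_congr_ae ?_
  filter_upwards [hb.ae_integrable hΦ, ae_restrict_mem measurableSet_Ioo] with s hs hst
  have hτ : 0 < t - s := sub_pos.2 hst.2
  rw [← hG.wordD_eq_kern hτ, ← hG.wordD_eq_kern hτ, wordD_nil,
    integral_cv_mul (hG.integrable hτ) hs hcontw hB2',
    integral_cv_mul (hG.integrable_wordD hτ hw) hs hcont hB2, ← integral_const_mul]
  refine integral_congr_ae (Eventually.of_forall fun y => ?_)
  have hsm : ContDiff ℝ (wordOf α).length (G (t - s)) :=
    (hG.contDiff hτ).of_le (by exact_mod_cast hw)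
  have hs' : ContDiff ℝ (wordOf α).length fun x => G (t - s) (x - y) :=
    hsm.comp (contDiff_id.sub contDiff_const)
  have h1 := integral_mul_wordD (wordOf α) hs' hψ hc
  simp only [wordD_comp_sub] at h1
  -- The order reversed by the integrations by parts is restored by symmetry of the derivatives.
  rw [wordD_perm (List.reverse_perm _) (by simpa using hsm)] at h1
  simp only [h1, length_wordOf]
  ring

theorem HasWeakPartial.ae_eq {α : Fin N → ℕ} {u w₁ w₂ : Sp N → ℝ} (h₁ : HasWeakPartial α u w₁)
    (h₂ : HasWeakPartial α u w₂) : w₁ =ᵐ[volume] w₂ := by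
  have h : ∀ᵐ x, w₁ x - w₂ x = 0 := by
    refine ae_eq_zero_of_integral_contDiff_smul_eq_zero (h₁.2.1.sub h₂.2.1) fun ψ hψ hc => ?_
    have e := (h₁.2.2 ψ hψ hc).symm.trans (h₂.2.2 ψ hψ hc)
    have e' : ∫ x, w₁ x * ψ x = ∫ x, w₂ x * ψ x := mul_left_cancel₀ (by simp) e
    have i₁ : Integrable fun x => w₁ x * ψ x := by
      simpa [mul_comm] using h₁.2.1.integrable_smul_left_of_hasCompactSupport hψ.continuous hc
    have i₂ : Integrable fun x => w₂ x * ψ x := by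
      simpa [mul_comm] using h₂.2.1.integrable_smul_left_of_hasCompactSupport hψ.continuous hc
    have : ∀ x, ψ x • (w₁ x - w₂ x) = w₁ x * ψ x - w₂ x * ψ x := fun x => by
      rw [smul_eq_mul]; ring
    simp only [this]
    rw [integral_sub i₁ i₂, e', sub_self]
  exact h.mono fun x hx => sub_eq_zero.1 hx

theorem HasWeakPartial.weakPartial_ae_eq {α : Fin N → ℕ} {u w : Sp N → ℝ}
    (h : HasWeakPartial α u w) : weakPartial α u =ᵐ[volume] w := by
  have hex : ∃ w, HasWeakPartial α u w := ⟨w, h⟩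
  rw [weakPartial, dif_pos hex]
  exact hex.choose_spec.ae_eq h

end Duhamel

/-! ### The estimate of the Duhamel integral for large times -/

/-- A jointly measurable forcing for which `E_{K,q}` is finite at every time and locally bounded
at almost every time. -/
structure Regular (d K : ℝ) (q : ℝ≥0∞) (f : ℝ → Sp N → ℝ) : Prop where
  meas : Measurable (Function.uncurry f)
  lt_top : ∀ s, EKq d K q f s < ∞
  bdd : ∀ T : ℝ, 0 < T → ∃ M : ℝ≥0∞, M ≠ ∞ ∧
    ∀ᵐ s ∂(volume.restrict (Ioo 0 T)), EKq d K q f s ≤ M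

section LargeTime

variable {G : ℝ → Sp N → ℝ} {γ : ℕ} {d L K : ℝ} {q : ℝ≥0∞} {f Φ : ℝ → Sp N → ℝ}

theorem Admissible.exists_regular (hf : Admissible d K q f) :
    ∃ f' : ℝ → Sp N → ℝ, Regular d K q f' ∧
      ∀ᵐ s ∂(volume.restrict (Ioi (0 : ℝ))), f s =ᵐ[volume] f' s := by
  obtain ⟨f', hm, hE, hae⟩ := hf.exists_measurable
  refine ⟨f', ⟨hm, hE, fun T hT => ⟨_, (hf.bdd T hT).ne, ?_⟩⟩, hae⟩
  have hae' : ∀ᵐ s ∂(volume.restrict (Ioo 0 T)), f s =ᵐ[volume] f' s :=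
    ae_restrict_of_ae_restrict_of_subset Ioo_subset_Ioi_self hae
  filter_upwards [ENNReal.ae_le_essSup (EKq d K q f), hae'] with s hs hs'
  rwa [← EKq_congr hs']

theorem Regular.measurable_section (hf : Regular d K q f) (s : ℝ) : Measurable (f s) :=
  hf.meas.comp measurable_prodMk_left

theorem rpow_neg_le_one {s : ℝ} (hK : 0 ≤ K) (hd : 0 < d) (hs : 0 < s) :
    ENNReal.ofReal (((s + 1) ^ (1 / d)) ^ (-K)) ≤ 1 := by
  rw [← ENNReal.ofReal_one]
  refine ENNReal.ofReal_le_ofReal (Real.rpow_le_one_of_one_le_of_nonpos ?_ (by linarith))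
  exact Real.one_le_rpow (by linarith) (one_div_pos.2 hd).le

theorem Regular.bddL1 (hf : Regular d K q f) (hK : 0 ≤ K) (hd : 0 < d) {t : ℝ} (ht : 0 < t) :
    BddL1 f t := by
  obtain ⟨M, hM, h⟩ := hf.bdd t ht
  refine ⟨ENNReal.ofReal (2 ^ K) * (1 * M), ENNReal.mul_ne_top ENNReal.ofReal_ne_top
    (ENNReal.mul_ne_top ENNReal.one_ne_top hM), ?_⟩
  filter_upwards [h, ae_restrict_mem measurableSet_Ioo] with s hs hst
  refine (lintegral_enorm_le_nW hK (by have := hst.1; positivity) _).trans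
    ((nW_le_EKq (d := d) (q := q) hK hst.1 (hf.measurable_section s)).trans ?_)
  gcongr
  exact rpow_neg_le_one hK hd hst.1

theorem CondG.bddL1_projP (hG : CondG G γ d L) (hK : 0 ≤ K) (hKL : K < L)
    (hKγ : ⌊K⌋₊ + 1 ≤ γ) (hq : 1 ≤ q) (hf : Regular d K q f)
    (hΦ : ∀ s, 0 < s → Φ s = projP G K s (f s)) {t : ℝ} (ht : 0 < t) : BddL1 Φ t := by
  obtain ⟨C, hC, hb⟩ := hG.exists_projP_bounds hK hKL hKγ hq
  obtain ⟨M, hM, h⟩ := hf.bdd t ht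
  refine ⟨C * (1 * M), ENNReal.mul_ne_top hC (ENNReal.mul_ne_top ENNReal.one_ne_top hM), ?_⟩
  filter_upwards [h, ae_restrict_mem measurableSet_Ioo] with s hs hst
  rw [hΦ s hst.1]
  refine (lintegral_enorm_le_nW hK (by have := hst.1; positivity) _).trans
    ((hb f s hst.1 (hf.measurable_section s)).1.trans ?_)
  gcongr
  exact rpow_neg_le_one hK hG.d_pos hst.1

theorem lintegral_norm_rpow_le (hK : 0 ≤ K) {s : ℝ} (hs : 0 < s) (φ : Sp N → ℝ) :
    ∫⁻ y, ‖φ y‖ₑ * ENNReal.ofReal (‖y‖ ^ K) ≤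
      ENNReal.ofReal (((s + 1) ^ (1 / d)) ^ K) * nW K ((s + 1) ^ (1 / d)) φ := by
  unfold nW
  rw [← lintegral_const_mul' _ _ ENNReal.ofReal_ne_top]
  refine lintegral_mono fun y => ?_
  rw [mul_left_comm, ← ENNReal.ofReal_mul (by positivity)]
  gcongr
  exact pow_le_wt hK le_rfl (by positivity) y

/-- The weighted norm of `P_K(s) f(s)` is controlled by `E_{K,q}[f](s)`. -/
theorem CondG.exists_lintegral_projP_le (hG : CondG G γ d L) (hK : 0 ≤ K) (hKL : K < L)
    (hKγ : ⌊K⌋₊ + 1 ≤ γ) (hq : 1 ≤ q) : ∃ C : ℝ≥0∞, C ≠ ∞ ∧ ∀ (f : ℝ → Sp N → ℝ) (s : ℝ),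
      0 < s → Measurable (f s) →
      ∫⁻ y, ‖projP G K s (f s) y‖ₑ * ENNReal.ofReal (‖y‖ ^ K) ≤ C * EKq d K q f s := by
  obtain ⟨C, hC, hb⟩ := hG.exists_projP_bounds hK hKL hKγ hq
  refine ⟨C, hC, fun f s hs hf => (lintegral_norm_rpow_le (d := d) hK hs _).trans ?_⟩
  refine (mul_le_mul_right (hb f s hs hf).1 _).trans_eq ?_
  have hρ : 0 < (s + 1) ^ (1 / d) := by positivity
  rw [mul_left_comm, ← mul_assoc (ENNReal.ofReal _), ofReal_rpow_mul_rpow hρ, add_neg_cancel,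
    Real.rpow_zero, ENNReal.ofReal_one, one_mul]

theorem qW_le (t : ℝ) (φ : Sp N → ℝ) :
    qW d K t φ ≤ ∫⁻ y, ‖φ y‖ₑ * ENNReal.ofReal (‖y‖ ^ K) := by
  refine lintegral_mono fun y => ?_
  gcongr
  exact min_le_left _ _

theorem Regular.nW_lt_top (hf : Regular d K q f) (hK : 0 ≤ K) {s : ℝ} (hs : 0 < s) :
    nW K ((s + 1) ^ (1 / d)) (f s) < ∞ :=
  (nW_le_EKq (d := d) (q := q) hK hs (hf.measurable_section s)).trans_lt
    (ENNReal.mul_lt_top ENNReal.ofReal_lt_top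
      (ENNReal.mul_lt_top ENNReal.ofReal_lt_top (hf.lt_top s)))

theorem ofReal_rpow_const_mul {c x a : ℝ} (hc : 0 < c) (hx : 0 < x) :
    ENNReal.ofReal ((c * x) ^ a) = ENNReal.ofReal (c ^ a) * ENNReal.ofReal (x ^ a) := by
  rw [← ENNReal.ofReal_mul (by positivity), Real.mul_rpow hc.le hx.le]

/-- The crude bound holds at all times, since `qW` is controlled by E_{K,q} in the early range. The
refined early bound keeps `qW` and replaces t-s by t, which is legitimate as t-s > t/2. -/
theorem CondG.exists_zN_term_le (hG : CondG G γ d L) (hK : 0 ≤ K) (hKL : K < L)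
    (hKγ : ⌊K⌋₊ + 1 ≤ γ) (hq : 1 ≤ q) {w : List (Fin N)} (hw : w.length ≤ γ) :
    ∃ C : ℝ≥0∞, C ≠ ∞ ∧ ∀ f : ℝ → Sp N → ℝ, Regular d K q f → ∀ t s : ℝ, 1 ≤ t → 0 < s → s < t →
      zN K q (t ^ (1 / d)) (cv (wordD w (G (t - s))) (projP G K s (f s))) ≤
          C * (ENNReal.ofReal (t ^ (-K / d)) *
            (ENNReal.ofReal ((t - s) ^ (-(w.length : ℝ) / d)) * EKq d K q f s)) ∧
      (s < t / 2 →
        zN K q (t ^ (1 / d)) (cv (wordD w (G (t - s))) (projP G K s (f s))) ≤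
          C * (ENNReal.ofReal (t ^ (-(K + w.length) / d)) *
            qW d K t (projP G K s (f s)))) := by
  obtain ⟨C₁, hC₁, h₁⟩ := hG.exists_zN_cv_le_late hK hKL hq hw
  obtain ⟨C₂, hC₂, h₂⟩ := hG.exists_zN_cv_le_early hK hKL hKγ hq hw
  obtain ⟨C₃, hC₃, h₃⟩ := hG.exists_projP_bounds hK hKL hKγ hq
  obtain ⟨C₄, hC₄, h₄⟩ := hG.exists_lintegral_projP_le hK hKL hKγ hq
  have hd := hG.d_pos
  set c₁ := ENNReal.ofReal ((1 / 2) ^ (-K / d)) with hc₁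
  set c₂ := ENNReal.ofReal ((1 / 2) ^ (-(w.length : ℝ) / d)) with hc₂
  refine ⟨C₁ * (C₃ * c₁) + C₂ * C₄ + C₂ * c₂, ?_, fun f hf t s ht hs hst => ?_⟩
  · refine ENNReal.add_ne_top.2 ⟨ENNReal.add_ne_top.2 ⟨?_, ENNReal.mul_ne_top hC₂ hC₄⟩,
      ENNReal.mul_ne_top hC₂ ENNReal.ofReal_ne_top⟩
    exact ENNReal.mul_ne_top hC₁ (ENNReal.mul_ne_top hC₃ ENNReal.ofReal_ne_top)
  have hfs := hf.measurable_section s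
  have ht0 : 0 < t := by linarith
  have hτ : 0 < t - s := by linarith
  have hnW := hf.nW_lt_top hK hs
  have hγ : ∀ α ∈ multiIdx N K, len α ≤ γ := fun α hα => by
    have := (len_le_floor hK).2 (mem_multiIdx.1 hα)
    omega
  have hΦm : Measurable (projP G K s (f s)) := by
    refine hfs.sub (Finset.measurable_sum _ fun α hα => ?_)
    exact (hG.measurable_gFun hs (hγ α hα)).const_mul _
  have hR : ∀ a : ℝ, (t ^ (1 / d)) ^ (-a) = t ^ (-a / d) := fun a => by
    rw [← Real.rpow_mul ht0.le]
    congr 1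
    ring
  have early : s < t / 2 →
      zN K q (t ^ (1 / d)) (cv (wordD w (G (t - s))) (projP G K s (f s))) ≤
        C₂ * (ENNReal.ofReal ((t - s) ^ (-(w.length : ℝ) / d)) *
          (ENNReal.ofReal (t ^ (-K / d)) * qW d K t (projP G K s (f s)))) := by
    intro hs2
    rw [← hR]
    exact h₂ t s hs hs2 _ hΦm
      (fun α hα => (hG.moments_projP hK hKL hKγ hs hfs hnW hα).1)
      (fun h1 α hα => (hG.moments_projP hK hKL hKγ hs hfs hnW hα).2 h1)
  refine ⟨?_, fun hs2 => (early hs2).trans ?_⟩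
  · rcases lt_or_ge s (t / 2) with hs2 | hs2
    · refine (early hs2).trans ?_
      calc _ ≤ C₂ * (ENNReal.ofReal ((t - s) ^ (-(w.length : ℝ) / d)) *
            (ENNReal.ofReal (t ^ (-K / d)) * (C₄ * EKq d K q f s))) := by
            gcongr
            exact (qW_le t _).trans (h₄ f s hs hfs)
        _ = C₂ * C₄ * (ENNReal.ofReal (t ^ (-K / d)) *
            (ENNReal.ofReal ((t - s) ^ (-(w.length : ℝ) / d)) * EKq d K q f s)) := by ring
        _ ≤ _ := mul_le_mul_left (le_add_right le_add_self) _
    · have hρ : ENNReal.ofReal (((s + 1) ^ (1 / d)) ^ (-K)) ≤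
          c₁ * ENNReal.ofReal (t ^ (-K / d)) := by
        rw [hc₁, ← ofReal_rpow_const_mul (by norm_num) ht0, ← Real.rpow_mul (by positivity)]
        refine ENNReal.ofReal_le_ofReal ?_
        have : 1 / d * -K = -K / d := by ring
        rw [this]
        refine Real.rpow_le_rpow_of_nonpos (by positivity) (by linarith) ?_
        rw [neg_div, neg_nonpos]
        positivity
      refine (h₁ t s ht hs2 hst _ hΦm).trans ?_
      calc _ ≤ C₁ * (ENNReal.ofReal ((t - s) ^ (-(w.length : ℝ) / d)) *
            (C₃ * (c₁ * ENNReal.ofReal (t ^ (-K / d)) * EKq d K q f s))) := by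
            gcongr
            refine ((h₃ f s hs hfs).2 (by linarith)).trans ?_
            gcongr
        _ = C₁ * (C₃ * c₁) * (ENNReal.ofReal (t ^ (-K / d)) *
            (ENNReal.ofReal ((t - s) ^ (-(w.length : ℝ) / d)) * EKq d K q f s)) := by ring
        _ ≤ _ := mul_le_mul_left (le_add_right le_self_add) _
  · have hτ' : ENNReal.ofReal ((t - s) ^ (-(w.length : ℝ) / d)) ≤
        c₂ * ENNReal.ofReal (t ^ (-(w.length : ℝ) / d)) := by
      rw [hc₂, ← ofReal_rpow_const_mul (by norm_num) ht0]
      refine ENNReal.ofReal_le_ofReal ?_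
      refine Real.rpow_le_rpow_of_nonpos (by positivity) (by linarith) ?_
      rw [neg_div, neg_nonpos]
      positivity
    have hexp : t ^ (-(K + w.length) / d) = t ^ (-(w.length : ℝ) / d + -K / d) := by
      congr 1
      ring
    calc _ ≤ C₂ * (c₂ * ENNReal.ofReal (t ^ (-(w.length : ℝ) / d)) *
          (ENNReal.ofReal (t ^ (-K / d)) * qW d K t (projP G K s (f s)))) := by gcongr
      _ = C₂ * c₂ * ((ENNReal.ofReal (t ^ (-(w.length : ℝ) / d)) * ENNReal.ofReal (t ^ (-K / d))) *
            qW d K t (projP G K s (f s))) := by ring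
      _ ≤ _ := by
        rw [ofReal_rpow_mul_rpow ht0, ← hexp]
        exact mul_le_mul_left le_add_self _

/-- Dominated convergence: the second entry of the minimum tends to 0 pointwise because K < [K]+1,
and the first entry |y|^K is an integrable majorant, E_{K,q} being bounded on (0,T). -/
theorem CondG.tendsto_lintegral_qW (hG : CondG G γ d L) (hK : 0 ≤ K) (hKL : K < L)
    (hKγ : ⌊K⌋₊ + 1 ≤ γ) (hq : 1 ≤ q) (hf : Regular d K q f)
    (hΦm : Measurable (Function.uncurry Φ)) (hΦ : ∀ s, 0 < s → Φ s = projP G K s (f s)) {T : ℝ}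
    (hT : 0 < T) : Tendsto (fun t => ∫⁻ s in Ioo 0 T, qW d K t (Φ s)) atTop (𝓝 0) := by
  obtain ⟨C, hC, h⟩ := hG.exists_lintegral_projP_le hK hKL hKγ hq
  obtain ⟨M, hM, hb⟩ := hf.bdd T hT
  set F : ℝ → ℝ × Sp N → ℝ≥0∞ := fun t p => ‖Φ p.1 p.2‖ₑ * ENNReal.ofReal
    (min (‖p.2‖ ^ K) (‖p.2‖ ^ (⌊K⌋₊ + 1) * (t ^ (1 / d)) ^ (K - (⌊K⌋₊ + 1)))) with hF
  have hΦe : Measurable fun p : ℝ × Sp N => ‖Φ p.1 p.2‖ₑ := hΦm.enorm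
  have hFm : ∀ t, Measurable (F t) := fun t => by
    simp only [hF]
    fun_prop
  have hBm : Measurable fun p : ℝ × Sp N => ‖Φ p.1 p.2‖ₑ * ENNReal.ofReal (‖p.2‖ ^ K) := by
    fun_prop
  have heq : ∀ t, ∫⁻ s in Ioo 0 T, qW d K t (Φ s) =
      ∫⁻ p, F t p ∂((volume.restrict (Ioo 0 T)).prod volume) := fun t => by
    rw [lintegral_prod _ (hFm t).aemeasurable]
    rfl
  simp only [heq]
  rw [← lintegral_zero (μ := (volume.restrict (Ioo 0 T)).prod (volume : Measure (Sp N)))]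
  refine tendsto_lintegral_filter_of_dominated_convergence
    (fun p : ℝ × Sp N => ‖Φ p.1 p.2‖ₑ * ENNReal.ofReal (‖p.2‖ ^ K))
    (Eventually.of_forall hFm) ?_ ?_ ?_
  · refine Eventually.of_forall fun t => Eventually.of_forall fun p => ?_
    simp only [hF]
    gcongr
    exact min_le_left _ _
  · rw [lintegral_prod _ hBm.aemeasurable]
    refine ne_top_of_le_ne_top (b := ∫⁻ _ in Ioo 0 T, C * M) ?_ (lintegral_mono_ae ?_)
    · rw [lintegral_const]
      exact ENNReal.mul_ne_top (ENNReal.mul_ne_top hC hM) (by simp)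
    · filter_upwards [hb, ae_restrict_mem measurableSet_Ioo] with s hs hst
      simp only [hΦ s hst.1]
      refine (h f s hst.1 (hf.measurable_section s)).trans ?_
      gcongr
  · refine Eventually.of_forall fun p => ?_
    have hlt : 0 < (⌊K⌋₊ + 1 : ℝ) - K := by linarith [Nat.lt_floor_add_one K]
    have h1 : Tendsto (fun t : ℝ => (t ^ (1 / d)) ^ (K - (⌊K⌋₊ + 1))) atTop (𝓝 0) := by
      have := (tendsto_rpow_neg_atTop hlt).comp (tendsto_rpow_atTop (one_div_pos.2 hG.d_pos))
      simpa [Function.comp_def] using this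
    have h2 : Tendsto (fun t : ℝ => min (‖p.2‖ ^ K)
        (‖p.2‖ ^ (⌊K⌋₊ + 1) * (t ^ (1 / d)) ^ (K - (⌊K⌋₊ + 1)))) atTop (𝓝 0) := by
      have := (tendsto_const_nhds (x := ‖p.2‖ ^ K)).min (h1.const_mul (‖p.2‖ ^ (⌊K⌋₊ + 1)))
      rwa [mul_zero, min_eq_right (by positivity)] at this
    have h3 := ENNReal.Tendsto.const_mul (a := ‖Φ p.1 p.2‖ₑ) (ENNReal.tendsto_ofReal h2)
      (Or.inr enorm_ne_top)
    rw [ENNReal.ofReal_zero, mul_zero] at h3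
    exact h3

/-- Minkowski's inequality for the L^q part, Tonelli for the weighted part. -/
theorem zN_duhamel_le {k : ℝ → Sp N → ℝ} (hk : Measurable (Function.uncurry k))
    (hΦ : Measurable (Function.uncurry Φ)) (hq : 1 ≤ q) (R t : ℝ) :
    zN K q R (fun x => ∫ s in Ioo 0 t, cv (k (t - s)) (Φ s) x) ≤
      ∫⁻ s in Ioo 0 t, zN K q R (cv (k (t - s)) (Φ s)) := by
  have hm := measurable_cv_kern hk hΦ t
  have hme : Measurable (Function.uncurry fun s x => ‖cv (k (t - s)) (Φ s) x‖ₑ) := hm.enorm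
  have hpt : ∀ x, ‖∫ s in Ioo 0 t, cv (k (t - s)) (Φ s) x‖ₑ ≤
      ∫⁻ s in Ioo 0 t, ‖cv (k (t - s)) (Φ s) x‖ₑ := fun x =>
    enorm_integral_le_lintegral_enorm _
  have hwm := measurable_wt (N := N) K R
  have hw : Measurable (Function.uncurry fun s x =>
      ‖cv (k (t - s)) (Φ s) x‖ₑ * ENNReal.ofReal (wt K R x)) := by
    have : Measurable fun p : ℝ × Sp N => ENNReal.ofReal (wt K R p.2) := by fun_prop
    exact hme.mul this
  have hnW : Measurable fun s => nW K R (cv (k (t - s)) (Φ s)) := hw.lintegral_prod_right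
  unfold zN
  rw [lintegral_add_right _ hnW, lintegral_const_mul' _ _ ENNReal.ofReal_ne_top]
  refine add_le_add (mul_le_mul_right ?_ _) ?_
  · calc _ ≤ eLpNorm (fun x => ∫⁻ s in Ioo 0 t, ‖cv (k (t - s)) (Φ s) x‖ₑ) q volume :=
          eLpNorm_mono_enorm fun x => by simpa using hpt x
      _ ≤ ∫⁻ s in Ioo 0 t, eLpNorm (fun x => ‖cv (k (t - s)) (Φ s) x‖ₑ) q volume :=
          eLpNorm_lintegral_le hme hq
      _ = _ := by simp only [eLpNorm_enorm]
  · calc _ ≤ ∫⁻ x, ∫⁻ s in Ioo 0 t, ‖cv (k (t - s)) (Φ s) x‖ₑ * ENNReal.ofReal (wt K R x) := by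
          refine lintegral_mono fun x => ?_
          rw [lintegral_mul_const' _ _ ENNReal.ofReal_ne_top]
          exact mul_le_mul_left (hpt x) _
      _ = _ := (lintegral_lintegral_swap hw.aemeasurable).symm

theorem CondG.exists_zN_duhamel_le (hG : CondG G γ d L) (hK : 0 ≤ K) (hKL : K < L)
    (hKγ : ⌊K⌋₊ + 1 ≤ γ) (hq : 1 ≤ q) {w : List (Fin N)} (hw : w.length ≤ γ) :
    ∃ C : ℝ≥0∞, C ≠ ∞ ∧ ∀ f Φ : ℝ → Sp N → ℝ, Regular d K q f → Measurable (Function.uncurry Φ) →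
      (∀ s, 0 < s → Φ s = projP G K s (f s)) → ∀ ε : ℝ, 0 < ε → ∀ T : ℝ, 0 < T →
      ∀ᶠ t : ℝ in atTop, zN K q (t ^ (1 / d)) (duhamel G d Φ t w) ≤
        ENNReal.ofReal (ε * t ^ (-(K + w.length) / d)) + C * (ENNReal.ofReal (t ^ (-K / d)) *
          ∫⁻ s in Ioo T t, ENNReal.ofReal ((t - s) ^ (-(w.length : ℝ) / d)) * EKq d K q f s) := by
  obtain ⟨C, hC, h⟩ := hG.exists_zN_term_le hK hKL hKγ hq hw
  refine ⟨C, hC, fun f Φ hf hΦm hΦ ε hε T hT => ?_⟩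
  have hlim := hG.tendsto_lintegral_qW hK hKL hKγ hq hf hΦm hΦ (by linarith : 0 < T + 1)
  have hlim' := ENNReal.Tendsto.const_mul (a := C) hlim (Or.inr hC)
  rw [mul_zero] at hlim'
  have hev := hlim'.eventually_lt_const (ENNReal.ofReal_pos.2 hε)
  -- Beyond 2(T+1) the whole interval (0,T+1) lies in the early range s < t/2.
  filter_upwards [hev, eventually_gt_atTop (2 * (T + 1)), eventually_ge_atTop 1] with t hqt htT ht1
  have ht0 : 0 < t := by linarith
  refine (zN_duhamel_le (hG.measurable_kern hw) hΦm hq _ t).trans ?_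
  -- The two open intervals overlap, so that no endpoint has to be treated.
  have hsub : Ioo 0 t ⊆ Ioo 0 (T + 1) ∪ Ioo T t := by
    intro s hs
    rcases lt_or_ge s (T + 1) with h1 | h1
    · exact Or.inl ⟨hs.1, h1⟩
    · exact Or.inr ⟨by linarith, hs.2⟩
  have hterm : ∀ s, 0 < s → s < t → cv (kern G d w (t - s)) (Φ s) =
      cv (wordD w (G (t - s))) (projP G K s (f s)) := fun s hs hst => by
    rw [hΦ s hs, hG.wordD_eq_kern (by linarith)]
  refine (lintegral_mono_set hsub).trans ((lintegral_union_le _ _ _).trans (add_le_add ?_ ?_))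
  · calc _ ≤ ∫⁻ s in Ioo 0 (T + 1), C * (ENNReal.ofReal (t ^ (-(K + w.length) / d)) *
            qW d K t (Φ s)) := by
          refine setLIntegral_mono' measurableSet_Ioo fun s hs => ?_
          rw [hterm s hs.1 (by linarith [hs.2]), hΦ s hs.1]
          exact (h f hf t s ht1 hs.1 (by linarith [hs.2])).2 (by linarith [hs.2])
      _ = ENNReal.ofReal (t ^ (-(K + w.length) / d)) *
            (C * ∫⁻ s in Ioo 0 (T + 1), qW d K t (Φ s)) := by
          rw [lintegral_const_mul' _ _ hC, lintegral_const_mul' _ _ ENNReal.ofReal_ne_top]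
          ring
      _ ≤ _ := by
          rw [ENNReal.ofReal_mul hε.le, mul_comm]
          gcongr
  · rw [← lintegral_const_mul' _ _ ENNReal.ofReal_ne_top, ← lintegral_const_mul' _ _ hC]
    refine setLIntegral_mono' measurableSet_Ioo fun s hs => ?_
    have hs0 : 0 < s := hT.trans hs.1
    rw [hterm s hs0 hs.2]
    exact (h f hf t s ht1 hs0 hs.2).1

end LargeTime

/-! ### The remainder -/

section Remainder

variable {G : ℝ → Sp N → ℝ} {γ : ℕ} {d L K : ℝ} {q : ℝ≥0∞} {f f' Φ : ℝ → Sp N → ℝ}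

/-- The semigroup law with (t-s)+(s+1) = t+1. It lets g_α(t) be taken out of the time integral in
the second expression of the remainder. -/
theorem CondG.expL_gFun (hG : CondG G γ d L) {s t : ℝ} (hs : 0 < s) (hst : s < t) {α : Fin N → ℕ}
    (hα : len α ≤ γ) : expL G (t - s) (gFun G α s) = gFun G α t := by
  have h := hG.wordD_eq_cv (sub_pos.2 hst) (by linarith : 0 < s + 1) (w := wordOf α)
    (by rwa [length_wordOf])
  have e : t - s + (s + 1) = t + 1 := by ring
  rw [e] at h
  funext x
  rw [gFun_eq, h]
  simp only [expL, cv, gFun_eq, ← integral_const_mul]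
  refine integral_congr_ae (Eventually.of_forall fun y => ?_)
  simp only
  ring

theorem CondG.integrable_mul (hG : CondG G γ d L) {τ : ℝ} (hτ : 0 < τ) {φ : Sp N → ℝ}
    (hφ : Integrable φ) (x : Sp N) : Integrable fun y => G τ (x - y) * φ y := by
  obtain ⟨B, hB⟩ := hG.exists_bound hτ
  have hc := (hG.contDiff hτ).continuous
  exact hφ.bdd_mul (c := B) (Continuous.aestronglyMeasurable (by fun_prop))
    (Eventually.of_forall fun y => hB [] (by simp) _)

theorem CondG.expL_projP (hG : CondG G γ d L) (hK : 0 ≤ K) (hKγ : ⌊K⌋₊ + 1 ≤ γ) {s t : ℝ}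
    (hs : 0 < s) (hst : s < t) {φ : Sp N → ℝ} (hφ : Integrable φ) (x : Sp N) :
    expL G (t - s) (projP G K s φ) x = expL G (t - s) φ x -
      ∑ α ∈ multiIdx N K, moment G φ s α * gFun G α t x := by
  have hτ := sub_pos.2 hst
  have hγ : ∀ α ∈ multiIdx N K, len α ≤ γ := fun α hα => by
    have := (len_le_floor hK).2 (mem_multiIdx.1 hα)
    omega
  have hgi : ∀ α ∈ multiIdx N K, Integrable (gFun G α s) := fun α hα => by
    have h : gFun G α s = fun x => _ := funext (gFun_eq α s)
    rw [h]
    exact (hG.integrable_wordD (by linarith) (by rw [length_wordOf]; exact hγ α hα)).const_mul _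
  have heq : ∀ y, G (t - s) (x - y) * projP G K s φ y = G (t - s) (x - y) * φ y -
      ∑ α ∈ multiIdx N K, moment G φ s α * (G (t - s) (x - y) * gFun G α s y) := fun y => by
    rw [projP, mul_sub, Finset.mul_sum]
    congr 1
    exact Finset.sum_congr rfl fun α _ => by ring
  have hi : ∀ α ∈ multiIdx N K, Integrable fun y =>
      moment G φ s α * (G (t - s) (x - y) * gFun G α s y) := fun α hα =>
    (hG.integrable_mul hτ (hgi α hα) x).const_mul _
  rw [expL]
  simp only [heq]
  rw [integral_sub (hG.integrable_mul hτ hφ x) (integrable_finsetSum _ hi),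
    integral_finsetSum _ hi]
  congr 1
  refine Finset.sum_congr rfl fun α hα => ?_
  rw [integral_const_mul, ← hG.expL_gFun hs hst (hγ α hα)]
  rfl

theorem CondG.kern_nil (hG : CondG G γ d L) {τ : ℝ} (hτ : 0 < τ) : kern G d [] τ = G τ :=
  (hG.wordD_eq_kern hτ []).symm

theorem CondG.ae_expL_projP_eq (hG : CondG G γ d L)
    (hae : ∀ᵐ s ∂(volume.restrict (Ioi (0 : ℝ))), f s =ᵐ[volume] f' s)
    (hΦ : ∀ s, 0 < s → Φ s = projP G K s (f' s)) (t : ℝ) :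
    ∀ᵐ s ∂(volume.restrict (Ioo 0 t)),
      expL G (t - s) (projP G K s (f s)) = cv (kern G d [] (t - s)) (Φ s) := by
  filter_upwards [ae_restrict_of_ae_restrict_of_subset Ioo_subset_Ioi_self hae,
    ae_restrict_mem measurableSet_Ioo] with s hs hst
  rw [expL_congr (projP_congr hs s), hΦ s hst.1, hG.kern_nil (sub_pos.2 hst.2)]
  rfl

/-- The exceptional set of times does not depend on x, because each integrand agrees as a function
of x; hence equality holds at every point. -/
theorem CondG.remR_eq_duhamel (hG : CondG G γ d L)
    (hae : ∀ᵐ s ∂(volume.restrict (Ioi (0 : ℝ))), f s =ᵐ[volume] f' s)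
    (hΦ : ∀ s, 0 < s → Φ s = projP G K s (f' s)) (t : ℝ) :
    remR G K f t = duhamel G d Φ t [] := by
  funext x
  exact integral_congr_ae ((hG.ae_expL_projP_eq hae hΦ t).mono fun s hs => by simp only [hs])

theorem CondG.exists_moment_le_EKq (hG : CondG G γ d L) (hK : 0 ≤ K) (hKL : K < L)
    (hKγ : ⌊K⌋₊ + 1 ≤ γ) {α : Fin N → ℕ} (hα : (len α : ℝ) ≤ K) : ∃ C : ℝ, 0 < C ∧
      ∀ (f : ℝ → Sp N → ℝ) (t : ℝ), 0 < t → Measurable (f t) →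
        ENNReal.ofReal |moment G (f t) t α| ≤
          ENNReal.ofReal (C * (1 + t) ^ (-(K - (len α : ℝ)) / d)) * EKq d K q f t := by
  obtain ⟨C, hC, h⟩ := hG.exists_moment_le hK hKL hKγ α hα
  -- The added 1 only ensures a positive constant.
  refine ⟨(C * ENNReal.ofReal (2 ^ K)).toReal + 1, by positivity, fun f t ht hf => ?_⟩
  have hCt : C * ENNReal.ofReal (2 ^ K) ≠ ∞ := ENNReal.mul_ne_top hC ENNReal.ofReal_ne_top
  have hρ : 0 < (t + 1) ^ (1 / d) := by positivity
  rw [← Real.enorm_eq_ofReal_abs]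
  refine (h t ht (f t)).trans ((mul_le_mul_right (mul_le_mul_right
    (nW_le_EKq (d := d) (q := q) hK ht hf) _) _).trans ?_)
  have e : ENNReal.ofReal (((t + 1) ^ (1 / d)) ^ len α) *
      ENNReal.ofReal (((t + 1) ^ (1 / d)) ^ (-K)) =
      ENNReal.ofReal ((1 + t) ^ (-(K - (len α : ℝ)) / d)) := by
    rw [← Real.rpow_natCast, ofReal_rpow_mul_rpow hρ, ← Real.rpow_mul (by positivity), add_comm t]
    congr 2
    ring
  calc _ = C * ENNReal.ofReal (2 ^ K) * (ENNReal.ofReal (((t + 1) ^ (1 / d)) ^ len α) *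
        ENNReal.ofReal (((t + 1) ^ (1 / d)) ^ (-K))) * EKq d K q f t := by ring
    _ ≤ _ := by
      rw [e, ENNReal.ofReal_mul (by positivity)]
      gcongr
      rw [ENNReal.ofReal_add ENNReal.toReal_nonneg zero_le_one, ENNReal.ofReal_toReal hCt]
      exact le_self_add

theorem CondG.integrableOn_moment (hG : CondG G γ d L) (hK : 0 ≤ K) (hKL : K < L)
    (hKγ : ⌊K⌋₊ + 1 ≤ γ) (hf : Regular d K q f')
    (hae : ∀ᵐ s ∂(volume.restrict (Ioi (0 : ℝ))), f s =ᵐ[volume] f' s) {α : Fin N → ℕ}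
    (hα : (len α : ℝ) ≤ K) {t : ℝ} (ht : 0 < t) :
    IntegrableOn (fun s => moment G (f s) s α) (Ioo 0 t) := by
  obtain ⟨C, -, h⟩ := hG.exists_moment_le_EKq (q := q) hK hKL hKγ hα
  obtain ⟨M, hM, hMe⟩ := hG.exists_measurable_moment hf.meas α (by
    have := (len_le_floor hK).2 hα
    omega)
  obtain ⟨B, hB, hb⟩ := hf.bdd t ht
  have hae' : ∀ᵐ s ∂(volume.restrict (Ioo 0 t)), f s =ᵐ[volume] f' s :=
    ae_restrict_of_ae_restrict_of_subset Ioo_subset_Ioi_self hae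
  have hM' : IntegrableOn M (Ioo 0 t) := by
    refine ⟨hM.aestronglyMeasurable, ?_⟩
    rw [hasFiniteIntegral_iff_enorm]
    refine lt_of_le_of_lt (b := ∫⁻ _ in Ioo 0 t, ENNReal.ofReal |C| * B) (lintegral_mono_ae ?_) ?_
    · filter_upwards [hb, ae_restrict_mem measurableSet_Ioo] with s hs hst
      rw [hMe s hst.1, Real.enorm_eq_ofReal_abs]
      refine (h f' s hst.1 (hf.measurable_section s)).trans ?_
      gcongr
      refine (mul_le_mul_of_nonneg_right (le_abs_self C) (by have := hst.1; positivity)).trans ?_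
      refine mul_le_of_le_one_right (abs_nonneg C) ?_
      refine Real.rpow_le_one_of_one_le_of_nonpos (by linarith [hst.1]) ?_
      rw [neg_div, neg_nonpos]
      exact div_nonneg (by linarith) hG.d_pos.le
    · rw [lintegral_const]
      exact ENNReal.mul_lt_top (ENNReal.mul_lt_top ENNReal.ofReal_lt_top hB.lt_top) (by simp)
  refine hM'.congr ?_
  filter_upwards [hae', ae_restrict_mem measurableSet_Ioo] with s hs hst
  rw [hMe s hst.1, moment_congr hs]

theorem CondG.remR_formula (hG : CondG G γ d L) (hK : 0 ≤ K) (hKL : K < L) (hKγ : ⌊K⌋₊ + 1 ≤ γ)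
    (hq : 1 ≤ q) (hf : Admissible d K q f) {t : ℝ} (ht : 0 < t) :
    (∀ α : Fin N → ℕ, (len α : ℝ) ≤ K →
      IntegrableOn (fun s => moment G (f s) s α) (Ioo 0 t)) ∧
    ∀ᵐ x : Sp N,
      IntegrableOn (fun s => expL G (t - s) (projP G K s (f s)) x) (Ioo 0 t) ∧
      IntegrableOn (fun s => expL G (t - s) (f s) x) (Ioo 0 t) ∧
      remR G K f t x = (∫ s in Ioo 0 t, expL G (t - s) (f s) x) -
        ∑ α ∈ multiIdx N K, (∫ s in Ioo 0 t, moment G (f s) s α) * gFun G α t x := by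
  obtain ⟨f', hf', hae⟩ := hf.exists_regular
  obtain ⟨Φ, hΦm, hΦ⟩ := hG.exists_measurable_projP hK hKγ hf'.meas
  have hmom : ∀ α : Fin N → ℕ, (len α : ℝ) ≤ K →
      IntegrableOn (fun s => moment G (f s) s α) (Ioo 0 t) := fun α hα =>
    hG.integrableOn_moment hK hKL hKγ hf' hae hα ht
  refine ⟨hmom, ?_⟩
  have hae' : ∀ᵐ s ∂(volume.restrict (Ioo 0 t)), f s =ᵐ[volume] f' s :=
    ae_restrict_of_ae_restrict_of_subset Ioo_subset_Ioi_self hae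
  have hb := hf'.bddL1 hK hG.d_pos ht
  have h1 := (hG.integrable_duhamel (w := []) (by simp) (by simpa using hG.d_pos) hΦm
    (hG.bddL1_projP hK hKL hKγ hq hf' hΦ ht)).prod_left_ae
  have h2 := (hG.integrable_duhamel (w := []) (by simp) (by simpa using hG.d_pos) hf'.meas
    hb).prod_left_ae
  have e1 := hG.ae_expL_projP_eq hae hΦ t
  have e2 : ∀ᵐ s ∂(volume.restrict (Ioo 0 t)),
      expL G (t - s) (f s) = cv (kern G d [] (t - s)) (f' s) := by
    filter_upwards [hae', ae_restrict_mem measurableSet_Ioo] with s hs hst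
    rw [expL_congr hs, hG.kern_nil (sub_pos.2 hst.2)]
    rfl
  filter_upwards [h1, h2] with x hx1 hx2
  have i1 : IntegrableOn (fun s => expL G (t - s) (projP G K s (f s)) x) (Ioo 0 t) :=
    Integrable.congr hx1 (e1.mono fun s hs => by simp only [hs, Function.uncurry])
  have i2 : IntegrableOn (fun s => expL G (t - s) (f s) x) (Ioo 0 t) :=
    Integrable.congr hx2 (e2.mono fun s hs => by simp only [hs, Function.uncurry])
  refine ⟨i1, i2, ?_⟩
  have i3 : ∀ α ∈ multiIdx N K,
      IntegrableOn (fun s => moment G (f s) s α * gFun G α t x) (Ioo 0 t) := fun α hα =>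
    (hmom α (mem_multiIdx.1 hα)).mul_const _
  simp only [← integral_mul_const]
  rw [← integral_finsetSum _ i3, ← integral_sub i2 (integrable_finsetSum _ i3)]
  refine integral_congr_ae ?_
  filter_upwards [hae', hb.ae_integrable hf'.meas, ae_restrict_mem measurableSet_Ioo]
    with s hs hi hst
  exact hG.expL_projP hK hKγ hst.1 hst.2 (hi.congr hs.symm) x

/-- Both t^{-ℓ/d} and t^{-ℓ/d}|x|^ℓ are at most the weight at scale t^{1/d} when t ≥ 1, whence the
factor 2. One norm therefore serves every ℓ in [0,K]. -/
theorem lhs_le_two_mul_zN (hd : 0 < d) {ℓ : ℝ} (hℓ0 : 0 ≤ ℓ) (hℓ : ℓ ≤ K) {t : ℝ} (ht : 1 ≤ t)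
    (ψ : Sp N → ℝ) :
    ENNReal.ofReal (t ^ ((N : ℝ) / d * (1 - (1 / q).toReal))) * eLpNorm ψ q volume +
      ENNReal.ofReal (t ^ (-ℓ / d)) * wNorm ℓ ψ ≤ 2 * zN K q (t ^ (1 / d)) ψ := by
  have ht0 : 0 < t := by linarith
  unfold zN
  rw [mul_add]
  refine add_le_add ?_ ?_
  · have : (t ^ (1 / d)) ^ (N * (1 - (1 / q).toReal)) =
        t ^ ((N : ℝ) / d * (1 - (1 / q).toReal)) := by
      rw [← Real.rpow_mul ht0.le]
      congr 1
      ring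
    rw [this, two_mul]
    exact le_self_add
  · unfold wNorm nW
    rw [← lintegral_const_mul' _ _ ENNReal.ofReal_ne_top, ← lintegral_const_mul' _ _ (by simp)]
    refine lintegral_mono fun x => ?_
    have h2 : 2 * ENNReal.ofReal (wt K (t ^ (1 / d)) x) =
        ENNReal.ofReal (2 * wt K (t ^ (1 / d)) x) := by
      rw [ENNReal.ofReal_mul zero_le_two]
      simp
    rw [mul_left_comm, mul_left_comm 2, h2, ← ENNReal.ofReal_mul (by positivity)]
    refine mul_le_mul_right (ENNReal.ofReal_le_ofReal ?_) _
    have hR : 0 < t ^ (1 / d) := by positivity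
    have h3 : t ^ (-ℓ / d) ≤ 1 := by
      refine Real.rpow_le_one_of_one_le_of_nonpos ht ?_
      rw [neg_div, neg_nonpos]
      positivity
    have h4 : 1 ≤ wt K (t ^ (1 / d)) x := one_le_wt (hℓ0.trans hℓ) hR.le x
    have h5 := pow_le_wt hℓ0 hℓ hR x
    have h6 : t ^ (-ℓ / d) * (t ^ (1 / d)) ^ ℓ = 1 := by
      rw [← Real.rpow_mul ht0.le, ← Real.rpow_add ht0]
      have : -ℓ / d + 1 / d * ℓ = 0 := by ring
      rw [this, Real.rpow_zero]
    have h7 : t ^ (-ℓ / d) * ‖x‖ ^ ℓ ≤ wt K (t ^ (1 / d)) x := by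
      refine (mul_le_mul_of_nonneg_left h5 (by positivity)).trans_eq ?_
      rw [← mul_assoc, h6, one_mul]
    linarith

theorem zN_mono_ae {R : ℝ} {φ ψ : Sp N → ℝ} (h : ∀ᵐ x, ‖φ x‖ₑ ≤ ‖ψ x‖ₑ) :
    zN K q R φ ≤ zN K q R ψ := by
  unfold zN nW
  refine add_le_add (mul_le_mul_right (eLpNorm_mono_enorm_ae h) _) (lintegral_mono_ae ?_)
  filter_upwards [h] with x hx
  gcongr

theorem CondG.measurable_duhamel (hG : CondG G γ d L) (hΦ : Measurable (Function.uncurry Φ))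
    {w : List (Fin N)} (hw : w.length ≤ γ) (t : ℝ) : Measurable (duhamel G d Φ t w) :=
  (measurable_cv_kern (hG.measurable_kern hw) hΦ t).stronglyMeasurable.integral_prod_left'.measurable

theorem CondG.zN_weakNablaAbs_le (hG : CondG G γ d L) (hq : 1 ≤ q)
    (hΦ : Measurable (Function.uncurry Φ)) {t : ℝ} (hb : BddL1 Φ t) {j : ℕ} (hj : j ≤ γ)
    (hjd : (j : ℝ) < d) (R : ℝ) :
    zN K q R (weakNablaAbs j (duhamel G d Φ t [])) ≤
      ∑ α ∈ multiIdxEq N j, zN K q R (duhamel G d Φ t (wordOf α)) := by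
  have hα : ∀ α ∈ multiIdxEq N j, len α ≤ γ ∧ (len α : ℝ) < d := fun α hα => by
    rw [mem_multiIdxEq.1 hα]
    exact ⟨hj, hjd⟩
  have hm : ∀ α ∈ multiIdxEq N j, Measurable (duhamel G d Φ t (wordOf α)) := fun α h =>
    hG.measurable_duhamel hΦ (by rw [length_wordOf]; exact (hα α h).1) t
  have hae : ∀ᵐ x, ∀ α ∈ multiIdxEq N j,
      weakPartial α (duhamel G d Φ t []) x = duhamel G d Φ t (wordOf α) x :=
    (Finset.eventually_all _).2 fun α h =>
      (hG.hasWeakPartial_duhamel (hα α h).1 (hα α h).2 hΦ hb).weakPartial_ae_eq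
  calc _ ≤ zN K q R fun x => ∑ α ∈ multiIdxEq N j, |duhamel G d Φ t (wordOf α) x| := by
        refine zN_mono_ae ?_
        filter_upwards [hae] with x hx
        have h0 : 0 ≤ weakNablaAbs j (duhamel G d Φ t []) x := Real.sqrt_nonneg _
        rw [Real.enorm_eq_ofReal h0, Real.enorm_eq_ofReal
          (Finset.sum_nonneg fun _ _ => abs_nonneg _)]
        refine ENNReal.ofReal_le_ofReal ((nablaLen_le_sum _ x).trans_eq ?_)
        exact Finset.sum_congr rfl fun α h => by rw [hx α h]
    _ ≤ ∑ α ∈ multiIdxEq N j, zN K q R fun x => |duhamel G d Φ t (wordOf α) x| :=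
        zN_sum_le hq _ fun α h => (hm α h).abs
    _ ≤ _ := Finset.sum_le_sum fun α _ => zN_mono_ae (Eventually.of_forall fun x => by simp)

theorem CondG.exists_weakNabla_bound (hG : CondG G γ d L) (hK : 0 ≤ K) (hKL : K < L)
    (hKγ : ⌊K⌋₊ + 1 ≤ γ) (hq : 1 ≤ q) {j : ℕ} (hj : j ≤ γ) (hjd : (j : ℝ) < d) {ℓ : ℝ}
    (hℓ0 : 0 ≤ ℓ) (hℓ : ℓ ≤ K) :
    ∃ C : ℝ, 0 < C ∧ ∀ f : ℝ → Sp N → ℝ, Admissible d K q f → ∀ ε : ℝ, 0 < ε → ∀ T : ℝ, 0 < T →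
      ∀ᶠ t : ℝ in atTop,
        ENNReal.ofReal (t ^ ((N : ℝ) / d * (1 - (1 / q).toReal))) *
            eLpNorm (weakNablaAbs j (remR G K f t)) q volume
          + ENNReal.ofReal (t ^ (-ℓ / d)) * wNorm ℓ (weakNablaAbs j (remR G K f t))
        ≤ ENNReal.ofReal (ε * t ^ (-(K + j) / d))
          + ENNReal.ofReal (C * t ^ (-K / d)) *
            ∫⁻ s in Ioo T t, ENNReal.ofReal ((t - s) ^ (-(j : ℝ) / d)) * EKq d K q f s := by
  have hlen : ∀ α ∈ multiIdxEq N j, (wordOf α).length = j := fun α hα => by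
    rw [length_wordOf, mem_multiIdxEq.1 hα]
  have h : ∀ α ∈ multiIdxEq N j, _ := fun α hα =>
    hG.exists_zN_duhamel_le hK hKL hKγ hq (w := wordOf α) (by rw [hlen α hα]; exact hj)
  choose! C hC h using h
  set n := (multiIdxEq N j).card with hn
  have hS : 2 * ∑ α ∈ multiIdxEq N j, C α ≠ ∞ :=
    ENNReal.mul_ne_top (by simp) (ENNReal.sum_ne_top.2 hC)
  refine ⟨(2 * ∑ α ∈ multiIdxEq N j, C α).toReal + 1, by positivity, fun f hf ε hε T hT => ?_⟩
  obtain ⟨f', hf', hae⟩ := hf.exists_regular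
  obtain ⟨Φ, hΦm, hΦ⟩ := hG.exists_measurable_projP hK hKγ hf'.meas
  have hev : ∀ᶠ t : ℝ in atTop, ∀ α ∈ multiIdxEq N j, _ := (Finset.eventually_all _).2 fun α hα =>
    -- There are n multi-indices and an overall factor 2; n+1 avoids a zero denominator.
    h α hα f' Φ hf' hΦm hΦ (ε / (2 * (n + 1))) (by positivity) T hT
  filter_upwards [hev, eventually_ge_atTop 1] with t hev ht1
  have ht0 : 0 < t := by linarith
  rw [hG.remR_eq_duhamel hae hΦ t]
  refine (lhs_le_two_mul_zN hG.d_pos hℓ0 hℓ ht1 _).trans ?_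
  set X := ENNReal.ofReal (t ^ (-K / d)) *
    ∫⁻ s in Ioo T t, ENNReal.ofReal ((t - s) ^ (-(j : ℝ) / d)) * EKq d K q f s with hX
  have hEq : ∫⁻ s in Ioo T t, ENNReal.ofReal ((t - s) ^ (-(j : ℝ) / d)) * EKq d K q f' s =
      ∫⁻ s in Ioo T t, ENNReal.ofReal ((t - s) ^ (-(j : ℝ) / d)) * EKq d K q f s := by
    refine lintegral_congr_ae ?_
    have hae' : ∀ᵐ s ∂(volume.restrict (Ioo T t)), f s =ᵐ[volume] f' s :=
      ae_restrict_of_ae_restrict_of_subset (fun s hs => hT.trans hs.1) hae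
    filter_upwards [hae'] with s hs
    rw [EKq_congr hs]
  set Y := ENNReal.ofReal (ε / (2 * (n + 1)) * t ^ (-(K + j) / d)) with hY
  have hα : ∀ α ∈ multiIdxEq N j,
      zN K q (t ^ (1 / d)) (duhamel G d Φ t (wordOf α)) ≤ Y + C α * X := fun α hα => by
    have := hev α hα
    rwa [hlen α hα, hEq] at this
  calc _ ≤ 2 * ∑ α ∈ multiIdxEq N j, (Y + C α * X) := by
        gcongr
        exact (hG.zN_weakNablaAbs_le hq hΦm (hG.bddL1_projP hK hKL hKγ hq hf' hΦ ht0) hj hjd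
          _).trans (Finset.sum_le_sum hα)
    _ = 2 * (n * Y) + (2 * ∑ α ∈ multiIdxEq N j, C α) * X := by
        rw [Finset.sum_add_distrib, Finset.sum_const, ← Finset.sum_mul, nsmul_eq_mul, mul_add,
          mul_assoc]
    _ ≤ _ := by
        refine add_le_add ?_ ?_
        · have e : (2 : ℝ≥0∞) * (n * Y) =
              ENNReal.ofReal (2 * (n * (ε / (2 * (n + 1)) * t ^ (-(K + j) / d)))) := by
            rw [ENNReal.ofReal_mul (by norm_num), ENNReal.ofReal_mul (by positivity), hY]
            simp
          rw [e]
          refine ENNReal.ofReal_le_ofReal ?_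
          have e2 : 2 * (n * (ε / (2 * (n + 1)) * t ^ (-(K + j) / d))) =
              (n / (n + 1)) * (ε * t ^ (-(K + j) / d)) := by
            field_simp
          rw [e2]
          refine mul_le_of_le_one_left (by positivity) ?_
          rw [div_le_one (by positivity)]
          linarith
        · rw [ENNReal.ofReal_mul (by positivity), mul_assoc (ENNReal.ofReal _)]
          refine mul_le_mul_left ?_ _
          rw [ENNReal.ofReal_add ENNReal.toReal_nonneg zero_le_one, ENNReal.ofReal_toReal hS]
          exact le_self_add

/-! ### The limit for integrable E_{K,q}. -/

theorem tendsto_lintegral_Ioi_zero {E : ℝ → ℝ≥0∞} (hE : Measurable E)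
    (hfin : ∫⁻ s in Ioi (0 : ℝ), E s ≠ ∞) :
    Tendsto (fun T : ℝ => ∫⁻ s in Ioi (0 : ℝ), (Ioi T).indicator E s) atTop (𝓝 0) := by
  rw [← lintegral_zero (μ := volume.restrict (Ioi (0 : ℝ)))]
  refine tendsto_lintegral_filter_of_dominated_convergence E
    (Eventually.of_forall fun T => hE.indicator measurableSet_Ioi)
    (Eventually.of_forall fun T => Eventually.of_forall fun s => indicator_le_self _ _ _) hfin
    (Eventually.of_forall fun s => ?_)
  refine tendsto_const_nhds.congr' ?_
  filter_upwards [eventually_ge_atTop s] with T hT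
  exact (indicator_of_notMem (not_lt.2 hT) _).symm

theorem CondG.tendsto_remR (hG : CondG G γ d L) (hK : 0 ≤ K) (hKL : K < L)
    (hKγ : ⌊K⌋₊ + 1 ≤ γ) (hq : 1 ≤ q) (hf : Admissible d K q f)
    (hfin : ∫⁻ s in Ioi (0 : ℝ), EKq d K q f s < ∞) {ℓ : ℝ} (hℓ0 : 0 ≤ ℓ) (hℓ : ℓ ≤ K) :
    Tendsto (fun t : ℝ => ENNReal.ofReal (t ^ (K / d)) *
        (ENNReal.ofReal (t ^ ((N : ℝ) / d * (1 - (1 / q).toReal))) *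
            eLpNorm (remR G K f t) q volume
          + ENNReal.ofReal (t ^ (-ℓ / d)) * wNorm ℓ (remR G K f t)))
      atTop (𝓝 0) := by
  obtain ⟨f', hf', hae⟩ := hf.exists_regular
  obtain ⟨Φ, hΦm, hΦ⟩ := hG.exists_measurable_projP hK hKγ hf'.meas
  obtain ⟨C, hC, h⟩ := hG.exists_zN_duhamel_le hK hKL hKγ hq (w := []) (by simp)
  have hfin' : ∫⁻ s in Ioi (0 : ℝ), EKq d K q f' s ≠ ∞ := by
    rw [← lintegral_congr_ae (hae.mono fun s hs => EKq_congr hs)]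
    exact hfin.ne
  have htail := ENNReal.Tendsto.const_mul (a := 2 * C)
    (tendsto_lintegral_Ioi_zero (measurable_EKq hf'.meas) hfin')
    (Or.inr (ENNReal.mul_ne_top (by simp) hC))
  rw [mul_zero] at htail
  rw [ENNReal.tendsto_nhds_zero] at htail ⊢
  intro ε hε
  rcases eq_or_ne ε ∞ with rfl | hεt
  · exact Eventually.of_forall fun _ => le_top
  have hε4 : ε / 4 ≠ ∞ := ENNReal.div_ne_top hεt (by simp)
  have hε4' : 0 < ε / 4 := ENNReal.div_pos hε.ne' (by simp)
  -- T makes the tail of ∫ E_{K,q}, with its constant 2C, at most ε/4; the early part contributes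
  -- 2(ε/4). For order 0 the singular factor (t-s)^{-j/d} is 1, so the tail alone controls the late
  -- part.
  obtain ⟨T, hTε, hT⟩ := ((htail (ε / 4) hε4').and (eventually_gt_atTop 0)).exists
  have hev := h f' Φ hf' hΦm hΦ (ε / 4).toReal (ENNReal.toReal_pos hε4'.ne' hε4) T hT
  filter_upwards [hev, eventually_ge_atTop 1] with t hev ht1
  have ht0 : 0 < t := by linarith
  simp only [List.length_nil, Nat.cast_zero, add_zero, neg_zero, zero_div, Real.rpow_zero,
    ENNReal.ofReal_one, one_mul] at hev
  have hI : ∫⁻ s in Ioo T t, EKq d K q f' s ≤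
      ∫⁻ s in Ioi (0 : ℝ), (Ioi T).indicator (EKq d K q f') s := by
    rw [lintegral_indicator measurableSet_Ioi, Measure.restrict_restrict measurableSet_Ioi]
    exact lintegral_mono_set fun s hs => ⟨hs.1, hT.trans hs.1⟩
  have e1 : ENNReal.ofReal (t ^ (K / d)) * ENNReal.ofReal (t ^ (-K / d)) = 1 := by
    rw [ofReal_rpow_mul_rpow ht0, ← add_div, add_neg_cancel, zero_div, Real.rpow_zero,
      ENNReal.ofReal_one]
  rw [hG.remR_eq_duhamel hae hΦ t]
  calc _ ≤ ENNReal.ofReal (t ^ (K / d)) * (2 * (ENNReal.ofReal ((ε / 4).toReal * t ^ (-K / d)) +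
        C * (ENNReal.ofReal (t ^ (-K / d)) * ∫⁻ s in Ioo T t, EKq d K q f' s))) := by
        gcongr
        exact (lhs_le_two_mul_zN hG.d_pos hℓ0 hℓ ht1 _).trans (mul_le_mul_right hev _)
    _ = (ENNReal.ofReal (t ^ (K / d)) * ENNReal.ofReal (t ^ (-K / d))) * (2 * (ε / 4)) +
        (ENNReal.ofReal (t ^ (K / d)) * ENNReal.ofReal (t ^ (-K / d))) *
          (2 * C * ∫⁻ s in Ioo T t, EKq d K q f' s) := by
        rw [ENNReal.ofReal_mul ENNReal.toReal_nonneg, ENNReal.ofReal_toReal hε4]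
        ring
    _ ≤ 2 * (ε / 4) + ε / 4 := by
        rw [e1, one_mul, one_mul]
        gcongr
        exact (mul_le_mul_right hI _).trans hTε
    _ ≤ 4 * (ε / 4) := by
        have : (4 : ℝ≥0∞) * (ε / 4) = 2 * (ε / 4) + ε / 4 + ε / 4 := by ring
        rw [this]
        exact le_self_add
    _ = ε := ENNReal.mul_div_cancel (by simp) (by simp)

end Remainder

end GenHeat

end

/-! ### Assembly of the theorem. -/

theorem theorem1p2 (N : ℕ) (hN : 1 ≤ N) (G : ℝ → GenHeat.Sp N → ℝ) (γ : ℕ) (d L : ℝ)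
    (hG : GenHeat.CondG G γ d L) (K : ℝ) (hK0 : 0 ≤ K) (hKL : K < L) (hKγ : ⌊K⌋₊ + 1 ≤ γ)
    (q : ℝ≥0∞) (hq : 1 ≤ q) :
    -- (i) the bound on the moments
    (∀ α : Fin N → ℕ, (GenHeat.len α : ℝ) ≤ K →
      ∃ C₁ : ℝ, 0 < C₁ ∧ ∀ f : ℝ → GenHeat.Sp N → ℝ, GenHeat.Admissible d K q f →
        ∀ᵐ t ∂(volume.restrict (Ioi (0 : ℝ))),
          ENNReal.ofReal |GenHeat.moment G (f t) t α| ≤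
            ENNReal.ofReal (C₁ * (1 + t) ^ (-(K - (GenHeat.len α : ℝ)) / d)) *
              GenHeat.EKq d K q f t) ∧
    -- (ii) the remainder is well defined, with its two expressions
    (∀ f : ℝ → GenHeat.Sp N → ℝ, GenHeat.Admissible d K q f → ∀ t : ℝ, 0 < t →
      (∀ α : Fin N → ℕ, (GenHeat.len α : ℝ) ≤ K →
        IntegrableOn (fun s => GenHeat.moment G (f s) s α) (Ioo 0 t)) ∧
      ∀ᵐ x : GenHeat.Sp N,
        IntegrableOn (fun s => GenHeat.expL G (t - s) (GenHeat.projP G K s (f s)) x)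
          (Ioo 0 t) ∧
        IntegrableOn (fun s => GenHeat.expL G (t - s) (f s) x) (Ioo 0 t) ∧
        GenHeat.remR G K f t x =
          (∫ s in Ioo 0 t, GenHeat.expL G (t - s) (f s) x) -
            ∑ α ∈ GenHeat.multiIdx N K,
              (∫ s in Ioo 0 t, GenHeat.moment G (f s) s α) * GenHeat.gFun G α t x) ∧
    -- (ii) existence of the weak derivatives, and the epsilon-bound
    (∀ j : ℕ, j ≤ γ → (j : ℝ) < d →
      (∀ f : ℝ → GenHeat.Sp N → ℝ, GenHeat.Admissible d K q f → ∀ t : ℝ, 0 < t →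
        ∀ α : Fin N → ℕ, GenHeat.len α = j →
          ∃ w, GenHeat.HasWeakPartial α (GenHeat.remR G K f t) w) ∧
      ∀ ℓ : ℝ, 0 ≤ ℓ → ℓ ≤ K → ∀ T₀ : ℝ, 0 < T₀ →
        ∃ C₂ : ℝ, 0 < C₂ ∧ ∀ f : ℝ → GenHeat.Sp N → ℝ, GenHeat.Admissible d K q f →
          ∀ ε : ℝ, 0 < ε → ∀ T : ℝ, T₀ ≤ T → ∀ᶠ t : ℝ in atTop,
            ENNReal.ofReal (t ^ ((N : ℝ) / d * (1 - (1 / q).toReal))) *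
                eLpNorm (GenHeat.weakNablaAbs j (GenHeat.remR G K f t)) q volume
              + ENNReal.ofReal (t ^ (-ℓ / d)) *
                GenHeat.wNorm ℓ (GenHeat.weakNablaAbs j (GenHeat.remR G K f t))
            ≤ ENNReal.ofReal (ε * t ^ (-(K + j) / d))
              + ENNReal.ofReal (C₂ * t ^ (-K / d)) *
                ∫⁻ s in Ioo T t, ENNReal.ofReal ((t - s) ^ (-(j : ℝ) / d)) *
                  GenHeat.EKq d K q f s) ∧
    -- (ii) the limit when `E_{K,q}[f]` is integrable on `(0, ∞)`
    (∀ f : ℝ → GenHeat.Sp N → ℝ, GenHeat.Admissible d K q f →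
      (∫⁻ s in Ioi (0 : ℝ), GenHeat.EKq d K q f s) < ∞ →
      ∀ ℓ : ℝ, 0 ≤ ℓ → ℓ ≤ K →
        Tendsto (fun t : ℝ => ENNReal.ofReal (t ^ (K / d)) *
            (ENNReal.ofReal (t ^ ((N : ℝ) / d * (1 - (1 / q).toReal))) *
                eLpNorm (GenHeat.remR G K f t) q volume
              + ENNReal.ofReal (t ^ (-ℓ / d)) * GenHeat.wNorm ℓ (GenHeat.remR G K f t)))
          atTop (𝓝 0)) := by
  refine ⟨fun α hα => ?_, fun f hf t ht => hG.remR_formula hK0 hKL hKγ hq hf ht,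
    fun j hj hjd => ⟨fun f hf t ht α hα => ?_, fun ℓ hℓ0 hℓ T₀ hT₀ => ?_⟩,
    fun f hf hfin ℓ hℓ0 hℓ => hG.tendsto_remR hK0 hKL hKγ hq hf hfin hℓ0 hℓ⟩
  · obtain ⟨C, hC, h⟩ := hG.exists_moment_le_EKq (q := q) hK0 hKL hKγ hα
    refine ⟨C, hC, fun f hf => ?_⟩
    obtain ⟨f', hf', hae⟩ := hf.exists_regular
    filter_upwards [hae, ae_restrict_mem measurableSet_Ioi] with t ht ht0
    rw [GenHeat.moment_congr ht, GenHeat.EKq_congr ht]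
    exact h f' t ht0 (hf'.measurable_section t)
  · obtain ⟨f', hf', hae⟩ := hf.exists_regular
    obtain ⟨Φ, hΦm, hΦ⟩ := hG.exists_measurable_projP hK0 hKγ hf'.meas
    rw [hG.remR_eq_duhamel hae hΦ t]
    exact ⟨_, hG.hasWeakPartial_duhamel (by rwa [hα]) (by rwa [hα]) hΦm
      (hG.bddL1_projP hK0 hKL hKγ hq hf' hΦ ht)⟩
  · obtain ⟨C, hC, h⟩ := hG.exists_weakNabla_bound hK0 hKL hKγ hq hj hjd hℓ0 hℓ
    -- The constant is uniform in T > 0, so T₀ serves only to guarantee that T is positive.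
    exact ⟨C, hC, fun f hf ε hε T hT => h f hf ε hε T (hT₀.trans_le hT)⟩
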